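/- Fix an integer $q\ge 2$. A formula in the variables $x_1,\dots,x_n,z$ is an arithmetic circuit with $\times$ gates of fan-in two, $+$ gates of unbounded fan-in (each taking any given terminal node at most once as an input), and terminal nodes that are variables or the constant $1$, in which every gate has fan-out at most one; its size $s$ is the number of its gates, and it computes a polynomial $F(x_1,\dots,x_n,z)$ with integer coefficients. A monomial in $x_1,\dots,x_n$ is a $q$-monomial if every variable occurring in it has exponent between $1$ and $q-1$. There are a deterministic algorithm (a random access machine program, with time measured by the logarithmic, i.e. bit-length, cost) and constants $C,c$, all depending only on $q$, such that for all integers $n,k,t\ge 0$ and every formula of size $s$ computing $F(x_1,\dots,x_n,z)$, the algorithm, given $n$, $k$, $t$ and the formula, decides whether the expansion of $F$ into a sum of monomials contains, with nonzero coefficient, a monomial $z^t\pi$ where $\pi$ is a $q$-monomial of degree $k$ in the $x$-variables, and does so in time at most $$C\,(n+k+1)^{c}\cdot \max(t,1)^2\cdot 5.44^{k}\cdot \max(s,1)^4 .$$ In other words, the running time is $O^*(t^2\,5.44^k s^4)$, where $O^*$ suppresses factors polynomial in $n$ and $k$. -/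

import Mathlib

/-! ### Arithmetic formulas -/

/-- Formulas in the variables `x_1, …, x_n, z`: `×` gates of fan-in two, `+` gates of unbounded
fan-in, and terminal nodes. Only terminals may have fan-out larger than one, so a formula is a tree
of gates whose leaves are occurrences of terminals. A terminal is a variable or the constant `1`. -/
inductive Formula (n : ℕ) : Type
  | one : Formula n
  | z : Formula n
  | x (i : Fin n) : Formula n
  | mul (a b : Formula n) : Formula n
  | add (m : ℕ) (f : Fin m → Formula n) : Formula n

namespace Formula

/-- The size of a formula: the number of its gates (terminals are not gates). -/
def size {n : ℕ} : Formula n → ℕ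
  | one => 0
  | z => 0
  | x _ => 0
  | mul a b => a.size + b.size + 1
  | add _ f => (∑ i, (f i).size) + 1

/-- The underlying directed graph has no parallel edges into a `+` gate: no `+` gate takes the same
terminal (a subformula without gates) twice as an input. -/
def IsSimple {n : ℕ} : Formula n → Prop
  | one => True
  | z => True
  | x _ => True
  | mul a b => a.IsSimple ∧ b.IsSimple
  | add _ f => (∀ i, (f i).IsSimple) ∧ ∀ i j, (f i).size = 0 → f i = f j → i = j

/-- The polynomial computed by a formula; the variable `z` has index `none` and `x_i` has index
`some i`. -/
noncomputable def poly {n : ℕ} : Formula n → MvPolynomial (Option (Fin n)) ℤ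
  | one => 1
  | z => MvPolynomial.X none
  | x i => MvPolynomial.X (some i)
  | mul a b => a.poly * b.poly
  | add _ f => ∑ i, (f i).poly

/-- The description of a formula in prefix notation, as a list of natural numbers. -/
def encode {n : ℕ} : Formula n → List ℕ
  | one => [0]
  | z => [1]
  | x i => [2, (i : ℕ)]
  | mul a b => 3 :: (a.encode ++ b.encode)
  | add m f => 4 :: m :: (List.ofFn fun i => (f i).encode).flatten

end Formula

/-! ### Monomials -/

/-- A monomial, given by its exponents, is a `q`-monomial if every variable that occurs in it has
an exponent between `1` and `q - 1`. -/
def IsQMonomial (q : ℕ) {n : ℕ} (p : Fin n →₀ ℕ) : Prop :=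
  ∀ i ∈ p.support, 1 ≤ p i ∧ p i ≤ q - 1

/-- The expansion of `F` contains a monomial `z ^ t * π` with `π` a `q`-monomial of degree `k` in
the `x`-variables. -/
def HasMarkedQMonomial (q k t : ℕ) {n : ℕ} (F : MvPolynomial (Option (Fin n)) ℤ) : Prop :=
  ∃ p : Fin n →₀ ℕ, IsQMonomial q p ∧ p.degree = k ∧
    Finsupp.single none t + p.mapDomain some ∈ F.support

/-! ### Random access machines with logarithmic cost -/

namespace RAM

/-- Registers and main memory, both holding natural numbers. A program refers to finitely many
registers, by fixed names; memory cells are addressed by register contents. -/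
structure State where
  reg : ℕ → ℕ
  mem : ℕ → ℕ

/-- The length charged for a number, its number of bits plus one. -/
def len (a : ℕ) : ℕ := Nat.size a + 1

/-- The arithmetic operations: addition, truncated subtraction, multiplication, and integer
quotient. -/
inductive Op
  | add
  | sub
  | mul
  | div

/-- The result of an arithmetic operation. -/
def Op.eval : Op → ℕ → ℕ → ℕ
  | add, a, b => a + b
  | sub, a, b => a - b
  | mul, a, b => a * b
  | div, a, b => a / b

/-- The bit cost of an arithmetic operation: linear for addition and subtraction, that of the
schoolbook algorithms for multiplication and division. -/
def Op.cost : Op → ℕ → ℕ → ℕ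
  | add, a, b => len a + len b
  | sub, a, b => len a + len b
  | mul, a, b => len a * len b
  | div, a, b => len a * len b

/-- Programs. `const r c` puts the constant `c` into register `r`; `op o r a b` puts the result of
`o` on registers `a`, `b` into register `r`; `load r a` reads into register `r` the memory cell whose
address is in register `a`; `store a r` writes register `r` to the cell whose address is in register
`a`; `ite r P Q` runs `P` if register `r` is nonzero and `Q` otherwise; `loop r P` repeats `P` as long
as register `r` is nonzero. -/
inductive Prog
  | skip
  | const (r c : ℕ)
  | op (o : Op) (r a b : ℕ)
  | load (r a : ℕ)
  | store (a r : ℕ)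
  | seq (P Q : Prog)
  | ite (r : ℕ) (P Q : Prog)
  | loop (r : ℕ) (P : Prog)

/-- The state after register `r` has been set to `v`. -/
def State.setReg (s : State) (r v : ℕ) : State := ⟨Function.update s.reg r v, s.mem⟩

/-- The state after memory cell `a` has been set to `v`. -/
def State.setMem (s : State) (a v : ℕ) : State := ⟨s.reg, Function.update s.mem a v⟩

/-- `Exec P s s' T`: program `P`, started in state `s`, halts in state `s'` after time `T`, where
every step is charged the lengths of the numbers and memory addresses that it handles. -/
inductive Exec : Prog → State → State → ℕ → Prop
  | skip (s) : Exec .skip s s 1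
  | const (s r c) : Exec (.const r c) s (s.setReg r c) (len c)
  | op (s o r a b) : Exec (.op o r a b) s
      (s.setReg r (o.eval (s.reg a) (s.reg b))) (o.cost (s.reg a) (s.reg b))
  | load (s r a) : Exec (.load r a) s
      (s.setReg r (s.mem (s.reg a))) (len (s.reg a) + len (s.mem (s.reg a)))
  | store (s a r) : Exec (.store a r) s
      (s.setMem (s.reg a) (s.reg r)) (len (s.reg a) + len (s.reg r))
  | seq {P Q s s₁ s₂ T₁ T₂} : Exec P s s₁ T₁ → Exec Q s₁ s₂ T₂ → Exec (.seq P Q) s s₂ (T₁ + T₂)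
  | ite_true {r P Q s s' T} : s.reg r ≠ 0 → Exec P s s' T →
      Exec (.ite r P Q) s s' (len (s.reg r) + T)
  | ite_false {r P Q s s' T} : s.reg r = 0 → Exec Q s s' T →
      Exec (.ite r P Q) s s' (len (s.reg r) + T)
  | loop_done {r P s} : s.reg r = 0 → Exec (.loop r P) s s (len (s.reg r))
  | loop_step {r P s s₁ s₂ T₁ T₂} : s.reg r ≠ 0 → Exec P s s₁ T₁ → Exec (.loop r P) s₁ s₂ T₂ →
      Exec (.loop r P) s s₂ (len (s.reg r) + T₁ + T₂)

/-- Programs are deterministic: the final state and the running time are determined by the program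
and the initial state. -/
theorem Exec.deterministic {P : Prog} {s s₁ s₂ : State} {T₁ T₂ : ℕ}
    (h₁ : Exec P s s₁ T₁) (h₂ : Exec P s s₂ T₂) : s₁ = s₂ ∧ T₁ = T₂ := by
  induction h₁ generalizing s₂ T₂ with
  | skip | const | op | load | store => cases h₂; exact ⟨rfl, rfl⟩
  | seq _ _ ih₁ ih₂ =>
    cases h₂ with
    | seq h h' =>
      obtain ⟨rfl, rfl⟩ := ih₁ h
      obtain ⟨rfl, rfl⟩ := ih₂ h'
      exact ⟨rfl, rfl⟩
  | ite_true hr _ ih =>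
    cases h₂ with
    | ite_true _ h => obtain ⟨rfl, rfl⟩ := ih h; exact ⟨rfl, rfl⟩
    | ite_false h0 _ => exact absurd h0 hr
  | ite_false hr _ ih =>
    cases h₂ with
    | ite_true h0 _ => exact absurd hr h0
    | ite_false _ h => obtain ⟨rfl, rfl⟩ := ih h; exact ⟨rfl, rfl⟩
  | loop_done hr =>
    cases h₂ with
    | loop_done _ => exact ⟨rfl, rfl⟩
    | loop_step h0 _ _ => exact absurd hr h0
  | loop_step hr _ _ ih₁ ih₂ =>
    cases h₂ with
    | loop_done h0 => exact absurd h0 hr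
    | loop_step _ h h' =>
      obtain ⟨rfl, rfl⟩ := ih₁ h
      obtain ⟨rfl, rfl⟩ := ih₂ h'
      exact ⟨rfl, rfl⟩

/-- The initial state on an input word: the input stands at the beginning of the memory, and
everything else is zero. -/
def State.init (w : List ℕ) : State := ⟨fun _ => 0, fun a => w.getD a 0⟩

end RAM

/-- The input of the testing problem: `n`, `k`, `t` and the description of the formula. -/
def inputWord {n : ℕ} (k t : ℕ) (φ : Formula n) : List ℕ := n :: k :: t :: φ.encode

namespace RAM

/-! Give each variable `r = q - 1` copies, numbered `i * r + j`, and multiply the formula out into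
words: one summand is chosen at every `+` gate and one copy at every variable. A formula has no
negative constants, so nothing cancels, and a monomial occurs exactly when some word produces it. An
exponent is at most `q - 1` exactly when its occurrences can be assigned distinct copies. The
question becomes whether some word has `t` letters `z` and exactly `k` copies of variables, all
distinct (`hasMarkedQMonomial_iff`).

Distinctness is tested with exterior algebra. Copy `α` stands for the vector `(1, α, …, α ^ (k -
1))`, multiplied into each of two exterior algebras of dimension `2 ^ k`. After `k` copies the
coefficient in top degree of both is the square of a Vandermonde determinant: nonnegative, and
nonzero iff the copies are distinct. Any other number of copies contributes zero there. With
`z`-degrees recorded up to `t`, the sum of these squares over all words is a nonnegative integer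
that vanishes iff the answer is no (`wordAct_cell`, `act_eq_sum_words`). It is below the modulus
`M`, so residues suffice (`act_apply_eq_zero_iff`).

The sum is computed without listing words. A formula is read as a series-parallel network whose
nodes carry vectors with about `t * 4 ^ k` entries: a `×` gate splits an edge at a new node, a `+`
gate makes edges parallel, and a terminal edge adds the image of its source to its target
(`processes_encode`). Two general elements are never multiplied, only a vector by a rank-one
generator, at a cost of about `k * t * 4 ^ k` steps per edge. This gives `4 ^ k`, below `5.44 ^ k`.

For the time bound, all numbers stay below `Y`, whose length is linear in `s` and `log t` up to
factors polynomial in `n` and `k`. A step costs at most `len Y ^ 2` and there are about `s * t * 4 ^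
k` steps; since `(log t) ^ 2 = O(t)`, the total is of order `t ^ 2 * 4 ^ k * s ^ 3`. -/

theorem len_mono {a b : ℕ} (h : a ≤ b) : len a ≤ len b :=
  Nat.add_le_add_right (Nat.size_le_size h) 1

@[simp] theorem State.setReg_reg (s : State) (r v x : ℕ) :
    (s.setReg r v).reg x = if x = r then v else s.reg x := by
  simp [State.setReg, Function.update_apply]

@[simp] theorem State.setReg_mem (s : State) (r v : ℕ) : (s.setReg r v).mem = s.mem := rfl

@[simp] theorem State.setMem_reg (s : State) (a v : ℕ) : (s.setMem a v).reg = s.reg := rfl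

@[simp] theorem State.setMem_mem (s : State) (a v x : ℕ) :
    (s.setMem a v).mem x = if x = a then v else s.mem x := by
  simp [State.setMem, Function.update_apply]

/-! ### A weakest-precondition calculus that counts steps -/

/-- All registers and memory cells hold numbers below `Y`. -/
def State.Bd (Y : ℕ) (s : State) : Prop := (∀ r, s.reg r < Y) ∧ ∀ a, s.mem a < Y

theorem State.Bd.setReg {Y : ℕ} {s : State} (h : s.Bd Y) {r v : ℕ} (hv : v < Y) :
    (s.setReg r v).Bd Y :=
  ⟨fun x => by rw [State.setReg_reg]; split <;> simp [hv, h.1], h.2⟩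

theorem State.Bd.setMem {Y : ℕ} {s : State} (h : s.Bd Y) {a v : ℕ} (hv : v < Y) :
    (s.setMem a v).Bd Y :=
  ⟨h.1, fun x => by rw [State.setMem_mem]; split <;> simp [hv, h.2]⟩

/-- From a state with all numbers below `Y`, the program halts in such a state, after `N` steps of
cost at most `len Y ^ 2` each, and the final state and `N` satisfy `Q`. -/
def WP (Y : ℕ) (P : Prog) (s : State) (Q : State → ℕ → Prop) : Prop :=
  s.Bd Y → ∃ s' N T, Exec P s s' T ∧ T ≤ N * len Y ^ 2 ∧ s'.Bd Y ∧ Q s' N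

/-- The weakest precondition, computed along the structure of the program down to its loops. -/
def Prog.wp (Y : ℕ) : Prog → State → (State → ℕ → Prop) → Prop
  | .skip, s, Q => Q s 1
  | .const r c, s, Q => c < Y ∧ Q (s.setReg r c) 1
  | .op .add r a b, s, Q => s.reg a + s.reg b < Y ∧ Q (s.setReg r (s.reg a + s.reg b)) 1
  | .op .mul r a b, s, Q => s.reg a * s.reg b < Y ∧ Q (s.setReg r (s.reg a * s.reg b)) 1
  | .op .sub r a b, s, Q => Q (s.setReg r (s.reg a - s.reg b)) 1
  | .op .div r a b, s, Q => Q (s.setReg r (s.reg a / s.reg b)) 1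
  | .load r a, s, Q => Q (s.setReg r (s.mem (s.reg a))) 1
  | .store a r, s, Q => Q (s.setMem (s.reg a) (s.reg r)) 1
  | .seq P R, s, Q => P.wp Y s fun s₁ n₁ => R.wp Y s₁ fun s₂ n₂ => Q s₂ (n₁ + n₂)
  | .ite r P R, s, Q => (s.reg r ≠ 0 → P.wp Y s fun s' n => Q s' (n + 1)) ∧
      (s.reg r = 0 → R.wp Y s fun s' n => Q s' (n + 1))
  | .loop r P, s, Q => WP Y (.loop r P) s Q

theorem two_le_len {Y a : ℕ} (h : a < Y) : 2 ≤ len Y := by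
  have : 0 < Nat.size Y := Nat.size_pos.2 (by omega)
  unfold len; omega

theorem len_le_sq {Y a : ℕ} (h : a < Y) : len a ≤ len Y ^ 2 := by
  have h1 := len_mono h.le
  nlinarith [two_le_len h]

theorem len_add_le_sq {Y a b : ℕ} (ha : a < Y) (hb : b < Y) : len a + len b ≤ len Y ^ 2 := by
  have h1 := len_mono ha.le
  have h2 := len_mono hb.le
  nlinarith [two_le_len ha]

theorem len_mul_le_sq {Y a b : ℕ} (ha : a < Y) (hb : b < Y) : len a * len b ≤ len Y ^ 2 := by
  rw [pow_two]
  exact Nat.mul_le_mul (len_mono ha.le) (len_mono hb.le)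

/-- While all numbers are below `Y`, each instruction or test costs at most `len Y ^ 2`, so time
reduces to a step count. Only constants, sums and products can leave the range; differences and
quotients never exceed their first operand, which is why they carry no side condition. -/
theorem Prog.wp_sound {Y : ℕ} {P : Prog} {s : State} {Q : State → ℕ → Prop}
    (h : P.wp Y s Q) : WP Y P s Q := by
  induction P generalizing s Q with
  | skip =>
    intro hs
    refine ⟨s, 1, 1, .skip s, ?_, hs, h⟩
    have := two_le_len (hs.1 0)
    nlinarith
  | const r c =>
    intro hs
    exact ⟨_, 1, _, .const s r c, by rw [one_mul]; exact len_le_sq h.1, hs.setReg h.1, h.2⟩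
  | op o r a b =>
    intro hs
    have ha := hs.1 a
    have hb := hs.1 b
    cases o with
    | add => exact ⟨_, 1, _, .op s .add r a b, by rw [one_mul]; exact len_add_le_sq ha hb,
        hs.setReg h.1, h.2⟩
    | sub => exact ⟨_, 1, _, .op s .sub r a b, by rw [one_mul]; exact len_add_le_sq ha hb,
        hs.setReg ((Nat.sub_le _ _).trans_lt ha), h⟩
    | mul => exact ⟨_, 1, _, .op s .mul r a b, by rw [one_mul]; exact len_mul_le_sq ha hb,
        hs.setReg h.1, h.2⟩
    | div => exact ⟨_, 1, _, .op s .div r a b, by rw [one_mul]; exact len_mul_le_sq ha hb,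
        hs.setReg ((Nat.div_le_self _ _).trans_lt ha), h⟩
  | load r a =>
    intro hs
    exact ⟨_, 1, _, .load s r a, by rw [one_mul]; exact len_add_le_sq (hs.1 _) (hs.2 _),
      hs.setReg (hs.2 _), h⟩
  | store a r =>
    intro hs
    exact ⟨_, 1, _, .store s a r, by rw [one_mul]; exact len_add_le_sq (hs.1 _) (hs.1 _),
      hs.setMem (hs.1 _), h⟩
  | seq P R ihP ihR =>
    intro hs
    obtain ⟨s₁, N₁, T₁, e₁, l₁, b₁, h₁⟩ := ihP h hs
    obtain ⟨s₂, N₂, T₂, e₂, l₂, b₂, h₂⟩ := ihR h₁ b₁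
    exact ⟨s₂, N₁ + N₂, _, .seq e₁ e₂, by rw [add_mul]; omega, b₂, h₂⟩
  | ite r P R ihP ihR =>
    intro hs
    have hr := len_le_sq (hs.1 r)
    by_cases h0 : s.reg r = 0
    · obtain ⟨s₁, N₁, T₁, e₁, l₁, b₁, h₁⟩ := ihR (h.2 h0) hs
      exact ⟨s₁, N₁ + 1, _, .ite_false h0 e₁, by rw [add_mul]; omega, b₁, h₁⟩
    · obtain ⟨s₁, N₁, T₁, e₁, l₁, b₁, h₁⟩ := ihP (h.1 h0) hs
      exact ⟨s₁, N₁ + 1, _, .ite_true h0 e₁, by rw [add_mul]; omega, b₁, h₁⟩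
  | loop r P => exact h

theorem WP.mono {Y : ℕ} {P : Prog} {s : State} {Q Q' : State → ℕ → Prop} (h : WP Y P s Q)
    (hQ : ∀ s' n, s'.Bd Y → Q s' n → Q' s' n) : WP Y P s Q' := fun hs => by
  obtain ⟨s₁, N₁, T₁, e₁, l₁, b₁, h₁⟩ := h hs
  exact ⟨s₁, N₁, T₁, e₁, l₁, b₁, hQ _ _ b₁ h₁⟩

theorem Prog.wp_mono {Y : ℕ} {P : Prog} {s : State} {Q Q' : State → ℕ → Prop} (hs : s.Bd Y)
    (h : P.wp Y s Q) (hQ : ∀ s' n, s'.Bd Y → Q s' n → Q' s' n) : P.wp Y s Q' := by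
  induction P generalizing s Q Q' with
  | skip => exact hQ _ _ hs h
  | const r c => exact ⟨h.1, hQ _ _ (hs.setReg h.1) h.2⟩
  | op o r a b =>
    cases o with
    | add => exact ⟨h.1, hQ _ _ (hs.setReg h.1) h.2⟩
    | mul => exact ⟨h.1, hQ _ _ (hs.setReg h.1) h.2⟩
    | sub => exact hQ _ _ (hs.setReg ((Nat.sub_le _ _).trans_lt (hs.1 a))) h
    | div => exact hQ _ _ (hs.setReg ((Nat.div_le_self _ _).trans_lt (hs.1 a))) h
  | load r a => exact hQ _ _ (hs.setReg (hs.2 _)) h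
  | store a r => exact hQ _ _ (hs.setMem (hs.1 _)) h
  | seq P R ihP ihR =>
    exact ihP hs h fun s₁ n₁ h₁ h' => ihR h₁ h' fun s₂ n₂ h₂ h'' => hQ _ _ h₂ h''
  | ite r P R ihP ihR =>
    exact ⟨fun h0 => ihP hs (h.1 h0) fun _ _ => hQ _ _, fun h0 => ihR hs (h.2 h0) fun _ _ => hQ _ _⟩
  | loop r P => exact WP.mono h hQ

/-- Every run preserves the bound, so it may be assumed in the postcondition. -/
theorem Prog.wp_of_bd {Y : ℕ} {P : Prog} {s : State} {Q : State → ℕ → Prop} (hs : s.Bd Y)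
    (h : P.wp Y s fun s' n => s'.Bd Y → Q s' n) : P.wp Y s Q :=
  P.wp_mono hs h fun _ _ h' h'' => h'' h'

theorem WP.loop_done {Y r : ℕ} {P : Prog} {s : State} {Q : State → ℕ → Prop}
    (h0 : s.reg r = 0) (h : Q s 1) : WP Y (.loop r P) s Q := fun hs =>
  ⟨s, 1, _, .loop_done h0, by rw [one_mul]; exact len_le_sq (hs.1 r), hs, h⟩

theorem WP.loop_step {Y r : ℕ} {P : Prog} {s : State} {Q : State → ℕ → Prop}
    (h0 : s.reg r ≠ 0)
    (h : s.Bd Y → P.wp Y s fun s₁ n₁ => WP Y (.loop r P) s₁ fun s₂ n₂ => Q s₂ (1 + n₁ + n₂)) :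
    WP Y (.loop r P) s Q := fun hs => by
  obtain ⟨s₁, N₁, T₁, e₁, l₁, b₁, h₁⟩ := Prog.wp_sound (h hs) hs
  obtain ⟨s₂, N₂, T₂, e₂, l₂, b₂, h₂⟩ := h₁ b₁
  have hr := len_le_sq (hs.1 r)
  exact ⟨s₂, _, _, .loop_step h0 e₁ e₂, by rw [add_mul, add_mul]; omega, b₂, h₂⟩

/-- A loop whose register counts down. -/
theorem WP.countdown {Y r : ℕ} {P : Prog} (Inv : ℕ → State → Prop) (b N : ℕ) {s : State}
    {Q : State → ℕ → Prop} (hr : ∀ i s, Inv i s → s.reg r = i)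
    (hb : ∀ i s, i < N → Inv (i + 1) s → s.Bd Y → P.wp Y s fun s' n => Inv i s' ∧ n ≤ b)
    (h0 : Inv N s) (hQ : ∀ s' n, Inv 0 s' → n ≤ N * (b + 1) + 1 → Q s' n) :
    WP Y (.loop r P) s Q := by
  induction N generalizing s Q with
  | zero => exact .loop_done (hr _ _ h0) (hQ _ _ h0 (by omega))
  | succ N ih =>
    intro hs
    have hr0 := hr _ _ h0
    obtain ⟨s₁, N₁, T₁, e₁, l₁, b₁, h₁, h₁'⟩ := Prog.wp_sound (hb N s (by omega) h0 hs) hs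
    obtain ⟨s₂, N₂, T₂, e₂, l₂, b₂, h₂, h₂'⟩ := ih (s := s₁)
      (Q := fun s' n => Inv 0 s' ∧ n ≤ N * (b + 1) + 1)
      (fun i s hi => hb i s (by omega)) h₁ (fun s' n h h' => ⟨h, h'⟩) b₁
    have hl := len_le_sq (hs.1 r)
    refine ⟨s₂, 1 + N₁ + N₂, _, .loop_step (by omega) e₁ e₂, by rw [add_mul, add_mul]; omega, b₂,
      hQ _ _ h₂ ?_⟩
    rw [add_mul]; omega

/-! ### The edge routine: signed shift-and-add from one block to another -/

/-- Above address `lo`, the memory cells hold the residues below `M` given by `m`. -/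
def Cells (lo M : ℕ) (mem : ℕ → ℕ) (m : ℕ → ZMod M) : Prop :=
  ∀ a, lo ≤ a → mem a < M ∧ (mem a : ZMod M) = m a

/-- The digit of `a` at position `p * 2 ^ j`. -/
def bitAt (p j a : ℕ) : ℕ := a / (p * 2 ^ j) % 2

/-- The sign picked up when passing the first `j` binary digits of `a`, counted from `p`. -/
def bitSign (R : Type*) [CommRing R] (p j a : ℕ) : R :=
  ∏ i ∈ Finset.range j, if bitAt p i a = 0 then 1 else -1

/-- The contribution of the cell `a` of a source block to a target block at address `v`. -/
def edgeTerm (R : Type*) [CommRing R] (v p o α c a : ℕ) (x : R) : ℕ → R :=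
  ∑ j ∈ Finset.range c, if bitAt p j a = 0 then
    Pi.single (v + a + o * 2 ^ j) (bitSign R p j a * (α : R) ^ j * x) else 0

/-- One step of the inner loop of `edge`. -/
def edgeStep : Prog :=
  .seq (.op .sub 31 31 5) <| .seq (.op .div 32 26 28) <| .seq (.op .div 33 32 6) <|
  .seq (.op .mul 33 33 6) <| .seq (.op .sub 32 32 33) <|
  .seq (.ite 32 (.op .sub 27 7 27) <|
    .seq (.op .add 32 21 26) <| .seq (.op .add 32 32 29) <| .seq (.load 33 32) <|
    .seq (.op .mul 34 27 30) <| .seq (.op .add 33 33 34) <| .seq (.op .div 34 33 7) <|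
    .seq (.op .mul 34 34 7) <| .seq (.op .sub 33 33 34) <| .store 32 33) <|
  .seq (.op .mul 28 28 6) <| .seq (.op .mul 29 29 6) (.op .mul 30 30 24)

/-- The block at the address in register `20` is multiplied by a label given by registers `22` to
`25`, and the result is added to the block at the address in register `21`. -/
def edge : Prog :=
  .seq (.op .add 26 10 0) <| .loop 26 <|
    .seq (.op .sub 26 26 5) <| .seq (.op .add 32 20 26) <| .seq (.load 27 32) <|
    .seq (.op .add 28 22 0) <| .seq (.op .add 29 23 0) <| .seq (.const 30 1) <|
    .seq (.op .add 31 25 0) <| .loop 31 edgeStep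

/-- Register `27` carries the source value with the sign of the digits already passed. A digit `1`
negates it; a digit `0` means that basis vector `j` is absent and may be wedged in, so a term is
written. The bound on register `27` is `≤ M`, not `< M`, because negating `0` gives `M`. -/
theorem edgeStep_wp {Y M lo : ℕ} {s₀ s : State} {Q : State → ℕ → Prop} {m : ℕ → ZMod M}
    {v p o α c a j : ℕ} {x : ZMod M}
    (h5 : s₀.reg 5 = 1) (h6 : s₀.reg 6 = 2) (h7 : s₀.reg 7 = M) (h21 : s₀.reg 21 = v)
    (h24 : s₀.reg 24 = α) (hv : lo ≤ v)
    (hp : p * 2 ^ (j + 1) < Y) (ho : o * 2 ^ (j + 1) < Y) (hα : M * α ^ j + M ≤ Y)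
    (hα' : α ^ (j + 1) < Y) (hM : 0 < M)
    (ht : bitAt p j a = 0 → v + a + o * 2 ^ j < Y)
    (hY : s.Bd Y)
    (fr : ∀ r, ¬ (26 ≤ r ∧ r ≤ 34) → s.reg r = s₀.reg r) (fm : ∀ b < lo, s.mem b = s₀.mem b)
    (r26 : s.reg 26 = a) (r28 : s.reg 28 = p * 2 ^ j) (r29 : s.reg 29 = o * 2 ^ j)
    (r30 : s.reg 30 = α ^ j) (r31 : s.reg 31 = c + 1)
    (r27 : s.reg 27 ≤ M) (r27' : (s.reg 27 : ZMod M) = bitSign _ p j a * x)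
    (hm : Cells lo M s.mem m)
    (hQ : ∀ s' n, (∀ r, ¬ (26 ≤ r ∧ r ≤ 34) → s'.reg r = s₀.reg r) →
      (∀ b < lo, s'.mem b = s₀.mem b) → s'.reg 26 = a → s'.reg 28 = p * 2 ^ (j + 1) →
      s'.reg 29 = o * 2 ^ (j + 1) → s'.reg 30 = α ^ (j + 1) → s'.reg 31 = c →
      s'.reg 27 ≤ M → (s'.reg 27 : ZMod M) = bitSign _ p (j + 1) a * x →
      Cells lo M s'.mem (m + if bitAt p j a = 0 then
        Pi.single (v + a + o * 2 ^ j) (bitSign _ p j a * (α : ZMod M) ^ j * x) else 0) →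
      n ≤ 19 → Q s' n) : edgeStep.wp Y s Q := by
  have e5 := fr 5 (by omega)
  have e6 := fr 6 (by omega)
  have e7 := fr 7 (by omega)
  have e21 := fr 21 (by omega)
  have e24 := fr 24 (by omega)
  rw [h5] at e5; rw [h6] at e6; rw [h7] at e7; rw [h21] at e21; rw [h24] at e24
  have haY : a < Y := r26 ▸ hY.1 26
  -- There is no remainder instruction, so the parity is computed as `x - x / 2 * 2`; the reduction
  -- modulo `M` further down is done in the same way.
  have hx : a / (p * 2 ^ j) / 2 * 2 ≤ a := (Nat.div_mul_le_self _ _).trans (Nat.div_le_self _ _)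
  have hmod : a / (p * 2 ^ j) - a / (p * 2 ^ j) / 2 * 2 = bitAt p j a := by
    unfold bitAt; omega
  rw [pow_succ] at hp ho hα'
  simp only [edgeStep, Prog.wp, State.setReg_reg, State.setMem_reg, State.setReg_mem,
    e5, e6, e7, e21, e24, r26, r28, r29, r30, r31, Nat.reduceEqDiff,
    if_true, if_false, hmod]
  refine ⟨by omega, fun hb => ?_, fun hb => ?_⟩
  · refine ⟨by simpa [mul_assoc] using hp, by simpa [mul_assoc] using ho, by simpa using hα', ?_⟩
    apply hQ <;> simp [r26, pow_succ, mul_assoc]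
    · intro r h1
      rw [← fr r (by omega)]
      split_ifs <;> omega
    · exact fm
    · rw [Nat.cast_sub r27, bitSign, Finset.prod_range_succ, if_neg hb, r27']
      simp [bitSign]
    · rw [if_neg hb]; simpa using hm
  · have hw : v + a + o * 2 ^ j < Y := ht hb
    obtain ⟨c1, c2⟩ := hm (v + a + o * 2 ^ j) (by omega)
    have hval : s.reg 27 * α ^ j ≤ M * α ^ j := Nat.mul_le_mul_right _ r27
    refine ⟨by omega, hw, by omega, by omega, (Nat.div_mul_le_self _ _).trans_lt (by omega),
      by simpa [mul_assoc] using hp, by simpa [mul_assoc] using ho, by simpa using hα', ?_⟩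
    apply hQ <;> simp [r26, pow_succ, mul_assoc]
    · intro r h1
      rw [← fr r (by omega)]
      split_ifs <;> omega
    · intro b hb
      rw [if_neg (by omega), fm b hb]
    · exact r27
    · rw [bitSign, Finset.prod_range_succ, if_pos hb, r27']
      simp [bitSign]
    · rw [if_pos hb]
      intro b hlb
      have := hm b hlb
      simp only [State.setMem_mem, State.setReg_mem, Pi.add_apply]
      by_cases hba : b = v + a + o * 2 ^ j
      · subst hba
        rw [if_pos rfl, Pi.single_eq_same]
        have e : ∀ z, z - z / M * M = z % M := fun z => by
          rw [Nat.mod_eq_sub_mul_div, mul_comm]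
        rw [e]
        refine ⟨Nat.mod_lt _ hM, ?_⟩
        rw [ZMod.natCast_mod]
        push_cast
        rw [c2, r27']; ring
      · rw [if_neg hba, Pi.single_eq_of_ne hba, add_zero]
        exact this

/-- Source cells are handled from the top down. Per cell the inner loop takes `20 * c + 1` steps,
its preparation `7` and the outer test `1`, which gives `20 * c + 9`. -/
theorem edge_wp {Y M lo : ℕ} {s : State} {Q : State → ℕ → Prop} {m : ℕ → ZMod M}
    {u v p o α c S : ℕ} (h0 : s.reg 0 = 0)
    (h5 : s.reg 5 = 1) (h6 : s.reg 6 = 2) (h7 : s.reg 7 = M) (h10 : s.reg 10 = S)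
    (h20 : s.reg 20 = u) (h21 : s.reg 21 = v) (h22 : s.reg 22 = p) (h23 : s.reg 23 = o)
    (h24 : s.reg 24 = α) (h25 : s.reg 25 = c) (hu : lo ≤ u) (hv : lo ≤ v) (hM : 0 < M)
    (hY : s.Bd Y) (hp : p * 2 ^ c < Y) (ho : o * 2 ^ c < Y) (hα : ∀ j ≤ c, M * α ^ j + M ≤ Y)
    (huY : u + S ≤ Y) (ht : ∀ a < S, ∀ j < c, bitAt p j a = 0 → v + a + o * 2 ^ j < Y)
    (hd : ∀ a < S, ∀ j < c, bitAt p j a = 0 → ∀ b < S, u + b ≠ v + a + o * 2 ^ j)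
    (hm : Cells lo M s.mem m)
    (hQ : ∀ s' n, (∀ r, ¬ (26 ≤ r ∧ r ≤ 34) → s'.reg r = s.reg r) →
      (∀ b < lo, s'.mem b = s.mem b) →
      Cells lo M s'.mem (m + ∑ a ∈ Finset.range S, edgeTerm _ v p o α c a (m (u + a))) →
      n ≤ S * (20 * c + 9) + 2 → Q s' n) : edge.wp Y s Q := by
  have hSY : S < Y := h10 ▸ hY.1 10
  have hpos : ∀ j ≤ c, α ^ j < Y := fun j hj => by
    have := hα j hj
    nlinarith [Nat.le_mul_of_pos_left (α ^ j) hM]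
  simp only [edge, Prog.wp, h0, h10, add_zero]
  refine ⟨hSY, ?_⟩
  refine WP.countdown (fun i s' => (∀ r, ¬ (26 ≤ r ∧ r ≤ 34) → s'.reg r = s.reg r) ∧
    (∀ b < lo, s'.mem b = s.mem b) ∧ s'.reg 26 = i ∧
    Cells lo M s'.mem (m + ∑ a ∈ Finset.Ico i S, edgeTerm _ v p o α c a (m (u + a))))
    (20 * c + 8) S (fun i s' h => h.2.2.1) ?_ ?_ ?_
  · rintro i s₁ hi ⟨fr, fm, r26, hm₁⟩ hb₁
    have e0 := fr 0 (by omega)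
    have e5 := fr 5 (by omega)
    have e20 := fr 20 (by omega)
    have e22 := fr 22 (by omega)
    have e23 := fr 23 (by omega)
    have e25 := fr 25 (by omega)
    simp only [Prog.wp, State.setReg_reg, State.setReg_mem, e0, e5, e20, e22, e23, e25, r26, h0,
      h5, h20, h22, h23, h25, Nat.reduceEqDiff, if_true, if_false, add_zero, Nat.add_sub_cancel]
    -- By `hd` no earlier write has hit the source range, so the value read is still the original
    -- one.
    have hmi : (m + ∑ a ∈ Finset.Ico (i + 1) S, edgeTerm (ZMod M) v p o α c a (m (u + a))) (u + i)
        = m (u + i) := by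
      rw [Pi.add_apply, Finset.sum_apply, Finset.sum_eq_zero, add_zero]
      intro a ha
      rw [edgeTerm, Finset.sum_apply, Finset.sum_eq_zero]
      intro j hj
      rw [Finset.mem_range] at hj
      rw [Finset.mem_Ico] at ha
      split_ifs with h
      · exact Pi.single_eq_of_ne (hd a ha.2 j hj h i hi) _
      · rfl
    refine ⟨by omega, ?_, ?_, ?_, ?_, ?_⟩
    · have := hb₁.1 22; rw [e22, h22] at this; exact this
    · have := hb₁.1 23; rw [e23, h23] at this; exact this
    · have := hα 0 (by omega); rw [pow_zero] at this; omega
    · have := hb₁.1 25; rw [e25, h25] at this; exact this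
    refine WP.countdown (fun l s' => (∀ r, ¬ (26 ≤ r ∧ r ≤ 34) → s'.reg r = s.reg r) ∧
      (∀ b < lo, s'.mem b = s.mem b) ∧ s'.reg 26 = i ∧ l ≤ c ∧
      s'.reg 28 = p * 2 ^ (c - l) ∧ s'.reg 29 = o * 2 ^ (c - l) ∧ s'.reg 30 = α ^ (c - l) ∧
      s'.reg 31 = l ∧ s'.reg 27 ≤ M ∧
      (s'.reg 27 : ZMod M) = bitSign _ p (c - l) i * m (u + i) ∧
      Cells lo M s'.mem ((m + ∑ a ∈ Finset.Ico (i + 1) S, edgeTerm _ v p o α c a (m (u + a))) +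
        edgeTerm _ v p o α (c - l) i (m (u + i))))
      19 c (fun l s' h => h.2.2.2.2.2.2.2.1) ?_ ?_ ?_
    · rintro l s₂ hl ⟨fr, fm, r26, hlc, r28, r29, r30, r31, r27, r27', hm₂⟩ hb₂
      have hcl : c - l = c - (l + 1) + 1 := by omega
      refine edgeStep_wp (s₀ := s) (c := l) (x := m (u + i)) h5 h6 h7 h21 h24 hv ?_ ?_
        (hα _ (by omega)) (hpos _ (by omega)) hM (ht i hi _ (by omega)) hb₂ fr fm r26 r28 r29 r30
        r31 r27 r27' hm₂ ?_
      · exact (Nat.mul_le_mul_left _ (Nat.pow_le_pow_right (by omega) (by omega))).trans_lt hp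
      · exact (Nat.mul_le_mul_left _ (Nat.pow_le_pow_right (by omega) (by omega))).trans_lt ho
      intro s' n fr fm q26 q28 q29 q30 q31 q27 q27' hm' hn
      rw [← hcl] at q28 q29 q30 q27'
      refine ⟨⟨fr, fm, q26, by omega, q28, q29, q30, q31, q27, q27', ?_⟩, hn⟩
      rw [hcl, edgeTerm, Finset.sum_range_succ, ← edgeTerm, ← add_assoc]
      exact hm'
    · obtain ⟨c1, c2⟩ := hm₁ (u + i) (by omega)
      rw [hmi] at c2
      simp only [State.setReg_reg, State.setReg_mem, Nat.reduceEqDiff, if_true, if_false,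
        Nat.sub_self, pow_zero, mul_one, le_refl, true_and]
      refine ⟨?_, fm, c1.le, ?_, ?_⟩
      · intro r hr
        rw [← fr r hr]
        split_ifs <;> omega
      · rw [c2, bitSign, Finset.range_zero, Finset.prod_empty, one_mul]
      · rw [edgeTerm, Finset.range_zero, Finset.sum_empty, add_zero]; exact hm₁
    · rintro s' n ⟨fr, fm, r26, -, -, -, -, -, -, -, hm'⟩ hn
      refine ⟨⟨fr, fm, r26, ?_⟩, by omega⟩
      rw [Finset.sum_eq_sum_Ico_succ_bot hi, add_comm (edgeTerm _ _ _ _ _ _ _ _), ← add_assoc]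
      exact hm'
  · simp only [State.setReg_reg, State.setReg_mem, if_true, Finset.Ico_self, Finset.sum_empty,
      add_zero]
    refine ⟨fun r hr => ?_, fun _ _ => trivial, trivial, hm⟩
    rw [if_neg (by omega)]
  · rintro s' n ⟨fr, fm, -, hm'⟩ hn
    rw [← Finset.range_eq_Ico] at hm'
    refine hQ _ _ fr fm hm' ?_
    have : S * (20 * c + 8 + 1) = S * (20 * c + 9) := rfl
    omega

end RAM

/-! ### Linear operators attached to terminals and formulas -/

open RAM

/-- The linear map by which an edge acts on the block at its source; only cells below `S` count. -/
noncomputable def edgeOp (R : Type*) [CommRing R] (S p o α c : ℕ) : (ℕ → R) →ₗ[R] (ℕ → R) where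
  toFun f := ∑ a ∈ Finset.range S, edgeTerm R 0 p o α c a (f a)
  map_add' f g := by
    rw [← Finset.sum_add_distrib]
    refine Finset.sum_congr rfl fun a _ => ?_
    simp only [edgeTerm, ← Finset.sum_add_distrib]
    refine Finset.sum_congr rfl fun j _ => ?_
    split_ifs
    · rw [← Pi.single_add, Pi.add_apply, mul_add]
    · simp
  map_smul' r f := by
    simp only [edgeTerm, Finset.smul_sum, RingHom.id_apply, smul_ite, smul_zero]
    refine Finset.sum_congr rfl fun a _ => Finset.sum_congr rfl fun j _ => ?_
    split_ifs
    · rw [← Pi.single_smul, Pi.smul_apply, smul_eq_mul, smul_eq_mul]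
      congr 1; ring
    · rfl

/-- The action of the label `1`. -/
noncomputable def opOne (R : Type*) [CommRing R] (k t : ℕ) : Module.End R (ℕ → R) :=
  edgeOp R ((t + 1) * 4 ^ k) 0 0 1 1

/-- The action of the label `z`. -/
noncomputable def opZ (R : Type*) [CommRing R] (k t : ℕ) : Module.End R (ℕ → R) :=
  edgeOp R ((t + 1) * 4 ^ k) 0 (4 ^ k) 1 1

/-- The action of the vector `(1, α, …, α ^ (k - 1))`, once in each of the two exterior algebras. -/
noncomputable def opX (R : Type*) [CommRing R] (k t α : ℕ) : Module.End R (ℕ → R) :=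
  edgeOp R ((t + 1) * 4 ^ k) (2 ^ k) (2 ^ k) α k ∘ₗ edgeOp R ((t + 1) * 4 ^ k) 1 1 α k

/-- The action of a formula. The variable `x i` acts through its `r` copies. -/
noncomputable def Formula.act (R : Type*) [CommRing R] (k t r : ℕ) {n : ℕ} :
    Formula n → Module.End R (ℕ → R)
  | one => opOne R k t
  | z => opZ R k t
  | x i => ∑ j ∈ Finset.range r, opX R k t (i * r + j)
  | mul a b => b.act R k t r ∘ₗ a.act R k t r
  | add _ f => ∑ i, (f i).act R k t r

/-! ### Parameters, memory layout and the invariant of the main loop -/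

/-- The parameters of a run: `n`, `k`, `t`, the bound `q`, and the input word. -/
structure Par where
  (n k t q : ℕ)
  (w : List ℕ)

namespace Par

variable (P : Par)

/-- A bound on the letters `α`, and the base of the modulus. -/
def B : ℕ := (P.n + 1) * P.q + 1
/-- The modulus. -/
def M : ℕ := P.B ^ (P.w.length + 2 * (P.k * P.k))
/-- The number of cells of a block that serve as sources. -/
def S : ℕ := (P.t + 1) * 4 ^ P.k
/-- The size of a block. -/
def BL : ℕ := (P.t + 2) * 4 ^ P.k
/-- The address of the first block. -/
def NB : ℕ := 3 * P.w.length
/-- A bound on the number of blocks. -/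
def NMax : ℕ := P.q * P.w.length + 2
/-- The address of a block. -/
def addr (i : ℕ) : ℕ := P.NB + i * P.BL
/-- A bound on all numbers. -/
def Y : ℕ := P.M * P.B ^ P.k + P.M + P.addr (P.NMax + 1)
/-- The memory contents given by the contents of the blocks. -/
def flat {M : ℕ} (vec : ℕ → ℕ → ZMod M) (a : ℕ) : ZMod M :=
  vec ((a - P.NB) / P.BL) ((a - P.NB) % P.BL)

theorem BL_pos : 0 < P.BL := by unfold BL; positivity

theorem B_pos : 0 < P.B := by unfold B; positivity

theorem M_pos : 0 < P.M := by have := P.B_pos; unfold M; positivity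

theorem S_le_BL : P.S ≤ P.BL := Nat.mul_le_mul_right _ (by omega)

theorem addr_mono {i j : ℕ} (h : i ≤ j) : P.addr i ≤ P.addr j :=
  Nat.add_le_add_left (Nat.mul_le_mul_right _ h) _

theorem addr_succ (i : ℕ) : P.addr (i + 1) = P.addr i + P.BL := by unfold addr; ring

theorem NB_le_addr (i : ℕ) : P.NB ≤ P.addr i := Nat.le_add_right _ _

/-- `Y` contains the address one block past `NMax`, so every address inside or at the end of an
admissible block is covered. -/
theorem addr_add_lt {i y : ℕ} (hi : i ≤ P.NMax) (hy : y ≤ P.BL) : P.addr i + y < P.Y := by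
  have h1 := P.addr_succ i
  have h2 := P.addr_mono (show i + 1 ≤ P.NMax + 1 by omega)
  have h3 := P.M_pos
  unfold Y
  omega

theorem flat_addr {M : ℕ} (vec : ℕ → ℕ → ZMod M) (i : ℕ) {y : ℕ} (hy : y < P.BL) :
    P.flat vec (P.addr i + y) = vec i y := by
  have h : P.addr i + y - P.NB = y + P.BL * i := by unfold addr; rw [mul_comm]; omega
  rw [flat, h, Nat.add_mul_div_left _ _ P.BL_pos, Nat.add_mul_mod_self_left, Nat.mod_eq_of_lt hy,
    Nat.div_eq_of_lt hy, zero_add]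

theorem exists_addr {a : ℕ} (ha : P.NB ≤ a) : ∃ i y, y < P.BL ∧ a = P.addr i + y := by
  refine ⟨(a - P.NB) / P.BL, (a - P.NB) % P.BL, Nat.mod_lt _ P.BL_pos, ?_⟩
  have := Nat.mod_add_div (a - P.NB) P.BL
  unfold addr
  rw [mul_comm] at this
  omega

theorem addr_add_inj {i j y z : ℕ} (hy : y < P.BL) (hz : z < P.BL)
    (h : P.addr i + y = P.addr j + z) : i = j ∧ y = z := by
  have h' : y + P.BL * i = z + P.BL * j := by
    unfold addr at h; rw [mul_comm _ i, mul_comm _ j]; omega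
  constructor
  · have := congrArg (· / P.BL) h'
    simpa [Nat.add_mul_div_left _ _ P.BL_pos, Nat.div_eq_of_lt hy, Nat.div_eq_of_lt hz] using this
  · have := congrArg (· % P.BL) h'
    simpa [Nat.add_mul_mod_self_left, Nat.mod_eq_of_lt hy, Nat.mod_eq_of_lt hz] using this

/-- By `ht` the shifted offset never leaves the target block, so memory addresses can be replaced by
pairs of block and offset. -/
theorem edgeTerm_addr {M : ℕ} {v p o α c a : ℕ} (x : ZMod M)
    (ht : ∀ j < c, bitAt p j a = 0 → a + o * 2 ^ j < P.BL) (i : ℕ) {y : ℕ} (hy : y < P.BL) :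
    edgeTerm (ZMod M) (P.addr v) p o α c a x (P.addr i + y) =
      if i = v then edgeTerm (ZMod M) 0 p o α c a x y else 0 := by
  simp only [edgeTerm, Finset.sum_apply]
  split_ifs with hiv
  · subst hiv
    refine Finset.sum_congr rfl fun j hj => ?_
    split_ifs with hb
    · simp only [Pi.single_apply, zero_add, add_assoc, Nat.add_left_cancel_iff]
    · rfl
  · refine Finset.sum_eq_zero fun j hj => ?_
    split_ifs with hb
    · refine Pi.single_eq_of_ne (fun h => hiv ?_) _
      rw [add_assoc] at h
      exact (P.addr_add_inj hy (ht j (Finset.mem_range.1 hj) hb) h).1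
    · rfl

/-- The registers that hold constants during the main loop. -/
structure Glob (s : State) : Prop where
  r0 : s.reg 0 = 0
  r2 : s.reg 2 = P.k
  r4 : s.reg 4 = P.q - 1
  r5 : s.reg 5 = 1
  r6 : s.reg 6 = 2
  r7 : s.reg 7 = P.M
  r8 : s.reg 8 = 2 ^ P.k
  r9 : s.reg 9 = 4 ^ P.k
  r10 : s.reg 10 = P.S
  r11 : s.reg 11 = P.BL
  r12 : s.reg 12 = P.w.length

variable {P}

theorem Glob.congr {s s' : State} (h : P.Glob s) (hr : ∀ r ≤ 12, s'.reg r = s.reg r) :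
    P.Glob s' := by
  constructor <;> rw [hr _ (by omega)]
  exacts [h.r0, h.r2, h.r4, h.r5, h.r6, h.r7, h.r8, h.r9, h.r10, h.r11, h.r12]

/-- The cost of an edge. -/
def EC (P : Par) : ℕ := P.S * (20 * (P.k + 1) + 9) + 2

/-- This lifts `edge_wp` from cells to blocks. Distinct blocks are disjoint, which supplies the
hypothesis that writes miss the source. The bound `c ≤ P.k + 1` covers both `c = k` and the case `c
= 1`, `k = 0`. -/
theorem edge_block_wp {s : State} {Q : State → ℕ → Prop} {vec : ℕ → ℕ → ZMod P.M}
    {u v p o α c : ℕ} (hg : P.Glob s)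
    (h20 : s.reg 20 = P.addr u) (h21 : s.reg 21 = P.addr v) (h22 : s.reg 22 = p)
    (h23 : s.reg 23 = o) (h24 : s.reg 24 = α) (h25 : s.reg 25 = c)
    (hu : u ≤ P.NMax) (hv : v ≤ P.NMax) (huv : u ≠ v) (hY : s.Bd P.Y) (hp : p * 2 ^ c ≤ P.BL)
    (ho : o * 2 ^ c ≤ P.BL) (hα : ∀ j ≤ c, α ^ j ≤ P.B ^ P.k) (hc : c ≤ P.k + 1)
    (ht : ∀ a < P.S, ∀ j < c, bitAt p j a = 0 → a + o * 2 ^ j < P.BL)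
    (hm : Cells P.NB P.M s.mem (P.flat vec))
    (hQ : ∀ s' n, s'.Bd P.Y → (∀ r, ¬ (26 ≤ r ∧ r ≤ 34) → s'.reg r = s.reg r) →
      (∀ b < P.NB, s'.mem b = s.mem b) →
      Cells P.NB P.M s'.mem (P.flat
        (Function.update vec v (vec v + edgeOp (ZMod P.M) P.S p o α c (vec u)))) →
      n ≤ P.EC → Q s' n) : edge.wp P.Y s Q := by
  have hBL : P.BL < P.Y := by
    have := P.addr_add_lt hu le_rfl
    omega
  refine Prog.wp_of_bd hY ?_
  refine edge_wp hg.r0 hg.r5 hg.r6 hg.r7 hg.r10 h20 h21 h22 h23 h24 h25 (P.NB_le_addr u)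
    (P.NB_le_addr v) P.M_pos hY (by omega) (by omega) ?_ (P.addr_add_lt hu P.S_le_BL).le ?_ ?_ hm ?_
  · intro j hj
    have := Nat.mul_le_mul_left P.M (hα j hj)
    unfold Y
    omega
  · intro a ha j hj hb
    have := P.addr_add_lt hv (ht a ha j hj hb).le
    omega
  · intro a ha j hj hb b hb' h
    rw [add_assoc] at h
    exact huv (P.addr_add_inj (hb'.trans_le P.S_le_BL) (ht a ha j hj hb) h).1
  · intro s' n fr fm hm' hn hb'
    refine hQ s' n hb' fr fm ?_ (hn.trans ?_)
    · intro a ha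
      refine ⟨(hm' a ha).1, (hm' a ha).2.trans ?_⟩
      obtain ⟨i, y, hy, rfl⟩ := P.exists_addr ha
      rw [P.flat_addr _ _ hy, Pi.add_apply, P.flat_addr _ _ hy, Finset.sum_apply]
      have : ∀ a ∈ Finset.range P.S, edgeTerm (ZMod P.M) (P.addr v) p o α c a
          (P.flat vec (P.addr u + a)) (P.addr i + y) =
          if i = v then edgeTerm (ZMod P.M) 0 p o α c a (vec u a) y else 0 := by
        intro a ha
        rw [Finset.mem_range] at ha
        rw [P.edgeTerm_addr _ (ht a ha) _ hy, P.flat_addr _ _ (ha.trans_le P.S_le_BL)]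
      rw [Finset.sum_congr rfl this]
      by_cases hiv : i = v
      · subst hiv
        simp [edgeOp]
      · simp [hiv]
    · unfold EC
      gcongr

/-- The stack of pending edges, from the top. -/
def StackOK (P : Par) (mem : ℕ → ℕ) : List (ℕ × ℕ) → Prop
  | [] => True
  | e :: σ => mem (P.w.length + 2 * σ.length) = P.addr e.1 ∧
      mem (P.w.length + 2 * σ.length + 1) = P.addr e.2 ∧ P.StackOK mem σ

theorem StackOK.congr {mem mem' : ℕ → ℕ} {σ : List (ℕ × ℕ)} (h : P.StackOK mem σ)
    (hm : ∀ a < P.w.length + 2 * σ.length, mem' a = mem a) : P.StackOK mem' σ := by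
  induction σ with
  | nil => trivial
  | cons e σ ih =>
    rw [List.length_cons] at hm
    exact ⟨(hm _ (by omega)).trans h.1, (hm _ (by omega)).trans h.2.1,
      ih h.2.2 fun a ha => hm a (by omega)⟩

/-- The states at the head of the main loop. -/
structure MInv (P : Par) (s : State) (ptr : ℕ) (σ : List (ℕ × ℕ)) (N : ℕ)
    (vec : ℕ → ℕ → ZMod P.M) : Prop where
  glob : P.Glob s
  ptr : s.reg 14 = ptr
  dep : s.reg 15 = σ.length
  next : s.reg 16 = P.addr N
  stack : P.StackOK s.mem σ
  inp : ∀ a < P.w.length, s.mem a = P.w.getD a 0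
  cells : Cells P.NB P.M s.mem (P.flat vec)
  fresh : ∀ i, N ≤ i → vec i = 0

theorem MInv.congr {s s' : State} {ptr ptr' : ℕ} {σ : List (ℕ × ℕ)} {N : ℕ}
    {vec : ℕ → ℕ → ZMod P.M} (h : P.MInv s ptr σ N vec)
    (hr : ∀ r ≤ 16, r ≠ 14 → s'.reg r = s.reg r) (hp : s'.reg 14 = ptr') (hm : s'.mem = s.mem) :
    P.MInv s' ptr' σ N vec where
  glob := h.glob.congr fun r hr' => hr r (by omega) (by omega)
  ptr := hp
  dep := (hr _ (by omega) (by omega)).trans h.dep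
  next := (hr _ (by omega) (by omega)).trans h.next
  stack := hm ▸ h.stack
  inp := hm ▸ h.inp
  cells := hm ▸ h.cells
  fresh := h.fresh

/-- Changing one block and the number of blocks in use. -/
theorem MInv.update {s s' : State} {ptr : ℕ} {σ : List (ℕ × ℕ)} {N N' : ℕ}
    {vec vec' : ℕ → ℕ → ZMod P.M} (h : P.MInv s ptr σ N vec) (hσ : σ.length ≤ P.w.length)
    (hr : ∀ r ≤ 15, s'.reg r = s.reg r) (hN : s'.reg 16 = P.addr N')
    (hm : ∀ b < P.NB, s'.mem b = s.mem b) (hc : Cells P.NB P.M s'.mem (P.flat vec'))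
    (hf : ∀ i, N' ≤ i → vec' i = 0) : P.MInv s' ptr σ N' vec' where
  glob := h.glob.congr fun r hr' => hr r (by omega)
  ptr := (hr _ (by omega)).trans h.ptr
  dep := (hr _ (by omega)).trans h.dep
  next := hN
  stack := h.stack.congr fun a ha => hm a (by unfold NB; omega)
  inp a ha := (hm a (by unfold NB; omega)).trans (h.inp a ha)
  cells := hc
  fresh := hf

end Par

/-! ### The interpreter and its correctness token by token -/

namespace RAM

/-- Take an edge from the stack and a token from the input. -/
def fetch : Prog :=
  .seq (.op .sub 15 15 5) <| .seq (.op .mul 35 15 6) <| .seq (.op .add 35 35 12) <|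
  .seq (.load 17 35) <| .seq (.op .add 35 35 5) <| .seq (.load 18 35) <|
  .seq (.load 19 14) (.op .add 14 14 5)

/-- Put the edge given by registers `a` and `b` on the stack. -/
def push (a b : ℕ) : Prog :=
  .seq (.op .mul 35 15 6) <| .seq (.op .add 35 35 12) <| .seq (.store 35 a) <|
  .seq (.op .add 35 35 5) <| .seq (.store 35 b) (.op .add 15 15 5)

/-- Process the terminal `1`. -/
def caseOne : Prog :=
  .seq (.op .add 20 17 0) <| .seq (.op .add 21 18 0) <| .seq (.const 22 0) <|
  .seq (.const 23 0) <| .seq (.const 24 1) <| .seq (.const 25 1) edge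

/-- Process the terminal `z`. -/
def caseZ : Prog :=
  .seq (.op .add 20 17 0) <| .seq (.op .add 21 18 0) <| .seq (.const 22 0) <|
  .seq (.op .add 23 9 0) <| .seq (.const 24 1) <| .seq (.const 25 1) edge

/-- Process one copy of a variable, through a new node. -/
def copyStep : Prog :=
  .seq (.op .sub 37 37 5) <| .seq (.op .add 24 36 37) <| .seq (.op .add 20 17 0) <|
  .seq (.op .add 21 16 0) <| .seq (.const 22 1) <| .seq (.const 23 1) <|
  .seq (.op .add 25 2 0) <| .seq edge <| .seq (.op .add 20 16 0) <| .seq (.op .add 21 18 0) <|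
  .seq (.op .add 22 8 0) <| .seq (.op .add 23 8 0) <| .seq edge (.op .add 16 16 11)

/-- Process a variable. -/
def caseX : Prog :=
  .seq (.load 36 14) <| .seq (.op .add 14 14 5) <| .seq (.op .mul 36 36 4) <|
  .seq (.op .add 37 4 0) <| .loop 37 copyStep

/-- Process a `×` gate: split the edge at a new node. -/
def caseMul : Prog :=
  .seq (.op .add 36 16 0) <| .seq (.op .add 16 16 11) <| .seq (push 36 18) (push 17 36)

/-- Process a `+` gate: replace the edge by parallel edges. -/
def caseAdd : Prog :=
  .seq (.load 36 14) <| .seq (.op .add 14 14 5) <| .loop 36 <|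
    .seq (.op .sub 36 36 5) (push 17 18)

/-- Process a token. -/
def mainBody : Prog :=
  .seq fetch <| .ite 19 (.seq (.op .sub 19 19 5) <| .ite 19 (.seq (.op .sub 19 19 5) <|
    .ite 19 (.seq (.op .sub 19 19 5) <| .ite 19 caseAdd caseMul) caseX) caseZ) caseOne

/-- Process the whole formula. -/
def mainLoop : Prog := .loop 15 mainBody

end RAM

namespace Par
variable {P : Par}

theorem three_mul_lt_Y : 3 * P.w.length < P.Y := by
  have := P.addr_add_lt (i := 0) (by omega) (Nat.zero_le _)
  have := P.NB_le_addr 0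
  unfold NB at this
  omega

theorem fetch_wp {s : State} {Q : State → ℕ → Prop} {ptr u v N : ℕ} {σ : List (ℕ × ℕ)}
    {vec : ℕ → ℕ → ZMod P.M} (h : P.MInv s ptr ((u, v) :: σ) N vec) (hσ : σ.length < P.w.length)
    (hp : ptr < P.w.length)
    (hQ : ∀ s', P.MInv s' (ptr + 1) σ N vec → s'.reg 17 = P.addr u → s'.reg 18 = P.addr v →
      s'.reg 19 = P.w.getD ptr 0 → Q s' 8) : fetch.wp P.Y s Q := by
  have hl := P.three_mul_lt_Y
  have hd := h.dep
  rw [List.length_cons] at hd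
  have e : σ.length * 2 + P.w.length = P.w.length + 2 * σ.length := by ring
  simp only [fetch, Prog.wp, State.setReg_reg, State.setReg_mem, h.glob.r5, h.glob.r6, h.glob.r12,
    h.ptr, hd, Nat.reduceEqDiff, if_true, if_false, Nat.add_sub_cancel, e, h.stack.1, h.stack.2.1,
    h.inp ptr hp]
  refine ⟨by omega, by omega, by omega, by omega, hQ _ ⟨h.glob.congr ?_, ?_, ?_, ?_, ?_, ?_, ?_, ?_⟩
    ?_ ?_ ?_⟩
  · intro r hr
    simp only [State.setReg_reg]
    split_ifs <;> omega
  · simp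
  · simp
  · simp [h.next]
  · exact h.stack.2.2
  · exact h.inp
  · exact h.cells
  · exact h.fresh
  all_goals simp

/-- The stack lies between the input and the blocks, in the cells from `|w|` up to `3 * |w|`. As it
holds fewer than `|w|` pairs, a push disturbs neither neighbour. -/
theorem push_wp {s : State} {Q : State → ℕ → Prop} {ptr u v N a b : ℕ} {σ : List (ℕ × ℕ)}
    {vec : ℕ → ℕ → ZMod P.M} (h : P.MInv s ptr σ N vec) (hσ : σ.length < P.w.length)
    (ha : a ≠ 35) (hb : b ≠ 35) (hu : s.reg a = P.addr u) (hv : s.reg b = P.addr v)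
    (hQ : ∀ s', P.MInv s' ptr ((u, v) :: σ) N vec → (∀ r, r ≠ 15 → r ≠ 35 → s'.reg r = s.reg r) →
      Q s' 6) : (push a b).wp P.Y s Q := by
  have hl := P.three_mul_lt_Y
  have e : σ.length * 2 + P.w.length = P.w.length + 2 * σ.length := by ring
  simp only [push, Prog.wp, State.setReg_reg, State.setMem_reg, h.glob.r5,
    h.glob.r6, h.glob.r12, h.dep, Nat.reduceEqDiff, if_true, if_false, e, ha, hb, hu, hv]
  refine ⟨by omega, by omega, by omega, by omega, hQ _ ⟨h.glob.congr ?_, ?_, ?_, ?_, ?_, ?_, ?_, ?_⟩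
    ?_⟩
  · intro r hr
    simp only [State.setReg_reg, State.setMem_reg]
    split_ifs <;> omega
  · simp [h.ptr]
  · simp
  · simp [h.next]
  · refine ⟨by simp, by simp, h.stack.congr fun x hx => ?_⟩
    simp only [State.setReg_mem, State.setMem_mem]
    rw [if_neg (by omega), if_neg (by omega)]
  · intro x hx
    simp only [State.setReg_mem, State.setMem_mem]
    rw [if_neg (by omega), if_neg (by omega), h.inp x hx]
  · intro x hx
    have : x ≠ P.w.length + 2 * σ.length + 1 := by unfold NB at hx; omega
    have : x ≠ P.w.length + 2 * σ.length := by unfold NB at hx; omega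
    simp only [State.setReg_mem, State.setMem_mem, *, if_false]
    exact h.cells x hx
  · exact h.fresh
  · intro r h1 h2
    simp [h1, h2]

theorem one_lt_Y : 1 < P.Y := by
  have := P.M_pos
  have : 0 < P.M * P.B ^ P.k := Nat.mul_pos this (Nat.pow_pos P.B_pos)
  unfold Y
  omega

theorem addr_lt_Y {i : ℕ} (h : i ≤ P.NMax) : P.addr i < P.Y := P.addr_add_lt h (Nat.zero_le _)

theorem BL_lt_Y : P.BL < P.Y := by
  have := P.addr_add_lt (Nat.zero_le _) le_rfl
  omega

/-- Multiplying by `z` shifts by `4 ^ k`. A block has one spare layer, for degree `t + 1`, to catch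
the overflow; its cells are never used as sources, so higher degrees are discarded. -/
theorem four_pow_add_S : P.S + 4 ^ P.k = P.BL := by unfold S BL; ring

theorem caseOne_wp {s : State} {Q : State → ℕ → Prop} {ptr u v N : ℕ} {σ : List (ℕ × ℕ)}
    {vec : ℕ → ℕ → ZMod P.M} (h : P.MInv s ptr σ N vec) (hY : s.Bd P.Y)
    (hσ : σ.length ≤ P.w.length) (h17 : s.reg 17 = P.addr u) (h18 : s.reg 18 = P.addr v)
    (hu : u < N) (hv : v < N) (hN : N ≤ P.NMax) (huv : u ≠ v)
    (hQ : ∀ s' n, P.MInv s' ptr σ N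
      (Function.update vec v (vec v + opOne (ZMod P.M) P.k P.t (vec u))) →
      n ≤ P.EC + 6 → Q s' n) : caseOne.wp P.Y s Q := by
  have h1 := P.one_lt_Y
  have hu' := P.addr_lt_Y (i := u) (by omega)
  have hv' := P.addr_lt_Y (i := v) (by omega)
  simp only [caseOne, Prog.wp, State.setReg_reg, h17, h18, h.glob.r0, Nat.reduceEqDiff, if_false,
    add_zero]
  refine ⟨hu', hv', by omega, by omega, h1, h1, ?_⟩
  refine edge_block_wp (u := u) (v := v) (p := 0) (o := 0) (α := 1) (c := 1) (vec := vec)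
    (h.glob.congr fun r hr => ?_) ?_ ?_ ?_ ?_ ?_ ?_ (by omega) (by omega) huv ?_ (by simp)
    (by simp) ?_ (by omega) ?_ h.cells ?_
  · simp only [State.setReg_reg]
    split_ifs <;> omega
  iterate 6 simp only [State.setReg_reg, Nat.reduceEqDiff, if_true, if_false]
  · exact (((((hY.setReg hu').setReg hv').setReg (by omega)).setReg (by omega)).setReg h1).setReg h1
  · intro j hj
    rw [one_pow]
    exact Nat.pow_pos P.B_pos
  · intro a ha j hj _
    have := P.S_le_BL
    omega
  · intro s' n _ fr fm hm hn
    refine hQ _ _ (h.update hσ (fun r hr => ?_) ?_ fm hm fun i hi => ?_) (by omega)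
    · rw [fr r (by omega)]
      simp only [State.setReg_reg]
      split_ifs <;> omega
    · rw [fr 16 (by omega)]
      simp [h.next]
    · rw [Function.update_of_ne (by omega), h.fresh i hi]

theorem caseZ_wp {s : State} {Q : State → ℕ → Prop} {ptr u v N : ℕ} {σ : List (ℕ × ℕ)}
    {vec : ℕ → ℕ → ZMod P.M} (h : P.MInv s ptr σ N vec) (hY : s.Bd P.Y)
    (hσ : σ.length ≤ P.w.length) (h17 : s.reg 17 = P.addr u) (h18 : s.reg 18 = P.addr v)
    (hu : u < N) (hv : v < N) (hN : N ≤ P.NMax) (huv : u ≠ v)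
    (hQ : ∀ s' n, P.MInv s' ptr σ N
      (Function.update vec v (vec v + opZ (ZMod P.M) P.k P.t (vec u))) →
      n ≤ P.EC + 6 → Q s' n) : caseZ.wp P.Y s Q := by
  have h1 := P.one_lt_Y
  have hu' := P.addr_lt_Y (i := u) (by omega)
  have hv' := P.addr_lt_Y (i := v) (by omega)
  have hK : 4 ^ P.k * 2 ≤ P.BL := by
    unfold BL
    rw [mul_comm]
    exact Nat.mul_le_mul_right _ (by omega)
  have hK' : 4 ^ P.k < P.Y := by
    have := P.BL_lt_Y
    omega
  simp only [caseZ, Prog.wp, State.setReg_reg, h17, h18, h.glob.r0, h.glob.r9, Nat.reduceEqDiff,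
    if_false, add_zero]
  refine ⟨hu', hv', by omega, hK', h1, h1, ?_⟩
  refine edge_block_wp (u := u) (v := v) (p := 0) (o := 4 ^ P.k) (α := 1) (c := 1) (vec := vec)
    (h.glob.congr fun r hr => ?_) ?_ ?_ ?_ ?_ ?_ ?_ (by omega) (by omega) huv ?_ (by simp)
    (by simpa using hK) ?_ (by omega) ?_ h.cells ?_
  · simp only [State.setReg_reg]
    split_ifs <;> omega
  iterate 6 simp only [State.setReg_reg, Nat.reduceEqDiff, if_true, if_false]
  · exact (((((hY.setReg hu').setReg hv').setReg (by omega)).setReg hK').setReg h1).setReg h1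
  · intro j hj
    rw [one_pow]
    exact Nat.pow_pos P.B_pos
  · intro a ha j hj _
    have := P.four_pow_add_S
    have : j = 0 := by omega
    subst this
    omega
  · intro s' n _ fr fm hm hn
    refine hQ _ _ (h.update hσ (fun r hr => ?_) ?_ fm hm fun i hi => ?_) (by omega)
    · rw [fr r (by omega)]
      simp only [State.setReg_reg]
      split_ifs <;> omega
    · rw [fr 16 (by omega)]
      simp [h.next]
    · rw [Function.update_of_ne (by omega), h.fresh i hi]

/-- `S` is a multiple of `2 ^ (e + j + 1)`. In units of `2 ^ (e + j)`, the quotient of `a` is even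
and below an even bound, so increasing it by one stays below the bound. -/
theorem add_two_pow_lt {e j a : ℕ} (hj : e + j < 2 * P.k) (ha : a < P.S)
    (hb : bitAt (2 ^ e) j a = 0) : a + 2 ^ e * 2 ^ j < P.S := by
  obtain ⟨d, hd⟩ := Nat.exists_eq_add_of_lt hj
  have hS : P.S = 2 ^ e * 2 ^ j * (2 * ((P.t + 1) * 2 ^ d)) := by
    unfold S
    rw [show (4 : ℕ) = 2 ^ 2 from rfl, ← pow_mul, hd, pow_succ, pow_add, pow_add]
    ring
  have hr : 0 < 2 ^ e * 2 ^ j := by positivity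
  unfold bitAt at hb
  rw [hS] at ha ⊢
  have h1 := (Nat.div_lt_iff_lt_mul hr).2 (ha.trans_eq (mul_comm _ _))
  have h2 : (a + 2 ^ e * 2 ^ j) / (2 ^ e * 2 ^ j) = a / (2 ^ e * 2 ^ j) + 1 :=
    Nat.add_div_right _ hr
  rw [mul_comm _ (2 * _), ← Nat.div_lt_iff_lt_mul hr, h2]
  omega

theorem pow_le_B_pow {α j : ℕ} (h : α ≤ P.B) (hj : j ≤ P.k) : α ^ j ≤ P.B ^ P.k :=
  (Nat.pow_le_pow_left h j).trans (Nat.pow_le_pow_right P.B_pos hj)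

/-- The vector of a copy is wedged into the first exterior algebra on the way from `u` to a fresh
node, and into the second on the way from there to `v`. Expanding both at once would multiply the
cost per cell by another factor `k`. -/
theorem copyStep_wp {s : State} {Q : State → ℕ → Prop} {ptr u v N i j : ℕ} {σ : List (ℕ × ℕ)}
    {vec : ℕ → ℕ → ZMod P.M} (h : P.MInv s ptr σ N vec) (hY : s.Bd P.Y)
    (hσ : σ.length ≤ P.w.length) (h17 : s.reg 17 = P.addr u) (h18 : s.reg 18 = P.addr v)
    (h36 : s.reg 36 = i) (h37 : s.reg 37 = j + 1)
    (hu : u < N) (hv : v < N) (hN : N < P.NMax) (hα : i + j ≤ P.B)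
    (hB : P.B < P.Y)
    (hQ : ∀ s' n vec', P.MInv s' ptr σ (N + 1) vec' →
      vec' v = vec v + opX (ZMod P.M) P.k P.t (i + j) (vec u) →
      (∀ l < N, l ≠ v → vec' l = vec l) → s'.reg 17 = P.addr u → s'.reg 18 = P.addr v →
      s'.reg 36 = i → s'.reg 37 = j →
      n ≤ 2 * P.EC + 12 → Q s' n) : copyStep.wp P.Y s Q := by
  have h1 := P.one_lt_Y
  have hu' := P.addr_lt_Y (i := u) (by omega)
  have hv' := P.addr_lt_Y (i := v) (by omega)
  have hN' := P.addr_lt_Y (i := N) (by omega)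
  have hN'' := P.addr_lt_Y (i := N + 1) (by omega)
  have hK4 : 2 ^ P.k * 2 ^ P.k ≤ P.BL := by
    rw [← mul_pow]
    exact Nat.le_mul_of_pos_left _ (by omega)
  have hK2 : 1 * 2 ^ P.k ≤ P.BL := (Nat.mul_le_mul_right _ (Nat.pow_pos (by omega))).trans hK4
  have hK2' : 2 ^ P.k < P.Y := by
    have := P.BL_lt_Y
    omega
  have hk : P.k < P.Y := h.glob.r2 ▸ hY.1 2
  simp only [copyStep, Prog.wp, State.setReg_reg, h17, h36, h37, h.glob.r0, h.glob.r5,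
    h.glob.r2, h.next, Nat.reduceEqDiff, if_true, if_false, add_zero, Nat.add_sub_cancel]
  refine ⟨by omega, hu', hN', h1, h1, hk, ?_⟩
  refine edge_block_wp (u := u) (v := N) (p := 1) (o := 1) (α := i + j) (c := P.k) (vec := vec)
    (h.glob.congr fun r hr => ?_) ?_ ?_ ?_ ?_ ?_ ?_ (by omega) (by omega) (by omega) ?_ hK2 hK2
    (fun _ => P.pow_le_B_pow hα) (by omega) ?_ h.cells ?_
  · simp only [State.setReg_reg]
    split_ifs <;> omega
  iterate 6 simp only [State.setReg_reg, Nat.reduceEqDiff, if_true, if_false]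
  · exact ((((((hY.setReg (by have := hY.1 37; omega)).setReg (by omega)).setReg hu').setReg
      hN').setReg h1).setReg h1).setReg hk
  · intro a ha l hl hb
    exact (P.add_two_pow_lt (e := 0) (by omega) ha hb).trans_le P.S_le_BL
  intro s₁ n₁ hY₁ fr fm hm hn
  have hr : ∀ r, ¬ (20 ≤ r ∧ r ≤ 34) → r ≠ 37 → s₁.reg r = s.reg r := by
    intro r h1 h2
    rw [fr r (by omega)]
    simp only [State.setReg_reg]
    split_ifs <;> omega
  have e24 : s₁.reg 24 = i + j := by rw [fr 24 (by omega)]; simp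
  have e25 : s₁.reg 25 = P.k := by rw [fr 25 (by omega)]; simp
  have e37 : s₁.reg 37 = j := by rw [fr 37 (by omega)]; simp
  have hg : P.Glob s₁ := h.glob.congr fun r hr' => hr r (by omega) (by omega)
  simp only [hg.r0, hg.r8, hr 16 (by omega) (by omega), hr 18 (by omega) (by omega), h.next, h18,
    add_zero]
  refine ⟨hN', hv', hK2', hK2', ?_⟩
  refine edge_block_wp (u := N) (v := v) (p := 2 ^ P.k) (o := 2 ^ P.k) (α := i + j) (c := P.k)
    (hg.congr fun r hr => ?_) ?_ ?_ ?_ ?_ ?_ ?_ (by omega) (by omega) (by omega) ?_ hK4 hK4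
    (fun _ => P.pow_le_B_pow hα) (by omega) ?_ hm ?_
  · simp only [State.setReg_reg]
    split_ifs <;> omega
  iterate 4 simp only [State.setReg_reg, Nat.reduceEqDiff, if_true, if_false]
  · simp [e24]
  · simp [e25]
  · exact (((hY₁.setReg hN').setReg hv').setReg hK2').setReg hK2'
  · intro a ha l hl hb
    exact (P.add_two_pow_lt (e := P.k) (by omega) ha hb).trans_le P.S_le_BL
  intro s₂ n₂ _ fr₂ fm₂ hm₂ hn₂
  have hr₂ : ∀ r, ¬ (20 ≤ r ∧ r ≤ 34) → s₂.reg r = s₁.reg r := by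
    intro r h1
    rw [fr₂ r (by omega)]
    simp only [State.setReg_reg]
    split_ifs <;> omega
  have e16 : s₂.reg 16 = P.addr N := by rw [hr₂ 16 (by omega), hr 16 (by omega) (by omega), h.next]
  have e11 : s₂.reg 11 = P.BL := by rw [hr₂ 11 (by omega), hr 11 (by omega) (by omega), h.glob.r11]
  rw [e16, e11, ← P.addr_succ]
  refine ⟨hN'', hQ _ _ _ (h.update hσ (fun r hr' => ?_) ?_ (fun b hb => ?_) hm₂ fun l hl => ?_)
    ?_ ?_ ?_ ?_ ?_ ?_ (by omega)⟩
  · rw [State.setReg_reg, if_neg (by omega), hr₂ r (by omega), hr r (by omega) (by omega)]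
  · simp
  · exact (fm₂ b hb).trans (fm b hb)
  · rw [Function.update_of_ne (by omega), Function.update_of_ne (by omega), h.fresh l (by omega)]
  -- The fresh block was zero, so it holds exactly the first image, with nothing added.
  · rw [Function.update_self, Function.update_self, Function.update_of_ne (by omega),
      h.fresh N le_rfl, zero_add]
    rfl
  · intro l hl hlv
    rw [Function.update_of_ne hlv, Function.update_of_ne (by omega)]
  · rw [State.setReg_reg, if_neg (by omega), hr₂ _ (by omega), hr _ (by omega) (by omega), h17]
  · rw [State.setReg_reg, if_neg (by omega), hr₂ _ (by omega), hr _ (by omega) (by omega), h18]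
  · rw [State.setReg_reg, if_neg (by omega), hr₂ _ (by omega), hr _ (by omega) (by omega), h36]
  · rw [State.setReg_reg, if_neg (by omega), hr₂ _ (by omega), e37]

theorem caseX_wp {s : State} {Q : State → ℕ → Prop} {ptr u v N i : ℕ} {σ : List (ℕ × ℕ)}
    {vec : ℕ → ℕ → ZMod P.M} (h : P.MInv s ptr σ N vec)
    (hσ : σ.length ≤ P.w.length) (h17 : s.reg 17 = P.addr u) (h18 : s.reg 18 = P.addr v)
    (hu : u < N) (hv : v < N) (hN : N + P.q ≤ P.NMax) (huv : u ≠ v) (hq : 2 ≤ P.q)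
    (hB : P.B < P.Y) (hp : ptr < P.w.length) (hi : P.w.getD ptr 0 = i) (hin : i < P.n)
    (hQ : ∀ s' n vec', P.MInv s' (ptr + 1) σ (N + (P.q - 1)) vec' →
      vec' v = vec v +
        (∑ j ∈ Finset.range (P.q - 1), opX (ZMod P.M) P.k P.t (i * (P.q - 1) + j)) (vec u) →
      (∀ l < N, l ≠ v → vec' l = vec l) →
      n ≤ P.q * (2 * P.EC + 13) + 5 → Q s' n) : caseX.wp P.Y s Q := by
  have hl := P.three_mul_lt_Y
  -- All labels of copies are at most `B`, which keeps their powers within the range allowed by `Y`.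
  have hiB : i * (P.q - 1) + (P.q - 1) ≤ P.B := by
    have : i * (P.q - 1) + (P.q - 1) = (i + 1) * (P.q - 1) := by ring
    rw [this]
    exact (Nat.mul_le_mul (by omega : i + 1 ≤ P.n + 1) (by omega : P.q - 1 ≤ P.q)).trans
      (Nat.le_succ _)
  simp only [caseX, Prog.wp, State.setReg_reg, h.ptr, h.inp ptr hp, hi,
    h.glob.r5, h.glob.r4, h.glob.r0, Nat.reduceEqDiff, if_true, if_false, add_zero]
  refine ⟨by omega, by omega, by omega, ?_⟩
  refine WP.countdown (fun l s' => s'.reg 37 = l ∧ ∃ vec', l ≤ P.q - 1 ∧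
    P.MInv s' (ptr + 1) σ (N + (P.q - 1 - l)) vec' ∧
      vec' v = vec v +
        (∑ j ∈ Finset.Ico l (P.q - 1), opX (ZMod P.M) P.k P.t (i * (P.q - 1) + j)) (vec u) ∧
      (∀ l < N, l ≠ v → vec' l = vec l) ∧ s'.reg 17 = P.addr u ∧ s'.reg 18 = P.addr v ∧
      s'.reg 36 = i * (P.q - 1))
    (2 * P.EC + 12) (P.q - 1) (fun _ _ h => h.1) ?_ ?_ ?_
  · rintro l s₁ hl ⟨h37, vec₁, hlq, hm, hvv, hvo, h17, h18, h36⟩ hb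
    refine copyStep_wp hm hb hσ h17 h18 h36 h37 (by omega) (by omega) (by omega) (by omega) hB
      ?_
    intro s₂ n₂ vec₂ hm₂ hvv₂ hvo₂ k17 k18 k36 k37 hn
    refine ⟨⟨k37, vec₂, by omega, ?_, ?_, fun x hx hxv => ?_, k17, k18, k36⟩, hn⟩
    · rw [show N + (P.q - 1 - l) = N + (P.q - 1 - (l + 1)) + 1 by omega]
      exact hm₂
    · rw [hvv₂, hvv, hvo u hu huv, Finset.sum_eq_sum_Ico_succ_bot hl, LinearMap.add_apply]
      abel
    · rw [hvo₂ x (by omega) hxv, hvo x hx hxv]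
  · refine ⟨by simp, vec, le_rfl, ?_, by simp, fun _ _ _ => rfl, ?_, ?_, by simp⟩
    · rw [Nat.sub_self, add_zero]
      refine h.congr (fun r h1 h2 => ?_) (by simp) rfl
      simp only [State.setReg_reg]
      split_ifs <;> omega
    · simp [h17]
    · simp [h18]
  · rintro s₁ n ⟨-, vec', -, hm, hvv, hvo, -⟩ hn
    rw [← Finset.range_eq_Ico] at hvv
    refine hQ _ _ _ hm hvv hvo ?_
    obtain ⟨d, hd⟩ := Nat.exists_eq_add_of_le hq
    have e : P.q - 1 = d + 1 := by omega
    rw [e] at hn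
    rw [hd]
    ring_nf at hn ⊢
    omega

/-- The edge into `v` is pushed first, so that the edge out of `u` lies on top and is matched with
the first factor, which comes next in prefix order. -/
theorem caseMul_wp {s : State} {Q : State → ℕ → Prop} {ptr u v N : ℕ} {σ : List (ℕ × ℕ)}
    {vec : ℕ → ℕ → ZMod P.M} (h : P.MInv s ptr σ N vec)
    (hσ : σ.length + 1 < P.w.length) (h17 : s.reg 17 = P.addr u) (h18 : s.reg 18 = P.addr v)
    (hN : N < P.NMax)
    (hQ : ∀ s', P.MInv s' ptr ((u, N) :: (N, v) :: σ) (N + 1) vec → Q s' 14) :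
    caseMul.wp P.Y s Q := by
  have hN' := P.addr_lt_Y (i := N) (by omega)
  have hN'' := P.addr_lt_Y (i := N + 1) (by omega)
  simp only [caseMul, Prog.wp, State.setReg_reg, h.glob.r0, h.next, h.glob.r11, Nat.reduceEqDiff,
    if_false, add_zero, ← P.addr_succ]
  refine ⟨hN', hN'', ?_⟩
  refine push_wp (u := N) (v := v) (N := N + 1) (h.update (by omega) ?_ (by simp) (fun _ _ => rfl)
    h.cells fun i hi => h.fresh i (by omega)) (by omega) (by omega) (by omega) (by simp)
    (by simp [h18]) ?_
  · intro r hr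
    simp only [State.setReg_reg]
    split_ifs <;> omega
  intro s₁ h₁ fr
  refine push_wp (u := u) (v := N) h₁ (by simpa using hσ) (by omega) (by omega) ?_ ?_
    fun s₂ h₂ _ => hQ s₂ h₂
  · rw [fr _ (by omega) (by omega)]; simp [h17]
  · rw [fr _ (by omega) (by omega)]; simp

theorem caseAdd_wp {s : State} {Q : State → ℕ → Prop} {ptr u v N m : ℕ} {σ : List (ℕ × ℕ)}
    {vec : ℕ → ℕ → ZMod P.M} (h : P.MInv s ptr σ N vec)
    (hσ : σ.length + m ≤ P.w.length) (h17 : s.reg 17 = P.addr u) (h18 : s.reg 18 = P.addr v)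
    (hp : ptr < P.w.length) (hi : P.w.getD ptr 0 = m)
    (hQ : ∀ s' n, P.MInv s' (ptr + 1) (List.replicate m (u, v) ++ σ) N vec → n ≤ m * 8 + 3 →
      Q s' n) : caseAdd.wp P.Y s Q := by
  have hl := P.three_mul_lt_Y
  simp only [caseAdd, Prog.wp, State.setReg_reg, h.ptr, h.inp ptr hp, hi,
    h.glob.r5, Nat.reduceEqDiff, if_false]
  refine ⟨by omega, ?_⟩
  refine WP.countdown (fun l s' => s'.reg 36 = l ∧ l ≤ m ∧
    P.MInv s' (ptr + 1) (List.replicate (m - l) (u, v) ++ σ) N vec ∧ s'.reg 17 = P.addr u ∧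
      s'.reg 18 = P.addr v) 7 m (fun _ _ h => h.1) ?_ ?_ ?_
  · rintro l s₁ hl ⟨h36, hlm, hm, h17, h18⟩ hb
    simp only [Prog.wp, h36, hm.glob.r5, Nat.add_sub_cancel]
    refine push_wp (ptr := ptr + 1) (u := u) (v := v) (hm.congr ?_ ?_ rfl) ?_ (by omega) (by omega) ?_ ?_ ?_
    · intro r h1 h2
      rw [State.setReg_reg, if_neg (by omega)]
    · rw [State.setReg_reg, if_neg (by omega), hm.ptr]
    · simp; omega
    · simp [h17]
    · simp [h18]
    · intro s₂ h₂ fr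
      refine ⟨⟨?_, by omega, ?_, ?_, ?_⟩, by omega⟩
      · rw [fr _ (by omega) (by omega)]; simp
      · rw [show m - l = m - (l + 1) + 1 by omega, List.replicate_succ]
        exact h₂
      · rw [fr _ (by omega) (by omega)]; simp [h17]
      · rw [fr _ (by omega) (by omega)]; simp [h18]
  · refine ⟨by simp, le_rfl, ?_, by simp [h17], by simp [h18]⟩
    rw [Nat.sub_self]
    refine h.congr (fun r h1 h2 => ?_) (by simp) rfl
    simp only [State.setReg_reg]
    split_ifs <;> omega
  · rintro s₁ n ⟨-, -, hm, -⟩ hn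
    exact hQ _ _ hm (by omega)

end Par

/-! ### The main loop evaluates the formula -/

theorem Formula.one_le_length_encode {n : ℕ} (φ : Formula n) : 1 ≤ φ.encode.length := by
  cases φ <;> simp [Formula.encode]

/-- Every description is nonempty; hence the number of pending edges is bounded by the unread input,
and the stack fits. -/
theorem Formula.length_le_length_flatten {n : ℕ} (L : List (Formula n)) :
    L.length ≤ (L.map Formula.encode).flatten.length := by
  induction L with
  | nil => simp
  | cons φ L ih =>
    have := φ.one_le_length_encode
    simp only [List.map_cons, List.flatten_cons, List.length_append, List.length_cons]
    omega

namespace Par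
variable {P : Par}

/-- The common part of all five cases. The overhead `d` accounts for fetching and for the nested
tests and decrements that identify the token. -/
theorem body_wp {s : State} {Q : State → ℕ → Prop} {ptr u v N tok : ℕ} {σ : List (ℕ × ℕ)} {C : Prog}
    {vec : ℕ → ℕ → ZMod P.M}
    (hC : tok = 0 ∧ C = caseOne ∨ tok = 1 ∧ C = caseZ ∨ tok = 2 ∧ C = caseX ∨
      tok = 3 ∧ C = caseMul ∨ tok = 4 ∧ C = caseAdd)
    (h : P.MInv s ptr ((u, v) :: σ) N vec) (hσ : σ.length < P.w.length)
    (hp : ptr < P.w.length) (htok : P.w.getD ptr 0 = tok) (hs : s.Bd P.Y)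
    (hQ : ∀ s' d, P.MInv s' (ptr + 1) σ N vec → s'.Bd P.Y → s'.reg 17 = P.addr u →
      s'.reg 18 = P.addr v → d ≤ 16 → C.wp P.Y s' fun s₂ n => Q s₂ (n + d)) :
    mainBody.wp P.Y s Q := by
  simp only [mainBody, Prog.wp]
  refine Prog.wp_of_bd hs (fetch_wp h hσ hp ?_)
  intro s₁ h₁ h17 h18 h19 hb
  rw [htok] at h19
  have key : ∀ a, (s₁.reg 19 = tok → a < P.Y) → ∀ d ≤ 16,
      C.wp P.Y (s₁.setReg 19 a) fun s₂ n => Q s₂ (n + d) := by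
    intro a ha d hd
    refine hQ _ d (h₁.congr (fun r h1 h2 => ?_) ?_ rfl) (hb.setReg (ha h19)) ?_ ?_ hd
    · rw [State.setReg_reg, if_neg (by omega)]
    · rw [State.setReg_reg, if_neg (by omega), h₁.ptr]
    · rw [State.setReg_reg, if_neg (by omega), h17]
    · rw [State.setReg_reg, if_neg (by omega), h18]
  have hupd : ∀ a b, (s₁.setReg 19 a).setReg 19 b = s₁.setReg 19 b := by
    intro a b; simp [State.setReg]
  have h1 := P.one_lt_Y
  simp only [h19, h₁.glob.r5, State.setReg_reg, Nat.reduceEqDiff, if_true, if_false, hupd]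
  obtain ⟨rfl, rfl⟩ | ⟨rfl, rfl⟩ | ⟨rfl, rfl⟩ | ⟨rfl, rfl⟩ | ⟨rfl, rfl⟩ := hC
  · simp only [ne_eq, not_true_eq_false, false_implies, true_and, forall_true_left]
    refine Prog.wp_mono hb (hQ _ 9 h₁ hb h17 h18 (by omega)) fun s n _ h => ?_
    convert h using 1; omega
  · simp only [ne_eq, one_ne_zero, not_false_eq_true, Nat.sub_self, not_true_eq_false,
      false_implies, true_and, forall_true_left, and_true]
    refine Prog.wp_mono (hb.setReg (by omega)) (key 0 (by omega) 11 (by omega)) fun s n _ h => ?_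
    convert h using 1; omega
  · simp only [ne_eq, Nat.reduceSub, OfNat.ofNat_ne_zero, one_ne_zero, not_false_eq_true,
      Nat.sub_self, not_true_eq_false, false_implies, true_and, forall_true_left, and_true]
    refine Prog.wp_mono (hb.setReg (by omega)) (key 0 (by omega) 13 (by omega)) fun s n _ h => ?_
    convert h using 1; omega
  · simp only [ne_eq, Nat.reduceSub, OfNat.ofNat_ne_zero, one_ne_zero, not_false_eq_true,
      Nat.sub_self, not_true_eq_false, false_implies, true_and, forall_true_left, and_true]
    refine Prog.wp_mono (hb.setReg (by omega)) (key 0 (by omega) 15 (by omega)) fun s n _ h => ?_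
    convert h using 1; omega
  · simp only [ne_eq, Nat.reduceSub, OfNat.ofNat_ne_zero, one_ne_zero, not_false_eq_true,
      false_implies, forall_true_left, and_true]
    refine Prog.wp_mono (hb.setReg (by omega)) (key 1 (by omega) 15 (by omega)) fun s n _ h => ?_
    convert h using 1; omega

/-- A bound on the cost of processing a token. -/
def KC (P : Par) : ℕ := 40 + P.q * (2 * P.EC + 13)

/-- Processing the description of some subformulas, which act together by `A`, takes the main loop
from any state in which they are to act from node `u` to node `v` (with `e` the entries on the
stack for this) to a state in which this is done. -/
def Processes (P : Par) (code : List ℕ) (e : ℕ) (A : Module.End (ZMod P.M) (ℕ → ZMod P.M)) : Prop :=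
  ∀ (s : State) (u v : ℕ) (σ : List (ℕ × ℕ)) (N : ℕ) (vec : ℕ → ℕ → ZMod P.M)
    (Q : State → ℕ → Prop) (pre post : List ℕ),
    P.MInv s pre.length (List.replicate e (u, v) ++ σ) N vec → P.w = pre ++ code ++ post →
    u < N → v < N → u ≠ v → σ.length + code.length ≤ P.w.length →
    N + P.q * code.length ≤ P.NMax →
    (∀ s' N' vec' n, P.MInv s' (pre.length + code.length) σ N' vec' → N ≤ N' →
      N' ≤ N + P.q * code.length → vec' v = vec v + A (vec u) →
      (∀ i < N, i ≠ v → vec' i = vec i) → n + 8 * e ≤ (P.KC + 8) * code.length →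
      WP P.Y mainLoop s' fun s₂ n₂ => Q s₂ (n + n₂)) →
    WP P.Y mainLoop s Q

/-- Parallel edges add up: each subformula changes only `v` among the old nodes, so the next one
still sees the original vector at `u`. The term `8 * e` in `Processes` is credit held by `e` stack
entries, later spent on pushing them at the `+` gate. -/
theorem Processes.list {n : ℕ} {r : ℕ} (L : List (Formula n))
    (h : ∀ φ ∈ L, P.Processes φ.encode 1 (φ.act (ZMod P.M) P.k P.t r)) :
    P.Processes (L.map Formula.encode).flatten L.length
      (L.map (Formula.act (ZMod P.M) P.k P.t r)).sum := by
  induction L with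
  | nil =>
    intro s u v σ N vec Q pre post hm hw hu hv huv hσ hN hQ
    have := hQ s N vec 0 (by simpa using hm) le_rfl (by omega) (by simp) (fun _ _ _ => rfl) (by simp)
    simpa using this
  | cons φ L ih =>
    intro s u v σ N vec Q pre post hm hw hu hv huv hσ hN hQ
    have ih := ih fun ψ hψ => h ψ (List.mem_cons_of_mem _ hψ)
    simp only [List.map_cons, List.flatten_cons, List.length_append, List.length_cons,
      List.sum_cons, mul_add] at hw hσ hN hQ hm ⊢
    have hlen : L.length ≤ (L.map Formula.encode).flatten.length :=
      Formula.length_le_length_flatten L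
    refine h φ (List.mem_cons_self) s u v (List.replicate L.length (u, v) ++ σ) N vec Q pre
      ((L.map Formula.encode).flatten ++ post) hm (by simpa using hw) hu hv huv ?_ (by omega) ?_
    · rw [List.length_append, List.length_replicate]; omega
    intro s₁ N₁ vec₁ n₁ hm₁ hN1 hN2 hv₁ ho₁ hn₁
    refine ih s₁ u v σ N₁ vec₁ _ (pre ++ φ.encode) post (by simpa using hm₁) (by simpa using hw)
      (by omega) (by omega) huv (by omega) (by omega) ?_
    intro s₂ N₂ vec₂ n₂ hm₂ hN3 hN4 hv₂ ho₂ hn₂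
    have := hQ s₂ N₂ vec₂ (n₁ + n₂) (by simpa [add_assoc] using hm₂) (by omega) (by omega) ?_ ?_ ?_
    · simpa [add_assoc] using this
    · rw [hv₂, hv₁, ho₁ u hu huv, LinearMap.add_apply, add_assoc]
    · intro i hi hiv
      rw [ho₂ i (by omega) hiv, ho₁ i hi hiv]
    · omega

/-- Induction on the formula, with an arbitrary remaining stack and continuation. Series connection
gives composition of operators and parallel connection gives their sum. -/
theorem processes_encode {n : ℕ} (hq : 2 ≤ P.q) (hn : n = P.n) (hB : P.B < P.Y) (φ : Formula n) :
    P.Processes φ.encode 1 (φ.act (ZMod P.M) P.k P.t (P.q - 1)) := by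
  have hKC : P.EC + 40 ≤ P.KC := by unfold KC; nlinarith
  induction φ with
  | one =>
    intro s u v σ N vec Q pre post hm hw hu hv huv hσ hN hQ
    simp only [Formula.encode, List.length_singleton, mul_one] at hw hσ hN hQ
    have hl := congrArg List.length hw
    simp only [List.length_append, List.length_singleton] at hl
    refine WP.loop_step (by rw [hm.dep]; simp) fun hs => ?_
    refine body_wp (tok := 0) (C := caseOne) (σ := σ) (by simp) hm (by omega) (by omega) (by rw [hw]; simp) hs ?_
    intro s₁ d h₁ hb h17 h18 hd
    refine caseOne_wp h₁ hb (by omega) h17 h18 hu hv (by omega) huv ?_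
    intro s₂ n h₂ hn
    refine hQ _ _ _ (1 + (n + d)) h₂ le_rfl (by omega) ?_ ?_ (by omega)
    · simp [Formula.act]
    · intro i _ hi; exact Function.update_of_ne hi _ _
  | z =>
    intro s u v σ N vec Q pre post hm hw hu hv huv hσ hN hQ
    simp only [Formula.encode, List.length_singleton, mul_one] at hw hσ hN hQ
    have hl := congrArg List.length hw
    simp only [List.length_append, List.length_singleton] at hl
    refine WP.loop_step (by rw [hm.dep]; simp) fun hs => ?_
    refine body_wp (tok := 1) (C := caseZ) (σ := σ) (by simp) hm (by omega) (by omega) (by rw [hw]; simp) hs ?_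
    intro s₁ d h₁ hb h17 h18 hd
    refine caseZ_wp h₁ hb (by omega) h17 h18 hu hv (by omega) huv ?_
    intro s₂ n h₂ hn
    refine hQ _ _ _ (1 + (n + d)) h₂ le_rfl (by omega) ?_ ?_ (by omega)
    · simp [Formula.act]
    · intro i _ hi; exact Function.update_of_ne hi _ _
  | x i =>
    intro s u v σ N vec Q pre post hm hw hu hv huv hσ hN hQ
    simp only [Formula.encode, List.length_cons, List.length_nil, zero_add, Nat.reduceAdd]
      at hw hσ hN hQ
    have hl := congrArg List.length hw
    simp only [List.length_append, List.length_cons, List.length_nil] at hl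
    refine WP.loop_step (by rw [hm.dep]; simp) fun hs => ?_
    refine body_wp (tok := 2) (C := caseX) (σ := σ) (by simp) hm (by omega) (by omega) (by rw [hw]; simp) hs ?_
    intro s₁ d h₁ hb h17 h18 hd
    refine caseX_wp (i := i) h₁ (by omega) h17 h18 hu hv (by omega) huv hq hB (by omega) ?_
      (by omega) ?_
    · rw [hw]; simp
    intro s₂ n vec₂ h₂ hv₂ ho₂ hn
    refine hQ _ _ _ (1 + (n + d)) h₂ (by omega) (by omega) ?_ ho₂ ?_
    · simpa [Formula.act] using hv₂
    · unfold KC; omega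
  | mul a b iha ihb =>
    intro s u v σ N vec Q pre post hm hw hu hv huv hσ hN hQ
    simp only [Formula.encode, List.length_cons, List.length_append, mul_add, mul_one]
      at hw hσ hN hQ
    have hl := congrArg List.length hw
    simp only [List.length_append, List.length_cons] at hl
    have hla : 1 ≤ a.encode.length := a.one_le_length_encode
    have hlb : 1 ≤ b.encode.length := b.one_le_length_encode
    refine WP.loop_step (by rw [hm.dep]; simp) fun hs => ?_
    refine body_wp (tok := 3) (C := caseMul) (σ := σ) (by simp) hm (by omega) (by omega) (by rw [hw]; simp) hs ?_
    intro s₁ d h₁ hb h17 h18 hd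
    refine caseMul_wp h₁ (by omega) h17 h18 (by omega) ?_
    intro s₂ h₂
    refine iha s₂ u N ((N, v) :: σ) (N + 1) vec _ (pre ++ [3]) (b.encode ++ post) (by simpa using h₂)
      (by simpa using hw) (by omega) (by omega) (by omega) (by simp; omega) (by omega) ?_
    intro s₃ N₃ vec₃ n₃ hm₃ hN1 hN2 hv₃ ho₃ hn₃
    refine ihb s₃ N v σ N₃ vec₃ _ (pre ++ [3] ++ a.encode) post (by rw [List.length_append]; exact hm₃)
      (by simpa using hw) (by omega) (by omega) (by omega) (by omega) (by omega) ?_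
    intro s₄ N₄ vec₄ n₄ hm₄ hN3 hN4 hv₄ ho₄ hn₄
    have := hQ s₄ N₄ vec₄ (1 + (14 + d) + n₃ + n₄) 
      (by simpa [add_assoc, add_comm, add_left_comm] using hm₄)
      (by omega) (by omega) ?_ ?_ ?_
    · simpa [add_assoc] using this
    -- Node `N` was zero, so after the first factor it holds exactly the image of `vec u`, while `v`
    -- is still unchanged.
    · rw [hv₄, hv₃, ho₃ v (by omega) (by omega), h₁.fresh N le_rfl, zero_add]
      rfl
    · intro i hi hiv
      rw [ho₄ i (by omega) hiv, ho₃ i (by omega) (by omega)]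
    · omega
  | add m f ih =>
    intro s u v σ N vec Q pre post hm hw hu hv huv hσ hN hQ
    have hlist := Processes.list (r := P.q - 1) (List.ofFn f) (by
      intro φ hφ
      obtain ⟨i, rfl⟩ := (List.mem_ofFn' _ _).1 hφ
      exact ih i)
    have hcode : ((List.ofFn f).map Formula.encode).flatten =
      (List.ofFn fun i => (f i).encode).flatten := by rw [List.map_ofFn]; rfl
    have hact : ((List.ofFn f).map (Formula.act (ZMod P.M) P.k P.t (P.q - 1))).sum =
      (Formula.add m f).act (ZMod P.M) P.k P.t (P.q - 1) := by
      rw [List.map_ofFn, List.sum_ofFn]; rfl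
    have hlen := Formula.length_le_length_flatten (List.ofFn f)
    rw [hcode, List.length_ofFn] at hlen
    rw [hcode, hact, List.length_ofFn] at hlist
    simp only [Formula.encode, List.length_cons, mul_add, mul_one] at hw hσ hN hQ
    have hl := congrArg List.length hw
    simp only [List.length_append, List.length_cons] at hl
    refine WP.loop_step (by rw [hm.dep]; simp) fun hs => ?_
    refine body_wp (tok := 4) (C := caseAdd) (σ := σ) (by simp) hm (by omega) (by omega) (by rw [hw]; simp) hs ?_
    intro s₁ d h₁ hb h17 h18 hd
    refine caseAdd_wp (m := m) h₁ (by omega) h17 h18 (by omega) ?_ ?_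
    · rw [hw]; simp
    intro s₂ n₂ h₂ hn₂
    refine hlist s₂ u v σ N vec _ (pre ++ [4, m]) post (by simpa using h₂) (by simpa using hw)
      hu hv huv (by omega) (by omega) ?_
    intro s₃ N₃ vec₃ n₃ hm₃ hN1 hN2 hv₃ ho₃ hn₃
    have := hQ s₃ N₃ vec₃ (1 + (n₂ + d) + n₃) 
      (by convert hm₃ using 1; rw [List.length_append, List.length_cons, List.length_singleton]; omega)
      (by omega) (by omega) hv₃ ho₃ (by omega)
    simpa [add_assoc] using this

end Par

/-! ### Exterior algebra in binary coordinates -/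

section Words
open Finset

/-- The number whose binary digits `1` are at the positions in `I`. -/
def mask (I : Finset ℕ) : ℕ := ∑ i ∈ I, 2 ^ i

theorem mask_lt {k : ℕ} {I : Finset ℕ} (hI : I ⊆ range k) : mask I < 2 ^ k :=
  Nat.geomSum_lt le_rfl fun _ hi => mem_range.1 (hI hi)

theorem mask_erase {I : Finset ℕ} {j : ℕ} (hj : j ∈ I) : mask I = mask (I.erase j) + 2 ^ j :=
  (sum_erase_add I _ hj).symm

theorem testBit_mask (I : Finset ℕ) (j : ℕ) : (mask I).testBit j = decide (j ∈ I) := by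
  induction I using Finset.induction_on_max with
  | empty => simp [mask]
  | insert a s hs ih =>
    have ha : a ∉ s := fun h => lt_irrefl _ (hs a h)
    have h : mask (insert a s) = 2 ^ a * 1 + mask s := by
      rw [mask, sum_insert ha, mul_one, mask]
    have hlt : mask s < 2 ^ a := mask_lt fun i hi => mem_range.2 (hs i hi)
    rw [h, Nat.testBit_two_pow_mul_add _ hlt, ih]
    split_ifs with hja
    · simp [hja.ne]
    · have : j ∉ s := fun h => hja (hs j h)
      rcases Nat.lt_or_eq_of_le (not_lt.1 hja) with h | h
      · simp only [mem_insert, this, or_false, show j ≠ a by omega, decide_false]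
        rw [show (1 : ℕ) = 2 ^ 0 from rfl, Nat.testBit_two_pow]
        simp; omega
      · simp [h]

/-- The cell of a block that belongs to `z`-degree `d` and a pair of subsets. -/
def cell (k d : ℕ) (I J : Finset ℕ) : ℕ := mask I + 2 ^ k * (mask J + 2 ^ k * d)

theorem cell_lt {k t d : ℕ} {I J : Finset ℕ} (hI : I ⊆ range k) (hJ : J ⊆ range k) (hd : d ≤ t) :
    cell k d I J < (t + 1) * 4 ^ k := by
  have h1 := mask_lt hI
  have h2 := mask_lt hJ
  have h3 : 2 ^ k * (mask J + 2 ^ k * d + 1) ≤ 2 ^ k * (2 ^ k + 2 ^ k * d) :=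
    Nat.mul_le_mul_left _ (by omega)
  have h4 : 2 ^ k * (2 ^ k + 2 ^ k * d) = (d + 1) * 4 ^ k := by
    rw [show (4 : ℕ) = 2 * 2 from rfl, mul_pow]; ring
  have h5 : (d + 1) * 4 ^ k ≤ (t + 1) * 4 ^ k := Nat.mul_le_mul_right _ (by omega)
  unfold cell
  rw [mul_add, mul_one] at h3
  omega

theorem bitAt_eq (e j a : ℕ) : bitAt (2 ^ e) j a = (a.testBit (e + j)).toNat := by
  rw [Nat.toNat_testBit, bitAt, ← pow_add]

theorem bitAt_cell_left {k d j : ℕ} {I J : Finset ℕ} (hI : I ⊆ range k) (hj : j < k) :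
    bitAt (2 ^ 0) j (cell k d I J) = if j ∈ I then 1 else 0 := by
  rw [bitAt_eq, cell, add_comm (mask I), Nat.testBit_two_pow_mul_add _ (mask_lt hI), zero_add,
    if_pos hj, testBit_mask]
  split_ifs with h <;> simp [h]

theorem bitAt_cell_right {k d j : ℕ} {I J : Finset ℕ} (hI : I ⊆ range k) (hJ : J ⊆ range k)
    (hj : j < k) : bitAt (2 ^ k) j (cell k d I J) = if j ∈ J then 1 else 0 := by
  rw [bitAt_eq, cell, add_comm (mask I), Nat.testBit_two_pow_mul_add _ (mask_lt hI),
    if_neg (by omega), Nat.add_sub_cancel_left, add_comm (mask J),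
    Nat.testBit_two_pow_mul_add _ (mask_lt hJ), if_pos hj, testBit_mask]
  split_ifs with h <;> simp [h]

section Ops
variable {R : Type*} [CommRing R]

/-- Adding `2 ^ (e + j)` does not affect the lower digits, on which the sign depends. -/
theorem bitSign_add_two_pow (e : ℕ) {j : ℕ} (a : ℕ) :
    bitSign R (2 ^ e) j (a + 2 ^ e * 2 ^ j) = bitSign R (2 ^ e) j a := by
  refine prod_congr rfl fun i hi => ?_
  rw [mem_range] at hi
  have : bitAt (2 ^ e) i (a + 2 ^ e * 2 ^ j) = bitAt (2 ^ e) i a := by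
    obtain ⟨d, rfl⟩ := Nat.exists_eq_add_of_lt hi
    unfold bitAt
    rw [show 2 ^ e * 2 ^ (i + d + 1) = 2 ^ e * 2 ^ i * (2 * 2 ^ d) by ring,
      Nat.add_mul_div_left _ _ (by positivity)]
    omega
  rw [this]

theorem bitAt_add_two_pow (e j a : ℕ) :
    bitAt (2 ^ e) j (a + 2 ^ e * 2 ^ j) = (bitAt (2 ^ e) j a + 1) % 2 := by
  unfold bitAt
  rw [Nat.add_div_right _ (by positivity)]
  omega

/-- The program scatters from sources; this is the same map read as gathering at a target. A digit
`1` of `y` at position `j` determines a unique source, obtained by clearing that digit. -/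
theorem edgeOp_two_pow_apply {S e α c : ℕ} (f : ℕ → R) {y : ℕ} (hy : y < S) :
    edgeOp R S (2 ^ e) (2 ^ e) α c f y = ∑ j ∈ range c, if bitAt (2 ^ e) j y = 0 then 0 else
      bitSign R (2 ^ e) j y * (α : R) ^ j * f (y - 2 ^ e * 2 ^ j) := by
  simp only [edgeOp, LinearMap.coe_mk, AddHom.coe_mk, Finset.sum_apply, edgeTerm]
  rw [sum_comm]
  refine sum_congr rfl fun j _ => ?_
  have h2 : ∀ a, bitAt (2 ^ e) j a < 2 := fun a => Nat.mod_lt _ (by omega)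
  split_ifs with hb
  · refine sum_eq_zero fun a _ => ?_
    split_ifs with ha
    · refine Pi.single_eq_of_ne ?_ _
      rintro rfl
      rw [zero_add, bitAt_add_two_pow, ha] at hb
      omega
    · rfl
  · have hle : 2 ^ e * 2 ^ j ≤ y := by
      by_contra h
      exact hb (by rw [bitAt, Nat.div_eq_of_lt (not_le.1 h)])
    obtain ⟨a, rfl⟩ := Nat.exists_eq_add_of_le' hle
    have ha : bitAt (2 ^ e) j a = 0 := by
      rw [bitAt_add_two_pow] at hb
      have := h2 a
      omega
    rw [sum_eq_single a]
    · rw [if_pos ha, zero_add, Pi.single_eq_same, bitSign_add_two_pow, Nat.add_sub_cancel]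
    · intro b _ hba
      split_ifs
      · exact Pi.single_eq_of_ne (by omega) _
      · rfl
    · intro h
      exact absurd (mem_range.2 (by omega)) h

/-- With `p = 0`, division by zero makes every digit `0`, and `c = 1` leaves only `j = 0`: the
routine degenerates to a plain copy. The label `z` uses the same device with a shift by `4 ^ k`. -/
theorem opOne_apply {k t : ℕ} (f : ℕ → R) {y : ℕ} (hy : y < (t + 1) * 4 ^ k) :
    opOne R k t f y = f y := by
  simp only [opOne, edgeOp, LinearMap.coe_mk, AddHom.coe_mk, Finset.sum_apply, edgeTerm]
  simp only [range_one, sum_singleton, bitAt, zero_mul, Nat.div_zero, Nat.zero_mod, if_true]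
  rw [sum_eq_single y]
  · simp [bitSign]
  · intro b _ hb
    exact Pi.single_eq_of_ne (by omega) _
  · intro h
    exact absurd (mem_range.2 hy) h

theorem opZ_apply_add {k t : ℕ} (f : ℕ → R) {y : ℕ} (hy : y < (t + 1) * 4 ^ k) :
    opZ R k t f (y + 4 ^ k) = f y := by
  simp only [opZ, edgeOp, LinearMap.coe_mk, AddHom.coe_mk, Finset.sum_apply, edgeTerm]
  simp only [range_one, sum_singleton, bitAt, zero_mul, Nat.div_zero, Nat.zero_mod, if_true]
  rw [sum_eq_single y]
  · simp [bitSign]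
  · intro b _ hb
    exact Pi.single_eq_of_ne (by omega) _
  · intro h
    exact absurd (mem_range.2 hy) h

theorem opZ_apply_of_lt {k t : ℕ} (f : ℕ → R) {y : ℕ} (hy : y < 4 ^ k) :
    opZ R k t f y = 0 := by
  simp only [opZ, edgeOp, LinearMap.coe_mk, AddHom.coe_mk, Finset.sum_apply, edgeTerm]
  simp only [range_one, sum_singleton, bitAt, zero_mul, Nat.div_zero, Nat.zero_mod, if_true]
  refine sum_eq_zero fun a _ => Pi.single_eq_of_ne (by omega) _

/-- The coefficient of the basis vector `I` in the wedge product of the vectors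
`(1, α, α ^ 2, …)`, for `α` in the list. -/
def minor (R : Type*) [CommRing R] : List ℕ → Finset ℕ → R
  | [], I => if I = ∅ then 1 else 0
  | α :: A, I => ∑ j ∈ I, (-1) ^ #{i ∈ I | i < j} * (α : R) ^ j * minor R A (I.erase j)

theorem minor_cons (α : ℕ) (A : List ℕ) (I : Finset ℕ) : minor R (α :: A) I =
    ∑ j ∈ I, (-1) ^ #{i ∈ I | i < j} * (α : R) ^ j * minor R A (I.erase j) := rfl

theorem bitSign_eq {e j k y : ℕ} {I : Finset ℕ} (hj : j ≤ k)
    (h : ∀ i < k, bitAt (2 ^ e) i y = if i ∈ I then 1 else 0) :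
    bitSign R (2 ^ e) j y = (-1) ^ #{i ∈ I | i < j} := by
  rw [bitSign]
  have : ∀ i ∈ range j, (if bitAt (2 ^ e) i y = 0 then (1 : R) else -1) =
      if i ∈ I then -1 else 1 := by
    intro i hi
    rw [mem_range] at hi
    rw [h i (by omega)]
    split_ifs <;> simp_all
  rw [prod_congr rfl this, prod_ite, prod_const, prod_const_one, mul_one]
  congr 2
  ext i
  simp [and_comm]

theorem edgeOp_cell {S e k α y : ℕ} {I : Finset ℕ} (hI : I ⊆ range k) (f : ℕ → R) (hy : y < S)
    (h : ∀ i < k, bitAt (2 ^ e) i y = if i ∈ I then 1 else 0) :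
    edgeOp R S (2 ^ e) (2 ^ e) α k f y =
      ∑ j ∈ I, (-1) ^ #{i ∈ I | i < j} * (α : R) ^ j * f (y - 2 ^ e * 2 ^ j) := by
  rw [edgeOp_two_pow_apply f hy, ← sum_subset hI]
  · refine sum_congr rfl fun j hj => ?_
    have hjk := mem_range.1 (hI hj)
    rw [h j hjk, if_pos hj, if_neg one_ne_zero, bitSign_eq hjk.le h]
  · intro j hj hjI
    rw [h j (mem_range.1 hj), if_neg hjI, if_pos rfl]

/-- Removing `j` from a subset subtracts its power of two from the cell index, so each of the two
edges performs the recursion of `minor` in its own tensor factor and leaves the other alone. -/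
theorem opX_cell {k t α d : ℕ} {f : ℕ → R} {c : R} {A : List ℕ} (hd : d ≤ t)
    (hf : ∀ I J : Finset ℕ, I ⊆ range k → J ⊆ range k →
      f (cell k d I J) = c * (minor R A I * minor R A J))
    {I J : Finset ℕ} (hI : I ⊆ range k) (hJ : J ⊆ range k) :
    opX R k t α f (cell k d I J) = c * (minor R (α :: A) I * minor R (α :: A) J) := by
  have h1 : ∀ I J : Finset ℕ, I ⊆ range k → J ⊆ range k →
      edgeOp R ((t + 1) * 4 ^ k) 1 1 α k f (cell k d I J) =
        c * (minor R (α :: A) I * minor R A J) := by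
    intro I J hI hJ
    refine (edgeOp_cell (e := 0) hI f (cell_lt hI hJ hd)
      fun i hi => bitAt_cell_left hI hi).trans ?_
    rw [minor, sum_mul, mul_sum]
    refine sum_congr rfl fun j hj => ?_
    have : cell k d I J - 2 ^ 0 * 2 ^ j = cell k d (I.erase j) J := by
      unfold cell; rw [mask_erase hj]; omega
    rw [this, hf _ _ ((erase_subset _ _).trans hI) hJ]
    ring
  rw [opX, LinearMap.comp_apply, edgeOp_cell hJ _ (cell_lt hI hJ hd)
    fun i hi => bitAt_cell_right hI hJ hi, minor_cons α A J, mul_sum, mul_sum]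
  refine sum_congr rfl fun j hj => ?_
  have : cell k d I J - 2 ^ k * 2 ^ j = cell k d I (J.erase j) := by
    have := mask_erase hj
    unfold cell
    rw [this, show mask I + 2 ^ k * (mask (J.erase j) + 2 ^ j + 2 ^ k * d) =
      mask I + 2 ^ k * (mask (J.erase j) + 2 ^ k * d) + 2 ^ k * 2 ^ j by ring,
      Nat.add_sub_cancel]
  rw [this, h1 _ _ hI ((erase_subset _ _).trans hJ)]
  ring

/-- The recursion of `minor` is Laplace expansion along the first row. The signs agree because
exactly `c` elements of the image lie below `f c`. -/
theorem minor_image {m : ℕ} (v f : Fin m → ℕ) (hf : StrictMono f) :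
    minor R (List.ofFn v) (univ.image f) =
      (Matrix.of fun r c => (v r : R) ^ f c : Matrix (Fin m) (Fin m) R).det := by
  induction m with
  | zero => simp [minor]
  | succ m ih =>
    rw [List.ofFn_succ, minor, Matrix.det_succ_row_zero, sum_image fun _ _ _ _ h => hf.injective h]
    refine sum_congr rfl fun c _ => ?_
    have h1 : #{i ∈ univ.image f | i < f c} = (c : ℕ) := by
      have : (univ.image f).filter (· < f c) = (Finset.Iio c).image f := by
        ext i
        simp only [mem_filter, mem_image, mem_univ, true_and, mem_Iio]
        constructor
        · rintro ⟨⟨a, rfl⟩, h⟩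
          exact ⟨a, hf.lt_iff_lt.1 h, rfl⟩
        · rintro ⟨a, h, rfl⟩
          exact ⟨⟨a, rfl⟩, hf h⟩
      rw [this, card_image_of_injective _ hf.injective, Fin.card_Iio]
    have h2 : (univ.image f).erase (f c) = univ.image (f ∘ c.succAbove) := by
      ext i
      simp only [mem_erase, mem_image, mem_univ, true_and, Function.comp]
      constructor
      · rintro ⟨h, a, rfl⟩
        obtain ⟨b, rfl⟩ := Fin.exists_succAbove_eq (fun h' : a = c => h (h' ▸ rfl))
        exact ⟨b, rfl⟩
      · rintro ⟨a, rfl⟩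
        exact ⟨fun h => Fin.succAbove_ne c a (hf.injective h), _, rfl⟩
    rw [h1, h2, ih _ _ (hf.comp (Fin.strictMono_succAbove c))]
    rfl

theorem minor_range (v : List ℕ) :
    minor R v (range v.length) = (Matrix.vandermonde fun i : Fin v.length => (v.get i : R)).det := by
  have h : univ.image (fun i : Fin v.length => (i : ℕ)) = range v.length := by
    ext i
    simp only [mem_image, mem_univ, true_and, mem_range]
    exact ⟨fun ⟨a, h⟩ => h ▸ a.2, fun h => ⟨⟨i, h⟩, rfl⟩⟩
  have := minor_image (R := R) v.get (fun i => (i : ℕ)) (fun _ _ h => h)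
  rw [h, List.ofFn_get] at this
  rw [this]
  rfl

theorem minor_eq_zero {A : List ℕ} {I : Finset ℕ} (h : #I ≠ A.length) : minor R A I = 0 := by
  induction A generalizing I with
  | nil => rw [minor, if_neg]; rintro rfl; simp at h
  | cons α A ih =>
    refine sum_eq_zero fun j hj => ?_
    rw [ih, mul_zero]
    rw [card_erase_of_mem hj]
    rw [List.length_cons] at h
    have := card_pos.2 ⟨j, hj⟩
    omega

theorem minor_intCast (A : List ℕ) (I : Finset ℕ) : ((minor ℤ A I : ℤ) : R) = minor R A I := by
  induction A generalizing I with
  | nil => unfold minor; split_ifs <;> simp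
  | cons α A ih => simp [minor, ih]

end Ops

/-- A wedge of a different number of vectors has no top component; for exactly `k` vectors this is
the Vandermonde criterion, valid over `ℤ`. -/
theorem minor_range_ne_zero_iff {A : List ℕ} {k : ℕ} :
    minor ℤ A (range k) ≠ 0 ↔ A.length = k ∧ A.Nodup := by
  by_cases h : A.length = k
  · subst h
    rw [minor_range, Matrix.det_vandermonde_ne_zero_iff, List.nodup_iff_injective_get]
    simp only [true_and]
    exact ⟨fun h => Function.Injective.of_comp (f := fun a : ℕ => (a : ℤ)) h,
      fun h => Nat.cast_injective.comp h⟩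
  · simp [h, minor_eq_zero (R := ℤ) (A := A) (I := range k) (by simpa using Ne.symm h)]

/-- The Vandermonde determinant is a product of at most `k * k` differences, each of absolute value
at most `B`. -/
theorem minor_range_sq_le {A : List ℕ} {k B : ℕ} (hA : ∀ α ∈ A, α ≤ B) (hB : 0 < B) :
    minor ℤ A (range k) ^ 2 ≤ (B : ℤ) ^ (2 * (k * k)) := by
  by_cases h : A.length = k
  · subst h
    rw [minor_range, Matrix.det_vandermonde, ← sq_abs, mul_comm, pow_mul]
    have hB' : (1 : ℤ) ≤ B := by exact_mod_cast hB
    refine pow_le_pow_left₀ (abs_nonneg _) ?_ 2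
    rw [abs_prod, pow_mul]
    have h1 : ∀ i : Fin A.length, |∏ j ∈ Finset.Ioi i, ((A.get j : ℤ) - A.get i)| ≤
        (B : ℤ) ^ A.length := by
      intro i
      rw [abs_prod]
      calc ∏ j ∈ Finset.Ioi i, |(A.get j : ℤ) - A.get i| ≤ ∏ _j ∈ Finset.Ioi i, (B : ℤ) := by
            refine prod_le_prod (fun _ _ => abs_nonneg _) fun j _ => ?_
            have h1 := hA _ (A.get_mem i)
            have h2 := hA _ (A.get_mem j)
            rw [abs_le]
            constructor <;> omega
        _ ≤ (B : ℤ) ^ A.length := by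
            rw [prod_const]
            refine pow_le_pow_right₀ hB' ?_
            simpa using card_le_univ (Finset.Ioi i)
    calc _ ≤ ∏ _i : Fin A.length, (B : ℤ) ^ A.length :=
          prod_le_prod (fun _ _ => abs_nonneg _) fun i _ => h1 i
      _ = _ := by simp
  · rw [minor_eq_zero (by simpa using Ne.symm h)]
    positivity

/-! ### Words of letters and their action -/

/-- The letters of which the monomials of a formula are made up: `1`, `z`, and copies of variables,
which are numbered. -/
inductive Letter
  | one
  | z
  | x (α : ℕ)

namespace Letter

/-- The action of a letter. -/
noncomputable def act (R : Type*) [CommRing R] (k t : ℕ) : Letter → Module.End R (ℕ → R)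
  | one => opOne R k t
  | z => opZ R k t
  | x α => opX R k t α

/-- The action of a word. -/
noncomputable def wordAct (R : Type*) [CommRing R] (k t : ℕ) : List Letter → Module.End R (ℕ → R)
  | [] => LinearMap.id
  | l :: w => l.act R k t ∘ₗ wordAct R k t w

/-- The number of letters `z` of a word. -/
def zs : List Letter → ℕ
  | [] => 0
  | one :: w => zs w
  | z :: w => zs w + 1
  | x _ :: w => zs w

/-- The copies of variables in a word. -/
def xs : List Letter → List ℕ
  | [] => []
  | one :: w => xs w
  | z :: w => xs w
  | x α :: w => α :: xs w

theorem wordAct_append (R : Type*) [CommRing R] (k t : ℕ) (u v : List Letter) :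
    wordAct R k t (u ++ v) = wordAct R k t u ∘ₗ wordAct R k t v := by
  induction u with
  | nil => rfl
  | cons l u ih => rw [List.cons_append, wordAct, ih, wordAct, LinearMap.comp_assoc]

theorem xs_append (u v : List Letter) : xs (u ++ v) = xs u ++ xs v := by
  induction u with
  | nil => rfl
  | cons l u ih => cases l <;> simp [xs, ih]

theorem zs_append (u v : List Letter) : zs (u ++ v) = zs u + zs v := by
  induction u with
  | nil => simp [zs]
  | cons l u ih => cases l <;> simp [zs, ih]; omega

/-- The image of the unit is a pure tensor: a power of `z` times the same wedge product in both
factors. Truncation above degree `t` is harmless since letters never lower the `z`-degree. -/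
theorem wordAct_cell (R : Type*) [CommRing R] {k t : ℕ} (w : List Letter) {d : ℕ} (hd : d ≤ t)
    (I J : Finset ℕ) (hI : I ⊆ range k) (hJ : J ⊆ range k) :
    wordAct R k t w (Pi.single 0 1) (cell k d I J) =
      (if d = zs w then 1 else 0) * (minor R (xs w) I * minor R (xs w) J) := by
  induction w generalizing d I J with
  | nil =>
    have h0 : ∀ I : Finset ℕ, mask I = 0 ↔ I = ∅ := by
      intro I
      rw [mask, sum_eq_zero_iff]
      simp [eq_empty_iff_forall_notMem]
    simp only [wordAct, LinearMap.id_apply, zs, xs, minor]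
    rw [Pi.single_apply]
    have : cell k d I J = 0 ↔ I = ∅ ∧ J = ∅ ∧ d = 0 := by
      unfold cell
      rw [← h0, ← h0]
      simp
    simp only [this]
    by_cases h1 : I = ∅ <;> by_cases h2 : J = ∅ <;> by_cases h3 : d = 0 <;> simp [h1, h2, h3]
  | cons l w ih =>
    cases l with
    | one =>
      rw [wordAct, LinearMap.comp_apply, act, opOne_apply _ (cell_lt hI hJ hd), ih hd I J hI hJ]
      rfl
    | z =>
      rw [wordAct, LinearMap.comp_apply, act]
      cases d with
      | zero =>
        rw [opZ_apply_of_lt _ (by simpa using cell_lt (t := 0) hI hJ le_rfl)]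
        simp [zs]
      | succ d =>
        have : cell k (d + 1) I J = cell k d I J + 4 ^ k := by
          unfold cell
          rw [show (4 : ℕ) = 2 * 2 from rfl, mul_pow]
          ring
        rw [this, opZ_apply_add _ (cell_lt hI hJ (by omega)), ih (by omega) I J hI hJ]
        simp [zs, xs]
    | x α =>
      rw [wordAct, LinearMap.comp_apply, act, opX_cell hd (fun I J hI hJ => ih hd I J hI hJ) hI hJ]
      rfl

/-- Two letters are copies of the same terminal; a variable has `r` copies. -/
inductive Similar (r : ℕ) : Letter → Letter → Prop
  | one : Similar r one one
  | z : Similar r z z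
  | x {α β : ℕ} : α / r = β / r → Similar r (x α) (x β)

/-- Copies are chosen greedily from the end of the word. If all `r` copies of a variable were
already taken, the new letter would be its occurrence number `r + 1`. -/
theorem exists_similar_nodup {r : ℕ} (hr : 0 < r) (w : List Letter)
    (h : ∀ i, (xs w).countP (· / r = i) ≤ r) :
    ∃ w', List.Forall₂ (Similar r) w' w ∧ (xs w').Nodup := by
  have key : ∀ {w w'}, List.Forall₂ (Similar r) w' w → ∀ i,
      (xs w').countP (· / r = i) = (xs w).countP (· / r = i) := by
    intro w w' h i
    induction h with
    | nil => rfl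
    | cons h _ ih =>
      cases h with
      | one => exact ih
      | z => exact ih
      | x h => simp [xs, List.countP_cons, ih, h]
  induction w with
  | nil => exact ⟨[], .nil, List.nodup_nil⟩
  | cons l w ih =>
    cases l with
    | one =>
      obtain ⟨w', h1, h2⟩ := ih h
      exact ⟨one :: w', .cons .one h1, h2⟩
    | z =>
      obtain ⟨w', h1, h2⟩ := ih h
      exact ⟨z :: w', .cons .z h1, h2⟩
    | x α =>
      simp only [xs, List.countP_cons] at h
      obtain ⟨w', h1, h2⟩ := ih fun i => (Nat.le_add_right _ _).trans (h i)
      obtain ⟨β, hβ, hβ'⟩ : ∃ β, β / r = α / r ∧ β ∉ xs w' := by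
        by_contra! hc
        have hsub : (range r).image (fun j => r * (α / r) + j) ⊆
            ((xs w').filter (· / r = α / r)).toFinset := by
          intro β hβ
          obtain ⟨j, hj, rfl⟩ := mem_image.1 hβ
          have e : (r * (α / r) + j) / r = α / r := by
            rw [Nat.mul_add_div hr, Nat.div_eq_of_lt (mem_range.1 hj), add_zero]
          rw [List.mem_toFinset, List.mem_filter]
          exact ⟨hc _ e, by simpa using e⟩
        have h3 := card_le_card hsub
        rw [card_image_of_injective _ (add_right_injective _), card_range] at h3
        have h4 := List.toFinset_card_le ((xs w').filter (· / r = α / r))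
        have h5 := h (α / r)
        rw [← List.countP_eq_length_filter, key h1] at h4
        simp at h5
        omega
      exact ⟨x β :: w', .cons (.x hβ) h1, by simp [xs, hβ', h2]⟩

/-- The exponents of a word, when each of `n` variables has `r` copies. -/
noncomputable def exps (n r : ℕ) (w : List Letter) : Option (Fin n) →₀ ℕ :=
  (w.map fun
    | one => 0
    | z => Finsupp.single none 1
    | x α => if h : α / r < n then Finsupp.single (some ⟨α / r, h⟩) 1 else 0).sum

theorem exps_append (n r : ℕ) (u v : List Letter) :
    exps n r (u ++ v) = exps n r u + exps n r v := by simp [exps]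

theorem exps_none (n r : ℕ) (w : List Letter) : exps n r w none = zs w := by
  induction w with
  | nil => rfl
  | cons l w ih =>
    rw [← List.singleton_append, exps_append, zs_append, Finsupp.add_apply, ih]
    congr 1
    cases l with
    | one => simp [exps, zs]
    | z => simp [exps, zs]
    | x α => simp only [exps, zs, List.map_cons, List.map_nil, List.sum_singleton]; split_ifs <;> simp

theorem exps_some (n r : ℕ) (w : List Letter) (i : Fin n) :
    exps n r w (some i) = (xs w).countP (· / r = i) := by
  induction w with
  | nil => rfl
  | cons l w ih =>
    rw [← List.singleton_append, exps_append, xs_append, Finsupp.add_apply, ih, List.countP_append]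
    congr 1
    cases l with
    | one => simp [exps, xs]
    | z => simp [exps, xs]
    | x α =>
      simp only [exps, xs, List.map_cons, List.map_nil, List.sum_singleton, List.countP_cons,
        List.countP_nil, zero_add]
      split_ifs with h1 h2 h2
      · simp only [decide_eq_true_eq] at h2
        rw [Finsupp.single_apply, if_pos (congrArg some (Fin.ext h2))]
      · simp only [decide_eq_true_eq] at h2
        rw [Finsupp.single_apply, if_neg]
        simpa [Fin.ext_iff] using h2
      · simp only [decide_eq_true_eq] at h2
        omega
      · rfl

theorem degree_exps_some {n r : ℕ} {w : List Letter} (h : ∀ α ∈ xs w, α / r < n) :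
    (exps n r w).some.degree = (xs w).length := by
  induction w with
  | nil => simp [exps, xs]
  | cons l w ih =>
    rw [← List.singleton_append, xs_append] at h ⊢
    rw [exps_append, Finsupp.some_add, map_add, List.length_append,
      ih fun α hα => h α (List.mem_append_right _ hα)]
    congr 1
    cases l with
    | one => simp [exps, xs]
    | z => simp [exps, xs]
    | x α =>
      have : α / r < n := h α (by simp [xs])
      simp [exps, xs, this]

end Letter

open Letter

/-! ### Expanding a formula into words; the nonvanishing criterion -/

namespace Formula

/-- The words of a formula, one for every way to choose a summand at every `+` gate and a copy at
every variable, written from right to left. -/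
def words {n : ℕ} (r : ℕ) : Formula n → List (List Letter)
  | one => [[.one]]
  | z => [[.z]]
  | x i => (List.range r).map fun j => [.x (i * r + j)]
  | mul a b => (b.words r).flatMap fun v => (a.words r).map fun u => v ++ u
  | add _ f => (List.ofFn fun i => (f i).words r).flatten

variable {n : ℕ}

/-- Distributivity of composition over sums. The first factor acts first, hence the order from right
to left in `words`. -/
theorem act_eq_sum_words (R : Type*) [CommRing R] (k t r : ℕ) (φ : Formula n) :
    φ.act R k t r = ((φ.words r).map (wordAct R k t)).sum := by
  induction φ with
  | one => simp [words, act, wordAct, Letter.act]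
  | z => simp [words, act, wordAct, Letter.act]
  | x i =>
    have h : ∀ (g : ℕ → Module.End R (ℕ → R)) (m : ℕ),
        ∑ j ∈ range m, g j = ((List.range m).map g).sum := by
      intro g m
      induction m with
      | zero => simp
      | succ m ih => rw [sum_range_succ, ih, List.range_succ, List.map_append, List.sum_append]; simp
    rw [words, act, List.map_map, h]
    rfl
  | mul a b iha ihb =>
    rw [act, iha, ihb, words, ← Module.End.mul_eq_comp]
    generalize a.words r = A
    generalize b.words r = B
    induction B with
    | nil => simp
    | cons v B ih =>
      rw [List.map_cons, List.sum_cons, add_mul, ih, List.flatMap_cons, List.map_append,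
        List.sum_append, List.map_map, ← List.sum_map_mul_left]
      congr 2
      refine List.map_congr_left fun u _ => ?_
      rw [Function.comp, wordAct_append, Module.End.mul_eq_comp]
  | add m f ih =>
    rw [act, words, List.map_flatten, List.sum_flatten, List.map_map, List.map_ofFn, List.sum_ofFn]
    exact Finset.sum_congr rfl fun i _ => ih i

theorem length_words_le {r B : ℕ} (hr : r ≤ B) (hB : 2 ≤ B) (φ : Formula n) :
    (φ.words r).length ≤ B ^ φ.encode.length := by
  induction φ with
  | one => simpa [words, encode] using hB.trans' (by omega)
  | z => simpa [words, encode] using hB.trans' (by omega)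
  | x i => simpa [words, encode] using hr.trans (Nat.le_self_pow (by omega) B)
  | mul a b iha ihb =>
    have : (words r (a.mul b)).length = (b.words r).length * (a.words r).length := by
      simp [words, List.length_flatMap]
    rw [this, encode, List.length_cons, List.length_append]
    calc _ ≤ B ^ b.encode.length * B ^ a.encode.length := Nat.mul_le_mul ihb iha
      _ = B ^ (a.encode.length + b.encode.length) := by rw [pow_add, mul_comm]
      _ ≤ _ := Nat.pow_le_pow_right (by omega) (by omega)
  | add m f ih =>
    -- A sum of two numbers that are at least `2` is at most their product. The extra factor `B` and
    -- the `+ 1` keep this valid from the empty set on.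
    have key : ∀ s : Finset (Fin m), ∑ i ∈ s, ((f i).words r).length + 1 ≤
        B ^ (1 + ∑ i ∈ s, (f i).encode.length) := by
      intro s
      induction s using Finset.induction_on with
      | empty => simpa using hB.trans' (by omega)
      | insert i s hi ihs =>
        rw [sum_insert hi, sum_insert hi, show 1 + ((f i).encode.length +
          ∑ i ∈ s, (f i).encode.length) = (f i).encode.length +
          (1 + ∑ i ∈ s, (f i).encode.length) by ring, pow_add]
        have h1 := ih i
        have h2 : B ≤ B ^ (f i).encode.length := Nat.le_self_pow (by
          cases f i <;> simp [encode]) B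
        have h3 : B ≤ B ^ (1 + ∑ i ∈ s, (f i).encode.length) := Nat.le_self_pow (by omega) B
        nlinarith
    have h1 : (words r (add m f)).length = ∑ i, ((f i).words r).length := by
      rw [words, List.length_flatten, List.map_ofFn, List.sum_ofFn]; rfl
    have h2 : (encode (add m f)).length = ∑ i, (f i).encode.length + 2 := by
      rw [encode, List.length_cons, List.length_cons, List.length_flatten, List.map_ofFn,
        List.sum_ofFn]; rfl
    rw [h1, h2]
    have := key univ
    have h4 : B ^ (1 + ∑ i, (f i).encode.length) ≤ B ^ (∑ i, (f i).encode.length + 2) :=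
      Nat.pow_le_pow_right (by omega) (by omega)
    omega

theorem lt_of_mem_words {r : ℕ} (φ : Formula n) {w : List Letter} (hw : w ∈ φ.words r) :
    ∀ α ∈ xs w, α < n * r := by
  induction φ generalizing w with
  | one => rw [words, List.mem_singleton] at hw; subst hw; simp [xs]
  | z => rw [words, List.mem_singleton] at hw; subst hw; simp [xs]
  | x i =>
    rw [words, List.mem_map] at hw
    obtain ⟨j, hj, rfl⟩ := hw
    rw [List.mem_range] at hj
    simp only [xs, List.mem_singleton, forall_eq]
    have := Nat.mul_le_mul_right r (Nat.succ_le_of_lt i.2)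
    rw [Nat.succ_mul] at this
    omega
  | mul a b iha ihb =>
    rw [words, List.mem_flatMap] at hw
    obtain ⟨v, hv, hw⟩ := hw
    obtain ⟨u, hu, rfl⟩ := List.mem_map.1 hw
    intro α hα
    rw [xs_append, List.mem_append] at hα
    exact hα.elim (ihb hv α) (iha hu α)
  | add m f ih =>
    rw [words, List.mem_flatten] at hw
    obtain ⟨l, hl, hw⟩ := hw
    obtain ⟨i, rfl⟩ := (List.mem_ofFn' _ _).1 hl
    exact ih i hw

/-- The copy at each occurrence of a variable is chosen independently, so any rechoice is again a
word of the formula. -/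
theorem mem_words_of_similar {r : ℕ} (φ : Formula n) {w w' : List Letter}
    (h : List.Forall₂ (Similar r) w' w) (hw : w ∈ φ.words r) : w' ∈ φ.words r := by
  induction φ generalizing w w' with
  | one =>
    rw [words, List.mem_singleton] at hw ⊢
    subst hw
    cases h with | cons h h' => cases h' with | nil => cases h with | one => rfl
  | z =>
    rw [words, List.mem_singleton] at hw ⊢
    subst hw
    cases h with | cons h h' => cases h' with | nil => cases h with | z => rfl
  | x i =>
    rw [words, List.mem_map] at hw ⊢
    obtain ⟨j, hj, rfl⟩ := hw
    rw [List.mem_range] at hj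
    cases h with | cons h h' => cases h' with | nil => cases h with | @x α _ h =>
    have hr : 0 < r := by omega
    refine ⟨α % r, List.mem_range.2 (Nat.mod_lt _ hr), ?_⟩
    rw [mul_comm, Nat.mul_add_div hr, Nat.div_eq_of_lt hj, add_zero] at h
    rw [← h, Nat.div_add_mod']
  | mul a b iha ihb =>
    rw [words, List.mem_flatMap] at hw ⊢
    obtain ⟨v, hv, hw⟩ := hw
    obtain ⟨u, hu, rfl⟩ := List.mem_map.1 hw
    exact ⟨_, ihb (List.forall₂_take_append _ _ _ h) hv, List.mem_map.2
      ⟨_, iha (List.forall₂_drop_append _ _ _ h) hu, List.take_append_drop _ _⟩⟩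
  | add m f ih =>
    rw [words, List.mem_flatten] at hw ⊢
    obtain ⟨l, hl, hw⟩ := hw
    obtain ⟨i, rfl⟩ := (List.mem_ofFn' _ _).1 hl
    exact ⟨_, hl, ih i h hw⟩

/-- Nonnegativity is carried through the induction: a sum of nonnegative terms is nonzero iff one of
them is, so no monomial cancels. -/
theorem coeff_poly {r : ℕ} (hr : 0 < r) (φ : Formula n) (μ : Option (Fin n) →₀ ℕ) :
    0 ≤ φ.poly.coeff μ ∧ (φ.poly.coeff μ ≠ 0 ↔ ∃ w ∈ φ.words r, exps n r w = μ) := by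
  induction φ generalizing μ with
  | one =>
    rw [poly, MvPolynomial.coeff_one]
    split_ifs with h <;> simpa [words, exps] using h
  | z =>
    rw [poly, MvPolynomial.coeff_X]
    split_ifs with h <;> simpa [words, exps] using h
  | x i =>
    rw [poly, MvPolynomial.coeff_X]
    have e : ∀ j < r, exps n r [.x (i * r + j)] = Finsupp.single (some i) 1 := by
      intro j hj
      have : ((i : ℕ) * r + j) / r = i := by
        rw [mul_comm, Nat.mul_add_div hr, Nat.div_eq_of_lt hj, add_zero]
      simp [exps, this]
    have : (∃ w ∈ words r (x i), exps n r w = μ) ↔ Finsupp.single (some i) 1 = μ := by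
      constructor
      · rintro ⟨w, hw, rfl⟩
        rw [words, List.mem_map] at hw
        obtain ⟨j, hj, rfl⟩ := hw
        exact (e j (List.mem_range.1 hj)).symm
      · rintro rfl
        exact ⟨_, List.mem_map.2 ⟨0, List.mem_range.2 hr, rfl⟩, e 0 hr⟩
    rw [this]
    split_ifs with h <;> simp [h]
  | mul a b iha ihb =>
    rw [poly, MvPolynomial.coeff_mul]
    have h0 : ∀ x ∈ antidiagonal μ, 0 ≤ a.poly.coeff x.1 * b.poly.coeff x.2 :=
      fun x _ => mul_nonneg (iha _).1 (ihb _).1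
    refine ⟨sum_nonneg h0, ?_⟩
    rw [ne_eq, sum_eq_zero_iff_of_nonneg h0]
    push Not
    constructor
    · rintro ⟨⟨μ₁, μ₂⟩, hμ, h⟩
      obtain ⟨u, hu, rfl⟩ := (iha _).2.1 (left_ne_zero_of_mul h)
      obtain ⟨v, hv, rfl⟩ := (ihb _).2.1 (right_ne_zero_of_mul h)
      refine ⟨v ++ u, List.mem_flatMap.2 ⟨v, hv, List.mem_map.2 ⟨u, hu, rfl⟩⟩, ?_⟩
      rw [exps_append, add_comm]
      exact mem_antidiagonal.1 hμ
    · rintro ⟨w, hw, rfl⟩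
      rw [words, List.mem_flatMap] at hw
      obtain ⟨v, hv, hw⟩ := hw
      obtain ⟨u, hu, rfl⟩ := List.mem_map.1 hw
      refine ⟨(exps n r u, exps n r v), mem_antidiagonal.2 ?_, mul_ne_zero ((iha _).2.2 ⟨u, hu, rfl⟩)
        ((ihb _).2.2 ⟨v, hv, rfl⟩)⟩
      rw [exps_append, add_comm]
  | add m f ih =>
    rw [poly, MvPolynomial.coeff_sum]
    have h0 : ∀ i ∈ univ, 0 ≤ (f i).poly.coeff μ := fun i _ => (ih i _).1
    refine ⟨sum_nonneg h0, ?_⟩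
    rw [ne_eq, sum_eq_zero_iff_of_nonneg h0]
    push Not
    constructor
    · rintro ⟨i, -, h⟩
      obtain ⟨w, hw, rfl⟩ := (ih i _).2.1 h
      exact ⟨w, List.mem_flatten.2 ⟨_, (List.mem_ofFn' _ _).2 ⟨i, rfl⟩, hw⟩, rfl⟩
    · rintro ⟨w, hw, rfl⟩
      rw [words, List.mem_flatten] at hw
      obtain ⟨l, hl, hw⟩ := hw
      obtain ⟨i, rfl⟩ := (List.mem_ofFn' _ _).1 hl
      exact ⟨i, mem_univ _, (ih i _).2.2 ⟨w, hw, rfl⟩⟩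

/-- With `q - 1` copies per variable, distinct copies force exponents at most `q - 1`; conversely
such exponents leave room to make all copies distinct. -/
theorem hasMarkedQMonomial_iff {q : ℕ} (hq : 2 ≤ q) (k t : ℕ) (φ : Formula n) :
    HasMarkedQMonomial q k t φ.poly ↔
      ∃ w ∈ φ.words (q - 1), zs w = t ∧ (xs w).length = k ∧ (xs w).Nodup := by
  have hr : 0 < q - 1 := by omega
  have hn : ∀ w ∈ φ.words (q - 1), ∀ α ∈ xs w, α / (q - 1) < n := fun w hw α hα =>
    (Nat.div_lt_iff_lt_mul hr).2 (φ.lt_of_mem_words hw α hα)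
  constructor
  · rintro ⟨p, hp, hk, hs⟩
    obtain ⟨w, hw, he⟩ := (φ.coeff_poly hr _).2.1 (MvPolynomial.mem_support_iff.1 hs)
    have hsome : (exps n (q - 1) w).some = p := by
      ext i
      rw [he, Finsupp.some_apply, Finsupp.add_apply,
        Finsupp.mapDomain_apply (Option.some_injective _)]
      simp
    have hnone : zs w = t := by
      rw [← exps_none n (q - 1) w, he, Finsupp.add_apply,
        Finsupp.mapDomain_of_notMem_range _ _ (by simp)]
      simp
    have hlen : (xs w).length = k := by rw [← degree_exps_some (hn w hw), hsome, hk]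
    obtain ⟨w', hsim, hnd⟩ := exists_similar_nodup hr w (by
      intro i
      by_cases hi : i < n
      · have := exps_some n (q - 1) w ⟨i, hi⟩
        rw [← Finsupp.some_apply, hsome] at this
        rw [← this]
        by_cases h : (⟨i, hi⟩ : Fin n) ∈ p.support
        · exact (hp _ h).2
        · rw [Finsupp.notMem_support_iff.1 h]; omega
      · rw [List.countP_eq_zero.2]
        · omega
        · intro α hα h
          have := hn w hw α hα
          simp only [decide_eq_true_eq] at h
          omega)
    have hz : ∀ {w w'}, List.Forall₂ (Similar (q - 1)) w' w →
        zs w' = zs w ∧ (xs w').length = (xs w).length := by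
      intro w w' h
      induction h with
      | nil => exact ⟨rfl, rfl⟩
      | cons h _ ih => cases h <;> simp [zs, xs, ih]
    exact ⟨w', φ.mem_words_of_similar hsim hw, (hz hsim).1.trans hnone, (hz hsim).2.trans hlen, hnd⟩
  · rintro ⟨w, hw, ht, hk, hnd⟩
    refine ⟨(exps n (q - 1) w).some, ?_, (degree_exps_some (hn w hw)).trans hk, ?_⟩
    · intro i hi
      refine ⟨Nat.one_le_iff_ne_zero.2 (Finsupp.mem_support_iff.1 hi), ?_⟩
      rw [Finsupp.some_apply, exps_some, List.countP_eq_length_filter,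
        ← List.toFinset_card_of_nodup (hnd.filter _)]
      have hsub : ((xs w).filter (· / (q - 1) = i)).toFinset ⊆
          (range (q - 1)).image (fun j => (q - 1) * i + j) := by
        intro α hα
        rw [List.mem_toFinset, List.mem_filter, decide_eq_true_eq] at hα
        refine mem_image.2 ⟨α % (q - 1), mem_range.2 (Nat.mod_lt _ hr), ?_⟩
        rw [← hα.2, Nat.div_add_mod]
      exact (card_le_card hsub).trans (card_image_le.trans (by simp))
    · rw [MvPolynomial.mem_support_iff, (φ.coeff_poly hr _).2]
      refine ⟨w, hw, ?_⟩
      ext i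
      cases i with
      | none =>
        rw [exps_none, ht, Finsupp.add_apply, Finsupp.mapDomain_of_notMem_range _ _ (by simp)]
        simp
      | some i =>
        rw [Finsupp.add_apply, Finsupp.mapDomain_apply (Option.some_injective _)]
        simp

/-- The value at the top cell of the block that a formula produces from the unit vector. -/
theorem act_apply_eq_zero_iff {q k t M B : ℕ} (hq : 2 ≤ q) (φ : Formula n) (hB : n * (q - 1) ≤ B)
    (hqB : q ≤ B) (hM : B ^ (φ.encode.length + 2 * (k * k)) < M) :
    φ.act (ZMod M) k t (q - 1) (Pi.single 0 1) (cell k t (range k) (range k)) = 0 ↔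
      ¬ HasMarkedQMonomial q k t φ.poly := by
  -- The contribution of a word, lifted to `ℤ`. The two exterior algebras turn the determinant into
  -- its square, so contributions cannot cancel.
  set g : List Letter → ℤ := fun w => if t = zs w then minor ℤ (xs w) (range k) ^ 2 else 0 with hg
  have h0 : ∀ w, 0 ≤ g w := fun w => by simp only [hg]; split_ifs <;> positivity
  have hval : φ.act (ZMod M) k t (q - 1) (Pi.single 0 1) (cell k t (range k) (range k)) =
      ((((φ.words (q - 1)).map g).sum : ℤ) : ZMod M) := by
    rw [act_eq_sum_words]
    induction φ.words (q - 1) with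
    | nil => simp
    | cons w L ih =>
      rw [List.map_cons, List.sum_cons, LinearMap.add_apply, Pi.add_apply, ih, List.map_cons,
        List.sum_cons, Int.cast_add, wordAct_cell _ _ le_rfl _ _ subset_rfl subset_rfl]
      congr 1
      simp only [hg]
      split_ifs
      · rw [Int.cast_pow, minor_intCast, one_mul, pow_two]
      · simp
  have hle : ∀ w ∈ φ.words (q - 1), g w ≤ (B : ℤ) ^ (2 * (k * k)) := by
    intro w hw
    simp only [hg]
    split_ifs
    · exact minor_range_sq_le (fun α hα => (φ.lt_of_mem_words hw α hα).le.trans hB) (by omega)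
    · positivity
  -- The number of words times the largest square is below `M`, so the integer vanishes as soon as
  -- its residue does.
  have hsum : ((φ.words (q - 1)).map g).sum < M := by
    have h1 : ((φ.words (q - 1)).map g).sum ≤
        (φ.words (q - 1)).length • (B : ℤ) ^ (2 * (k * k)) := by
      have := List.sum_le_card_nsmul ((φ.words (q - 1)).map g) ((B : ℤ) ^ (2 * (k * k))) (by
        intro x hx
        obtain ⟨w, hw, rfl⟩ := List.mem_map.1 hx
        exact hle w hw)
      simpa using this
    have h2 := φ.length_words_le (r := q - 1) (B := B) (by omega) (by omega)
    calc _ ≤ _ := h1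
      _ ≤ ((B ^ φ.encode.length : ℕ) : ℤ) * (B : ℤ) ^ (2 * (k * k)) := by
          rw [nsmul_eq_mul]
          gcongr
      _ < M := by
          rw [pow_add] at hM
          exact_mod_cast hM
  have hnn : 0 ≤ ((φ.words (q - 1)).map g).sum := List.sum_nonneg (by
    intro x hx
    obtain ⟨w, -, rfl⟩ := List.mem_map.1 hx
    exact h0 w)
  rw [hval, ZMod.intCast_zmod_eq_zero_iff_dvd, hasMarkedQMonomial_iff hq]
  have hz : (M : ℤ) ∣ ((φ.words (q - 1)).map g).sum ↔ ((φ.words (q - 1)).map g).sum = 0 :=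
    ⟨fun h => Int.eq_zero_of_dvd_of_nonneg_of_lt hnn hsum h, fun h => h ▸ dvd_zero _⟩
  have hz' : ((φ.words (q - 1)).map g).sum = 0 ↔ ∀ w ∈ φ.words (q - 1), g w = 0 := by
    generalize φ.words (q - 1) = L
    induction L with
    | nil => simp
    | cons w L ih =>
      have : 0 ≤ (L.map g).sum := List.sum_nonneg (by
        intro x hx
        obtain ⟨w, -, rfl⟩ := List.mem_map.1 hx
        exact h0 w)
      rw [List.map_cons, List.sum_cons, List.forall_mem_cons, ← ih]
      have := h0 w
      omega
  rw [hz, hz']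
  push Not
  refine forall₂_congr fun w _ => ?_
  have := minor_range_ne_zero_iff (A := xs w) (k := k)
  simp only [hg]
  split_ifs with h
  · rw [sq_eq_zero_iff, ← not_iff_not, ← ne_eq, this]
    push Not
    simp [h.symm]
  · simp [Ne.symm h]

end Formula

end Words

/-! ### The complete program: scanning, preparation, answer -/

namespace RAM

/-- Skip over a token. -/
def scanBody : Prog :=
  .seq (.op .sub 15 15 5) <| .seq (.load 19 14) <| .seq (.op .add 14 14 5) <|
  .ite 19 (.seq (.op .sub 19 19 5) <| .ite 19 (.seq (.op .sub 19 19 5) <|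
    .ite 19 (.seq (.op .sub 19 19 5) <|
      .ite 19 (.seq (.load 36 14) <| .seq (.op .add 14 14 5) (.op .add 15 15 36))
        (.seq (.op .add 15 15 5) (.op .add 15 15 5)))
      (.op .add 14 14 5)) .skip) .skip

/-- Find the end of the input. -/
def scanLoop : Prog := .loop 15 scanBody

/-- Read the parameters. -/
def setup (q : ℕ) : Prog :=
  .seq (.const 5 1) <| .seq (.const 6 2) <| .seq (.const 4 (q - 1)) <| .seq (.load 1 0) <|
  .seq (.load 2 5) <| .seq (.load 3 6) <| .seq (.op .add 14 5 6) (.const 15 1)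

/-- Compute the modulus. -/
def modulus (q : ℕ) : Prog :=
  .seq (.op .add 12 14 0) <| .seq (.op .add 36 1 5) <| .seq (.const 37 q) <|
  .seq (.op .mul 36 36 37) <| .seq (.op .add 36 36 5) <| .seq (.op .mul 38 2 2) <|
  .seq (.op .mul 38 38 6) <| .seq (.op .add 38 38 12) <| .seq (.const 7 1) <|
  .loop 38 (.seq (.op .sub 38 38 5) (.op .mul 7 7 36))

/-- Compute the dimensions of the blocks. -/
def dimensions : Prog :=
  .seq (.const 8 1) <| .seq (.op .add 38 2 0) <|
  .seq (.loop 38 (.seq (.op .sub 38 38 5) (.op .mul 8 8 6))) <|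
  .seq (.op .mul 9 8 8) <| .seq (.op .add 10 3 5) <| .seq (.op .mul 10 10 9) (.op .add 11 10 9)

/-- Set up the first two blocks and the stack. -/
def start : Prog :=
  .seq (.op .mul 16 12 6) <| .seq (.op .add 16 16 12) <| .seq (.store 16 5) <|
  .seq (.op .add 17 16 0) <| .seq (.op .add 16 16 11) <| .seq (.op .add 18 16 0) <|
  .seq (.op .add 16 16 11) <| .seq (.op .add 14 5 6) (push 17 18)

/-- Read off the answer. -/
def answer : Prog :=
  .seq (.op .mul 36 12 6) <| .seq (.op .add 36 36 12) <| .seq (.op .add 36 36 11) <|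
  .seq (.op .sub 37 10 5) <| .seq (.op .add 36 36 37) <| .seq (.load 36 36) <|
  .ite 36 (.const 0 1) .skip

/-- The algorithm. -/
def algorithm (q : ℕ) : Prog :=
  .seq (setup q) <| .seq scanLoop <| .seq (modulus q) <| .seq dimensions <| .seq start <|
  .seq mainLoop answer

/-- The states of the scan, started in `s₀`: the next token and the number of subformulas yet to be
read are given. -/
structure SInv (s₀ s : State) (ptr pend : ℕ) : Prop where
  ptr : s.reg 14 = ptr
  pend : s.reg 15 = pend
  fr : ∀ r, r ≠ 14 → r ≠ 15 → r ≠ 19 → r ≠ 36 → s.reg r = s₀.reg r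
  mem : s.mem = s₀.mem

/-- The scan loop skips over the code of `e` subformulas. -/
def Scans (Y : ℕ) (w code : List ℕ) (e : ℕ) : Prop :=
  ∀ (s₀ s : State) (p : ℕ) (Q : State → ℕ → Prop) (pre post : List ℕ),
    s₀.reg 5 = 1 → (∀ a < w.length, s₀.mem a = w.getD a 0) →
    SInv s₀ s pre.length (e + p) → w = pre ++ code ++ post → p + code.length ≤ w.length →
    (∀ s' n, SInv s₀ s' (pre.length + code.length) p → n ≤ 16 * code.length →
      WP Y scanLoop s' fun s₂ n₂ => Q s₂ (n + n₂)) →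
    WP Y scanLoop s Q

theorem Scans.list {n : ℕ} {Y : ℕ} {w : List ℕ} (L : List (Formula n))
    (h : ∀ φ ∈ L, Scans Y w φ.encode 1) :
    Scans Y w (L.map Formula.encode).flatten L.length := by
  induction L with
  | nil =>
    intro s₀ s p Q pre post h5 hi hs hw hp hQ
    have := hQ s 0 (by simpa using hs) (by simp)
    simpa using this
  | cons φ L ih =>
    intro s₀ s p Q pre post h5 hi hs hw hp hQ
    have ih := ih fun ψ hψ => h ψ (List.mem_cons_of_mem _ hψ)
    have hlen := Formula.length_le_length_flatten L
    simp only [List.map_cons, List.flatten_cons, List.length_append, List.length_cons,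
      mul_add] at hw hp hQ hs ⊢
    refine h φ List.mem_cons_self s₀ s (L.length + p) Q pre
      ((L.map Formula.encode).flatten ++ post) h5 hi ?_ (by simpa using hw) (by omega) ?_
    · rw [show 1 + (L.length + p) = L.length + 1 + p by ring]; exact hs
    intro s₁ n₁ hs₁ hn₁
    refine ih s₀ s₁ p _ (pre ++ φ.encode) post h5 hi (by simpa using hs₁) (by simpa using hw)
      (by omega) ?_
    intro s₂ n₂ hs₂ hn₂
    have := hQ s₂ (n₁ + n₂) (by simpa [add_assoc] using hs₂) (by omega)
    simpa [add_assoc] using this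

/-- The input carries no length, and the cells behind it read as `0`, which is also a token. Its end
is found from the prefix code: the number of subformulas still to be read drops to zero exactly
there. -/
theorem scans_encode {n : ℕ} {Y : ℕ} {w : List ℕ} (hY : 3 * w.length < Y) (φ : Formula n) :
    Scans Y w φ.encode 1 := by
  induction φ with
  | one =>
    intro s₀ s p Q pre post h5 hi hs hw hp hQ
    simp only [Formula.encode, List.length_singleton, mul_one] at hw hp hQ
    have hl := congrArg List.length hw
    simp only [List.length_append, List.length_singleton] at hl
    have h5' := hs.fr 5 (by omega) (by omega) (by omega) (by omega)
    have ht : s.mem pre.length = 0 := by rw [hs.mem, hi _ (by omega), hw]; simp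
    refine WP.loop_step (by rw [hs.pend]; omega) fun _ => ?_
    simp only [scanBody, Prog.wp, State.setReg_reg, State.setReg_mem, Nat.reduceEqDiff, if_true,
      if_false, hs.ptr, hs.pend, h5', h5, ht]
    simp only [ne_eq, not_true_eq_false, false_implies, true_and, forall_true_left,
      Nat.add_sub_cancel_left]
    refine ⟨by omega, hQ _ _ ⟨by simp, by simp, fun r _ _ _ _ => ?_, hs.mem⟩ (by omega)⟩
    simp only [State.setReg_reg, *, if_false]
    exact hs.fr r ‹_› ‹_› ‹_› ‹_›
  | z =>
    intro s₀ s p Q pre post h5 hi hs hw hp hQ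
    simp only [Formula.encode, List.length_singleton, mul_one] at hw hp hQ
    have hl := congrArg List.length hw
    simp only [List.length_append, List.length_singleton] at hl
    have h5' := hs.fr 5 (by omega) (by omega) (by omega) (by omega)
    have ht : s.mem pre.length = 1 := by rw [hs.mem, hi _ (by omega), hw]; simp
    refine WP.loop_step (by rw [hs.pend]; omega) fun _ => ?_
    simp only [scanBody, Prog.wp, State.setReg_reg, State.setReg_mem, Nat.reduceEqDiff, if_true,
      if_false, hs.ptr, hs.pend, h5', h5, ht]
    simp only [ne_eq, one_ne_zero, not_false_eq_true, Nat.sub_self, not_true_eq_false,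
      false_implies, true_and, and_true, forall_true_left, Nat.add_sub_cancel_left]
    refine ⟨by omega, hQ _ _ ⟨by simp, by simp, fun r _ _ _ _ => ?_, hs.mem⟩ (by omega)⟩
    simp only [State.setReg_reg, *, if_false]
    exact hs.fr r ‹_› ‹_› ‹_› ‹_›
  | x i =>
    intro s₀ s p Q pre post h5 hi hs hw hp hQ
    simp only [Formula.encode, List.length_cons, List.length_nil] at hw hp hQ
    have hl := congrArg List.length hw
    simp only [List.length_append, List.length_cons, List.length_nil] at hl
    have h5' := hs.fr 5 (by omega) (by omega) (by omega) (by omega)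
    have ht : s.mem pre.length = 2 := by rw [hs.mem, hi _ (by omega), hw]; simp
    refine WP.loop_step (by rw [hs.pend]; omega) fun _ => ?_
    simp only [scanBody, Prog.wp, State.setReg_reg, State.setReg_mem, Nat.reduceEqDiff, if_true,
      if_false, hs.ptr, hs.pend, h5', h5, ht]
    simp only [ne_eq, Nat.reduceSub, OfNat.ofNat_ne_zero, one_ne_zero, not_false_eq_true,
      Nat.sub_self, not_true_eq_false, false_implies, true_and, and_true, forall_true_left,
      Nat.add_sub_cancel_left]
    refine ⟨by omega, by omega, hQ _ _ ⟨by simp, by simp, fun r _ _ _ _ => ?_, hs.mem⟩ (by omega)⟩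
    simp only [State.setReg_reg, *, if_false]
    exact hs.fr r ‹_› ‹_› ‹_› ‹_›
  | mul a b iha ihb =>
    intro s₀ s p Q pre post h5 hi hs hw hp hQ
    simp only [Formula.encode, List.length_cons, List.length_append, mul_add] at hw hp hQ
    have hl := congrArg List.length hw
    simp only [List.length_append, List.length_cons] at hl
    have hla := a.one_le_length_encode
    have hlb := b.one_le_length_encode
    have h5' := hs.fr 5 (by omega) (by omega) (by omega) (by omega)
    have ht : s.mem pre.length = 3 := by rw [hs.mem, hi _ (by omega), hw]; simp
    refine WP.loop_step (by rw [hs.pend]; omega) fun _ => ?_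
    simp only [scanBody, Prog.wp, State.setReg_reg, State.setReg_mem, Nat.reduceEqDiff, if_true,
      if_false, hs.ptr, hs.pend, h5', h5, ht]
    simp only [ne_eq, Nat.reduceSub, OfNat.ofNat_ne_zero, one_ne_zero, not_false_eq_true,
      Nat.sub_self, not_true_eq_false, false_implies, true_and, and_true, forall_true_left,
      Nat.add_sub_cancel_left]
    refine ⟨by omega, by omega, by omega, ?_⟩
    refine iha s₀ _ (p + 1) _ (pre ++ [3]) (b.encode ++ post) h5 hi ⟨by simp, ?_, ?_, hs.mem⟩
      (by simpa using hw) (by omega) ?_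
    · simp only [State.setReg_reg, if_true]; omega
    · intro r _ _ _ _
      simp only [State.setReg_reg, *, if_false]
      exact hs.fr r ‹_› ‹_› ‹_› ‹_›
    intro s₁ n₁ hs₁ hn₁
    refine ihb s₀ s₁ p _ (pre ++ [3] ++ a.encode) post h5 hi ?_ (by simpa using hw) (by omega) ?_
    · rw [List.length_append (bs := a.encode), add_comm 1 p]; exact hs₁
    intro s₂ n₂ hs₂ hn₂
    simp only [← add_assoc]
    refine hQ _ _ ?_ (by omega)
    convert hs₂ using 1
    simp only [List.length_append, List.length_singleton]
    omega
  | add m f ih =>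
    intro s₀ s p Q pre post h5 hi hs hw hp hQ
    have hlist := Scans.list (Y := Y) (w := w) (List.ofFn f) (by
      intro φ hφ
      obtain ⟨i, rfl⟩ := (List.mem_ofFn' _ _).1 hφ
      exact ih i)
    have hcode : ((List.ofFn f).map Formula.encode).flatten =
      (List.ofFn fun i => (f i).encode).flatten := by rw [List.map_ofFn]; rfl
    have hlen := Formula.length_le_length_flatten (List.ofFn f)
    rw [hcode, List.length_ofFn] at hlen
    rw [hcode, List.length_ofFn] at hlist
    simp only [Formula.encode, List.length_cons, mul_add] at hw hp hQ
    have hl := congrArg List.length hw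
    simp only [List.length_append, List.length_cons] at hl
    have h5' := hs.fr 5 (by omega) (by omega) (by omega) (by omega)
    have ht : s.mem pre.length = 4 := by rw [hs.mem, hi _ (by omega), hw]; simp
    have ht' : s.mem (pre.length + 1) = m := by rw [hs.mem, hi _ (by omega), hw]; simp
    refine WP.loop_step (by rw [hs.pend]; omega) fun _ => ?_
    simp only [scanBody, Prog.wp, State.setReg_reg, State.setReg_mem, Nat.reduceEqDiff, if_true,
      if_false, hs.ptr, hs.pend, h5', h5, ht, ht']
    simp only [ne_eq, Nat.reduceSub, OfNat.ofNat_ne_zero, one_ne_zero, not_false_eq_true,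
      false_implies, and_true, forall_true_left, Nat.add_sub_cancel_left]
    refine ⟨by omega, by omega, by omega, ?_⟩
    refine hlist s₀ _ p _ (pre ++ [4, m]) post h5 hi ⟨by simp, ?_, ?_, hs.mem⟩
      (by simpa using hw) (by omega) ?_
    · simp only [State.setReg_reg, if_true]; omega
    · intro r _ _ _ _
      simp only [State.setReg_reg, *, if_false]
      exact hs.fr r ‹_› ‹_› ‹_› ‹_›
    intro s₁ n₁ hs₁ hn₁
    simp only [← add_assoc]
    refine hQ _ _ ?_ (by omega)
    convert hs₁ using 1
    simp only [List.length_append, List.length_cons, List.length_nil]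
    omega

end RAM

/-! ### Correctness of the complete program -/

namespace Par
variable {P : Par}

/-- The registers after the parameters have been read and the end of the input has been found. -/
structure Read (P : Par) (s : State) : Prop where
  r0 : s.reg 0 = 0
  r1 : s.reg 1 = P.n
  r2 : s.reg 2 = P.k
  r3 : s.reg 3 = P.t
  r4 : s.reg 4 = P.q - 1
  r5 : s.reg 5 = 1
  r6 : s.reg 6 = 2
  mem : s.mem = fun a => P.w.getD a 0

theorem Read.congr {s s' : State} (h : P.Read s) (hr : ∀ r ≤ 6, s'.reg r = s.reg r)
    (hm : s'.mem = s.mem) : P.Read s' := by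
  constructor
  case mem => rw [hm, h.mem]
  all_goals rw [hr _ (by omega)]
  exacts [h.r0, h.r1, h.r2, h.r3, h.r4, h.r5, h.r6]

theorem B_le_M (hw : 4 ≤ P.w.length) : P.B ≤ P.M := Nat.le_self_pow (by omega) _

theorem M_lt_Y : P.M < P.Y := by
  have : 0 < P.M * P.B ^ P.k := Nat.mul_pos P.M_pos (Nat.pow_pos P.B_pos)
  unfold Y
  omega

theorem two_le_B (hq : 2 ≤ P.q) : 2 ≤ P.B := by unfold B; nlinarith

theorem exponent_lt_M (hq : 2 ≤ P.q) : P.w.length + 2 * (P.k * P.k) < P.M :=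
  Nat.lt_pow_self (P.two_le_B hq)

theorem setup_wp {Q : State → ℕ → Prop} {s : State} (hw : 4 ≤ P.w.length) (hq : 2 ≤ P.q)
    (hs : s = State.init P.w) (h0 : P.w.getD 0 0 = P.n) (h1 : P.w.getD 1 0 = P.k)
    (h2 : P.w.getD 2 0 = P.t)
    (hQ : ∀ s', P.Read s' → s'.reg 14 = 3 → s'.reg 15 = 1 → Q s' 8) :
    (setup P.q).wp P.Y s Q := by
  have hl := P.three_mul_lt_Y
  have hB : P.q ≤ P.B := by unfold B; nlinarith
  have := P.B_le_M hw
  have := P.M_lt_Y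
  subst hs
  simp only [setup, Prog.wp, State.setReg_reg, State.setReg_mem, Nat.reduceEqDiff, if_true,
    if_false]
  refine ⟨by omega, by omega, by omega, by omega, by omega, hQ _ ⟨?_, ?_, ?_, ?_, ?_, ?_, ?_, ?_⟩
    ?_ ?_⟩ <;> simp [State.init, ← h0, ← h1, ← h2]

theorem modulus_wp {Q : State → ℕ → Prop} {s : State} (hw : 4 ≤ P.w.length) (hq : 2 ≤ P.q)
    (h : P.Read s) (h14 : s.reg 14 = P.w.length) (h15 : s.reg 15 = 0)
    (hQ : ∀ s' n, P.Read s' → s'.reg 12 = P.w.length → s'.reg 15 = 0 → s'.reg 7 = P.M →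
      n ≤ 3 * (P.w.length + 2 * (P.k * P.k)) + 10 → Q s' n) : (modulus P.q).wp P.Y s Q := by
  have hl := P.three_mul_lt_Y
  have hB : (P.n + 1) * P.q + 1 = P.B := rfl
  have hn : P.n + 1 ≤ (P.n + 1) * P.q := Nat.le_mul_of_pos_right _ (by omega)
  have hq' : P.q ≤ (P.n + 1) * P.q := Nat.le_mul_of_pos_left _ (by omega)
  have hBM := P.B_le_M hw
  have hMY := P.M_lt_Y
  have he := P.exponent_lt_M hq
  have e : P.k * P.k * 2 + P.w.length = P.w.length + 2 * (P.k * P.k) := by ring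
  simp only [modulus, Prog.wp, State.setReg_reg, h.r0, h.r1, h.r2, h.r5, h.r6, h14,
    Nat.reduceEqDiff, if_true, if_false, add_zero, e, hB]
  refine ⟨by omega, by omega, by omega, by omega, by omega, by omega, by omega, by omega, by omega,
    ?_⟩
  generalize hE : P.w.length + 2 * (P.k * P.k) = E at *
  have hM : P.M = P.B ^ E := by rw [M, hE]
  refine WP.countdown (fun l s' => s'.reg 38 = l ∧ l ≤ E ∧ P.Read s' ∧ s'.reg 12 = P.w.length ∧
    s'.reg 15 = 0 ∧ s'.reg 36 = P.B ∧ s'.reg 7 = P.B ^ (E - l)) 2 E (fun _ _ h => h.1) ?_ ?_ ?_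
  · rintro l s₁ hl ⟨k38, hle, hr, k12, k15, k36, k7⟩ hb
    have hp : P.B ^ (E - (l + 1)) * P.B = P.B ^ (E - l) := by
      rw [← pow_succ]; congr 1; omega
    have hp' : P.B ^ (E - l) ≤ P.M := hM ▸ Nat.pow_le_pow_right P.B_pos (by omega)
    simp only [Prog.wp, State.setReg_reg, hr.r5, k38, k36, k7, Nat.reduceEqDiff, if_false,
      Nat.add_sub_cancel, hp]
    refine ⟨by omega, ⟨by simp, by omega, hr.congr (fun r hr => ?_) rfl, by simp [k12],
      by simp [k15], by simp, by simp⟩, le_rfl⟩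
    simp only [State.setReg_reg]
    split_ifs <;> omega
  · refine ⟨by simp, le_rfl, h.congr (fun r hr => ?_) rfl, by simp, by simp [h15], by simp,
      by simp⟩
    simp only [State.setReg_reg]
    split_ifs <;> omega
  · rintro s₁ n ⟨-, -, hr, k12, k15, -, k7⟩ hn
    exact hQ _ _ hr k12 k15 (by rw [k7, hM]; rfl) (by omega)

theorem dimensions_wp {Q : State → ℕ → Prop} {s : State} (h : P.Read s) (hk : P.k < P.Y)
    (h12 : s.reg 12 = P.w.length) (h15 : s.reg 15 = 0) (h7 : s.reg 7 = P.M)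
    (hQ : ∀ s' n, P.Glob s' → s'.mem = s.mem → s'.reg 15 = 0 →
      n ≤ 3 * P.k + 10 → Q s' n) : dimensions.wp P.Y s Q := by
  have h1 := P.one_lt_Y
  have hBL := P.BL_lt_Y
  have h4 : 2 ^ P.k * 2 ^ P.k = 4 ^ P.k := by rw [← mul_pow]; rfl
  have h4B : 4 ^ P.k ≤ P.BL := Nat.le_mul_of_pos_left _ (by omega)
  have h2 : 2 ^ P.k ≤ 4 ^ P.k := Nat.pow_le_pow_left (by omega) _
  have htB : P.t + 2 ≤ P.BL := Nat.le_mul_of_pos_right _ (by positivity)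
  have hS : (P.t + 1) * 4 ^ P.k = P.S := rfl
  have hSB := P.four_pow_add_S
  simp only [dimensions, Prog.wp, State.setReg_reg, h.r0, h.r2, Nat.reduceEqDiff,
    if_false, add_zero]
  refine ⟨h1, hk, ?_⟩
  refine WP.countdown (fun l s' => s'.reg 38 = l ∧ l ≤ P.k ∧ P.Read s' ∧ s'.mem = s.mem ∧
    s'.reg 12 = P.w.length ∧ s'.reg 15 = 0 ∧ s'.reg 7 = P.M ∧ s'.reg 8 = 2 ^ (P.k - l)) 2 P.k
    (fun _ _ h => h.1) ?_ ?_ ?_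
  · rintro l s₁ hl ⟨k38, hle, hr, hm, k12, k15, k7, k8⟩ hb
    have hp : 2 ^ (P.k - (l + 1)) * 2 = 2 ^ (P.k - l) := by
      rw [← pow_succ]; congr 1; omega
    have hp' : 2 ^ (P.k - l) ≤ 2 ^ P.k := Nat.pow_le_pow_right (by omega) (by omega)
    simp only [Prog.wp, State.setReg_reg, hr.r5, hr.r6, k38, k8, Nat.reduceEqDiff, if_false,
      Nat.add_sub_cancel, hp]
    refine ⟨by omega, ⟨by simp, by omega, hr.congr (fun r hr => ?_) rfl, hm, by simp [k12],
      by simp [k15], by simp [k7], by simp⟩, le_rfl⟩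
    simp only [State.setReg_reg]
    split_ifs <;> omega
  · refine ⟨by simp, le_rfl, h.congr (fun r hr => ?_) rfl, rfl, by simp [h12], by simp [h15],
      by simp [h7], by simp⟩
    simp only [State.setReg_reg]
    split_ifs <;> omega
  · rintro s₁ n ⟨-, -, hr, hm, k12, k15, k7, k8⟩ hn
    rw [Nat.sub_zero] at k8
    simp only [hr.r3, hr.r5, k8, if_true, h4, hS, hSB]
    refine ⟨by omega, by omega, ?_, hBL, hQ _ _ ⟨?_, ?_, ?_, ?_, ?_, ?_, ?_, ?_, ?_, ?_, ?_⟩ hm ?_ ?_⟩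
    · have := P.S_le_BL; omega
    all_goals simp [hr.r0, hr.r2, hr.r4, hr.r5, hr.r6, k12, k15, k7, k8]
    omega

theorem start_wp {Q : State → ℕ → Prop} {s : State} (hw : 4 ≤ P.w.length) (hM : 1 < P.M)
    (hg : P.Glob s) (hm : s.mem = fun a => P.w.getD a 0) (h15 : s.reg 15 = 0)
    (hQ : ∀ s', P.MInv s' 3 [(0, 1)] 2 (Pi.single 0 (Pi.single 0 1)) → Q s' 14) :
    start.wp P.Y s Q := by
  have h1 := P.one_lt_Y
  have hl := P.three_mul_lt_Y
  have ha0 : P.w.length * 2 + P.w.length = P.addr 0 := by unfold addr NB; ring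
  have ha1 := P.addr_succ 0
  have ha2 := P.addr_succ 1
  have hl1 := P.addr_lt_Y (i := 1) (by unfold NMax; omega)
  have hl2 := P.addr_lt_Y (i := 2) (by unfold NMax; omega)
  simp only [zero_add, Nat.reduceAdd] at ha1 ha2
  simp only [start, Prog.wp, State.setReg_reg, State.setMem_reg, hg.r0, hg.r5, hg.r6, hg.r11,
    hg.r12, Nat.reduceEqDiff, if_true, if_false, add_zero, ha0, ← ha1, ← ha2]
  refine ⟨by omega, by omega, by omega, by omega, by omega, by omega, by omega, ?_⟩
  -- Node `0` holds the unit, node `1` is zero and will receive the result; the whole formula is the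
  -- single pending edge between them. Reading starts at `3`, behind `n`, `k`, `t`.
  refine push_wp (ptr := 3) (u := 0) (v := 1) (N := 2) (σ := []) (vec := Pi.single 0 (Pi.single 0 1))
    ⟨hg.congr fun r hr => ?_, by simp, by simp [h15], by simp, trivial, ?_, ?_, ?_⟩ (by simp; omega)
    (by omega) (by omega) (by simp) (by simp) fun s' h _ => hQ s' h
  · simp only [State.setReg_reg, State.setMem_reg]
    split_ifs <;> omega
  · intro a ha
    simp only [State.setReg_mem, State.setMem_mem]
    rw [if_neg (by omega), hm]
  · intro a ha
    simp only [State.setReg_mem, State.setMem_mem]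
    obtain ⟨i, y, hy, rfl⟩ := P.exists_addr ha
    rw [P.flat_addr _ _ hy, hm]
    by_cases h : i = 0 ∧ y = 0
    · obtain ⟨rfl, rfl⟩ := h
      simpa using hM
    · have hne : P.addr i + y ≠ P.addr 0 := fun h' => h (P.addr_add_inj hy P.BL_pos h')
      have h0 : P.w.getD (P.addr i + y) 0 = 0 := by
        unfold NB at ha
        rw [List.getD_eq_default]
        omega
      simp only [if_neg hne, h0]
      refine ⟨by omega, ?_⟩
      by_cases hi : i = 0
      · subst hi
        rw [Pi.single_eq_same, Pi.single_eq_of_ne (by simpa using h), Nat.cast_zero]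
      · rw [Pi.single_eq_of_ne hi, Nat.cast_zero]; rfl
  · intro i hi
    exact Pi.single_eq_of_ne (by omega) _

theorem answer_wp {Q : State → ℕ → Prop} {s : State} {ptr N : ℕ} {vec : ℕ → ℕ → ZMod P.M}
    (h : P.MInv s ptr [] N vec)
    (hQ : ∀ s' n, (vec 1 (P.S - 1) = 0 → s'.reg 0 = 0) → (vec 1 (P.S - 1) ≠ 0 → s'.reg 0 = 1) →
      n ≤ 8 → Q s' n) : answer.wp P.Y s Q := by
  have h1 := P.one_lt_Y
  have hl := P.three_mul_lt_Y
  have hNM : 1 ≤ P.NMax := by unfold NMax; omega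
  have ha0 : P.w.length * 2 + P.w.length = P.addr 0 := by unfold addr NB; ring
  have ha1 := P.addr_succ 0
  have hl1 := P.addr_lt_Y hNM
  have hSB : P.S - 1 < P.BL := by have := P.S_le_BL; have := P.BL_pos; omega
  have hl2 := P.addr_add_lt hNM hSB.le
  obtain ⟨c1, c2⟩ := h.cells (P.addr 1 + (P.S - 1)) ((P.NB_le_addr 1).trans (Nat.le_add_right _ _))
  rw [P.flat_addr _ _ hSB] at c2
  -- Cells hold reduced residues, so a cell is literally `0` iff its residue is.
  have hz : s.mem (P.addr 1 + (P.S - 1)) = 0 ↔ vec 1 (P.S - 1) = 0 := by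
    rw [← c2, ZMod.natCast_eq_zero_iff]
    exact ⟨fun h => h ▸ dvd_zero _, fun h => Nat.eq_zero_of_dvd_of_lt h c1⟩
  simp only [zero_add] at ha1
  simp only [answer, Prog.wp, State.setReg_reg, State.setReg_mem, h.glob.r5, h.glob.r6,
    h.glob.r10, h.glob.r11, h.glob.r12, Nat.reduceEqDiff, if_true, if_false, ha0, ← ha1]
  refine ⟨by omega, by omega, hl1, hl2, fun h' => ⟨h1, hQ _ _ (fun h0 => ?_) (fun _ => by simp)
    le_rfl⟩, fun h' => hQ _ _ (fun _ => by simp [h.glob.r0]) (fun h0 => ?_) le_rfl⟩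
  · exact absurd (hz.2 h0) h'
  · exact absurd (hz.1 h') h0

/-- A bound on the number of steps of the algorithm. -/
def steps (P : Par) : ℕ :=
  16 * P.w.length + 3 * (P.w.length + 2 * (P.k * P.k)) + 3 * P.k + (P.KC + 8) * P.w.length + 60

theorem algorithm_wp {n k t q : ℕ} (hq : 2 ≤ q) (φ : Formula n)
    (hP : P = ⟨n, k, t, q, inputWord k t φ⟩)
    {s : State} (hs : s = State.init P.w) :
    (algorithm q).wp P.Y s fun s' N => (HasMarkedQMonomial q k t φ.poly → s'.reg 0 = 1) ∧
      (¬ HasMarkedQMonomial q k t φ.poly → s'.reg 0 = 0) ∧ N ≤ P.steps := by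
  have hPn : P.n = n := by rw [hP]
  have hPk : P.k = k := by rw [hP]
  have hPt : P.t = t := by rw [hP]
  have hPq : P.q = q := by rw [hP]
  have hPw : P.w = [n, k, t] ++ φ.encode ++ [] := by rw [hP]; simp [inputWord]
  have hlen : P.w.length = 3 + φ.encode.length := by rw [hPw]; simp; omega
  have hφ := φ.one_le_length_encode
  have hw : 4 ≤ P.w.length := by omega
  have hq' : 2 ≤ P.q := by omega
  have hlY := P.three_mul_lt_Y
  have hB2 := P.two_le_B hq'
  have hBM := P.B_le_M hw
  have hMY := P.M_lt_Y
  clear hP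
  subst hPq
  simp only [algorithm, Prog.wp]
  refine setup_wp hw hq' hs (by simp [hPw, hPn]) (by simp [hPw, hPk]) (by simp [hPw, hPt]) ?_
  intro s₁ hr₁ k14 k15
  refine scans_encode hlY φ s₁ s₁ 0 _ [n, k, t] [] hr₁.r5 (fun a _ => by rw [hr₁.mem])
    ⟨k14, k15, fun _ _ _ _ _ => rfl, rfl⟩ hPw (by omega) ?_
  intro s₂ n₂ hs₂ hn₂
  refine WP.loop_done hs₂.pend ?_
  refine modulus_wp hw hq' (hr₁.congr (fun r hr => hs₂.fr r (by omega) (by omega) (by omega)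
    (by omega)) hs₂.mem) (by rw [hs₂.ptr, hlen]; rfl) hs₂.pend ?_
  intro s₃ n₃ hr₃ k12 k15 k7 hn₃
  have hkk : P.k ≤ P.k * P.k := Nat.le_mul_self _
  have hexp := P.exponent_lt_M hq'
  refine dimensions_wp hr₃ (by omega) k12 k15 k7 ?_
  intro s₄ n₄ hg₄ hm₄ k15 hn₄
  refine start_wp hw (by omega) hg₄ (by rw [hm₄, hr₃.mem]) k15 ?_
  intro s₅ hm₅
  have hqℓ : P.q * φ.encode.length ≤ P.q * P.w.length := Nat.mul_le_mul_left _ (by omega)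
  refine processes_encode hq' hPn.symm (by omega) φ s₅ 0 1 [] 2 _ _ [n, k, t] [] hm₅ hPw (by omega)
    (by omega) (by omega) (by simp; omega) (by unfold NMax; omega) ?_
  intro s₆ N₆ vec₆ n₆ hm₆ _ _ hv₆ _ hn₆
  refine WP.loop_done hm₆.dep ?_
  refine answer_wp hm₆ ?_
  intro s₇ n₇ hz hnz hn₇
  -- Degree `t` with both subsets full is the largest index among the source cells.
  have hcell : P.S - 1 = cell k t (Finset.range k) (Finset.range k) := by
    have hmask : ∀ k, mask (Finset.range k) + 1 = 2 ^ k := fun k => by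
      induction k with
      | zero => simp [mask]
      | succ k ih => rw [mask, Finset.sum_range_succ, ← mask, pow_succ]; omega
    have h1 : cell k t (Finset.range k) (Finset.range k) + 1 = P.S := by
      have h2 := hmask k
      unfold cell S
      rw [hPt, hPk, add_right_comm, h2, show (4 : ℕ) = 2 * 2 from rfl, mul_pow, ← h2]
      ring
    omega
  have hval : vec₆ 1 (P.S - 1) = 0 ↔ ¬ HasMarkedQMonomial P.q k t φ.poly := by
    rw [hv₆, hcell, ← Formula.act_apply_eq_zero_iff (M := P.M) (B := P.B) hq φ, hPk, hPt]
    · simp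
    · unfold B
      rw [hPn]
      exact (Nat.mul_le_mul (by omega) (by omega)).trans (Nat.le_succ _)
    · unfold B; nlinarith
    -- The exponent of `M` uses the whole input word, three entries longer than the description of
    -- the formula; this makes the inequality strict.
    · rw [M, hlen, hPk]
      exact Nat.pow_lt_pow_right (by omega) (by omega)
  refine ⟨fun h => hnz fun h0 => hval.1 h0 h, fun h => hz (hval.2 h), ?_⟩
  unfold steps
  have : (P.KC + 8) * φ.encode.length ≤ (P.KC + 8) * P.w.length :=
    Nat.mul_le_mul_left _ (by omega)
  omega

end Par

/-! ### Input length, number size and running time -/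

theorem Formula.le_of_mem_encode {n : ℕ} (φ : Formula n) :
    ∀ a ∈ φ.encode, a ≤ n + φ.encode.length + 4 := by
  induction φ with
  | one => simp [encode]
  | z => simp [encode]
  | x i =>
    have := i.2
    simp [encode]
    omega
  | mul a b iha ihb =>
    intro c hc
    simp only [encode, List.mem_cons, List.mem_append, List.length_cons, List.length_append] at hc ⊢
    rcases hc with rfl | hc | hc
    · omega
    · have := iha c hc; omega
    · have := ihb c hc; omega
  | add m f ih =>
    intro c hc
    have hm := Formula.length_le_length_flatten (List.ofFn f)
    have hcode : ((List.ofFn f).map Formula.encode).flatten =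
      (List.ofFn fun i => (f i).encode).flatten := by rw [List.map_ofFn]; rfl
    rw [hcode, List.length_ofFn] at hm
    simp only [encode, List.mem_cons, List.length_cons, List.mem_flatten] at hc ⊢
    rcases hc with rfl | rfl | ⟨l, hl, hc⟩
    · omega
    · omega
    · obtain ⟨i, rfl⟩ := (List.mem_ofFn' _ _).1 hl
      have h1 := ih i c hc
      have h2 := (List.sublist_flatten_of_mem hl).length_le
      dsimp only at h2
      omega

/-- Terminals are charged to the gate they enter. A simple `+` gate has at most `n + 2` terminal
inputs of two symbols each, plus two symbols of its own, which gives `2 * n + 6`; without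
simplicity, size would not bound the length. -/
theorem Formula.length_encode_le {n : ℕ} (φ : Formula n) (h : φ.IsSimple) :
    φ.encode.length ≤ (2 * n + 6) * φ.size + if φ.size = 0 then 2 else 0 := by
  induction φ with
  | one => simp [encode, size]
  | z => simp [encode, size]
  | x i => simp [encode, size]
  | mul a b iha ihb =>
    have ha := iha h.1
    have hb := ihb h.2
    have hl : (encode (mul a b)).length = a.encode.length + b.encode.length + 1 := by simp [encode]
    have h1 : (if a.size = 0 then 2 else 0) ≤ 2 := by split_ifs <;> omega
    have h2 : (if b.size = 0 then 2 else 0) ≤ 2 := by split_ifs <;> omega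
    rw [hl, size, if_neg (by omega)]
    nlinarith
  | add m f ih =>
    have hl : (encode (add m f)).length = ∑ i, (f i).encode.length + 2 := by
      rw [encode, List.length_cons, List.length_cons, List.length_flatten, List.map_ofFn,
        List.sum_ofFn]; rfl
    have hsum : ∑ i, (f i).encode.length ≤
        ∑ i, ((2 * n + 6) * (f i).size + if (f i).size = 0 then 2 else 0) :=
      Finset.sum_le_sum fun i _ => ih i (h.1 i)
    rw [Finset.sum_add_distrib, ← Finset.mul_sum, ← Finset.sum_filter, Finset.sum_const,
      smul_eq_mul] at hsum
    have hcard : (Finset.univ.filter fun i => (f i).size = 0).card ≤ n + 2 := by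
      -- This is injective on terminals, of which there are `n + 2`; the values on gates are
      -- irrelevant.
      let g : Formula n → Option (Option (Fin n)) := fun
        | one => none
        | z => some none
        | x i => some (some i)
        | mul _ _ => none
        | add _ _ => none
      have hg : ∀ a b : Formula n, a.size = 0 → b.size = 0 → g a = g b → a = b := by
        intro a b ha hb hab
        cases a <;> cases b <;> simp_all [g, size]
      have := Finset.card_le_card_of_injOn (s := Finset.univ.filter fun i => (f i).size = 0)
        (t := Finset.univ) (fun i => g (f i)) (fun _ _ => Finset.mem_coe.2 (Finset.mem_univ _)) (by
          intro i hi j hj hij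
          simp only [Finset.coe_filter, Finset.mem_univ, true_and, Set.mem_ofPred_eq] at hi hj
          exact h.2 i j hi (hg _ _ hi hj hij))
      simpa using this
    rw [hl, size, if_neg (by omega)]
    rw [mul_add]
    omega

theorem Par.init_bd {n k t q : ℕ} (hq : 2 ≤ q) (φ : Formula n) {P : Par}
    (hP : P = ⟨n, k, t, q, inputWord k t φ⟩) : (State.init P.w).Bd P.Y := by
  have hPn : P.n = n := by rw [hP]
  have hPk : P.k = k := by rw [hP]
  have hPt : P.t = t := by rw [hP]
  have hPq : P.q = q := by rw [hP]
  have hPw : P.w = n :: k :: t :: φ.encode := by rw [hP]; rfl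
  clear hP
  have hlen : P.w.length = φ.encode.length + 3 := by rw [hPw]; simp
  have hφ := φ.one_le_length_encode
  have h1 := P.one_lt_Y
  have hBL := P.BL_lt_Y
  have hBM := P.B_le_M (by omega)
  have hMY := P.M_lt_Y
  have htB : P.t + 2 ≤ P.BL := Nat.le_mul_of_pos_right _ (by positivity)
  have hkk : P.k ≤ P.k * P.k := Nat.le_mul_self _
  have hexp := P.exponent_lt_M (by omega)
  have hnB : P.n < P.B := by unfold B; nlinarith
  have hY : P.M + P.NB ≤ P.Y := by
    have := P.NB_le_addr (P.NMax + 1)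
    unfold Y
    omega
  refine ⟨fun r => by simp [State.init]; omega, fun a => ?_⟩
  have key : ∀ x ∈ P.w, x < P.Y := by
    intro x hx
    rw [hPw] at hx
    simp only [List.mem_cons] at hx
    rcases hx with rfl | rfl | rfl | hx
    · omega
    · omega
    · omega
    · have := φ.le_of_mem_encode x hx
      unfold NB at hY
      omega
  simp only [State.init]
  by_cases ha : a < P.w.length
  · rw [List.getD_eq_getElem _ _ ha]
    exact key _ (List.getElem_mem _)
  · rw [List.getD_eq_default _ _ (by omega)]
    omega

theorem sq_le_two_pow_succ (m : ℕ) : m ^ 2 ≤ 2 ^ (m + 1) := by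
  induction m with
  | zero => norm_num
  | succ m ih =>
    rcases Nat.lt_or_ge m 3 with h | h
    · interval_cases m <;> norm_num
    · rw [pow_succ 2 (m + 1)]
      nlinarith

/-- This absorbs the squared logarithm from the cost of arithmetic into the second factor `t` of the
time bound. -/
theorem size_sq_le (t : ℕ) : Nat.size (t + 2) ^ 2 ≤ 12 * max t 1 := by
  obtain ⟨m, hm⟩ : ∃ m, Nat.size (t + 2) = m + 1 :=
    Nat.exists_eq_succ_of_ne_zero (Nat.size_pos.2 (by omega)).ne'
  have h1 : 2 ^ m ≤ t + 2 := by
    rw [← Nat.lt_size, hm]; omega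
  have h2 := sq_le_two_pow_succ (m + 1)
  have h3 : 2 ^ (m + 1 + 1) = 4 * 2 ^ m := by ring
  rw [hm]
  omega

namespace Par
variable {P : Par}

/-- Powers of `B` are estimated crudely by `B ≤ 2 ^ B`, which costs only a factor polynomial in `n`.
The addresses contribute the logarithm of `t`. -/
theorem len_Y_le {s : ℕ} (hs : 1 ≤ s) (hL : P.w.length ≤ 9 * (P.n + P.k + 1) * s) :
    len P.Y ≤ (21 * P.q + 60) * ((P.n + P.k + 1) ^ 3 * s * Nat.size (P.t + 2)) := by
  have hτ : 1 ≤ Nat.size (P.t + 2) := Nat.size_pos.2 (by omega)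
  set τ := Nat.size (P.t + 2) with hτd
  set A := P.n + P.k + 1 with hA
  set L := P.w.length with hLd
  have hA1 : 1 ≤ A := by omega
  have h1 : P.M * P.B ^ P.k + P.M ≤ 2 ^ (P.B * (L + 2 * (P.k * P.k) + P.k) + 1) := by
    have e : P.M * P.B ^ P.k = P.B ^ (L + 2 * (P.k * P.k) + P.k) := by rw [M, ← pow_add]
    have h2 : P.M ≤ P.M * P.B ^ P.k := Nat.le_mul_of_pos_right _ (Nat.pow_pos P.B_pos)
    have h3 : P.B ^ (L + 2 * (P.k * P.k) + P.k) ≤ 2 ^ (P.B * (L + 2 * (P.k * P.k) + P.k)) := by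
      rw [pow_mul]
      exact Nat.pow_le_pow_left Nat.lt_two_pow_self.le _
    rw [pow_succ]
    omega
  have h2 : P.addr (P.NMax + 1) ≤ 2 ^ ((3 + P.q) * L + 3 + τ + 2 * P.k) := by
    have e : P.addr (P.NMax + 1) = 3 * L + (P.q * L + 3) * ((P.t + 2) * 4 ^ P.k) := rfl
    have h3 : 1 ≤ (P.t + 2) * 4 ^ P.k := Nat.mul_pos (by omega) (by positivity)
    have h4 : P.addr (P.NMax + 1) ≤ ((3 + P.q) * L + 3) * ((P.t + 2) * 4 ^ P.k) := by
      rw [e]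
      nlinarith [Nat.mul_le_mul_left (3 * L) h3]
    have h5 : P.t + 2 ≤ 2 ^ τ := (Nat.lt_size_self _).le
    refine h4.trans ?_
    rw [pow_add, pow_add, mul_assoc, pow_mul]
    exact Nat.mul_le_mul Nat.lt_two_pow_self.le (Nat.mul_le_mul_right _ h5)
  have hlen : len P.Y ≤ P.B * (L + 2 * (P.k * P.k) + P.k) + 1 +
      ((3 + P.q) * L + 3 + τ + 2 * P.k) + 3 := by
    generalize P.B * (L + 2 * (P.k * P.k) + P.k) + 1 = a at *
    generalize (3 + P.q) * L + 3 + τ + 2 * P.k = b at *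
    have : P.Y < 2 ^ (a + b + 1 + 1) := by
      unfold Y
      have h3 : 2 ^ a ≤ 2 ^ (a + b) := Nat.pow_le_pow_right (by omega) (by omega)
      have h4 : 2 ^ b ≤ 2 ^ (a + b) := Nat.pow_le_pow_right (by omega) (by omega)
      have h5 : 2 ^ (a + b + 1 + 1) = 4 * 2 ^ (a + b) := by ring
      have h6 : 0 < 2 ^ (a + b) := by positivity
      omega
    have := Nat.size_le.2 this
    unfold len
    omega
  have hB : P.B ≤ (P.q + 1) * A := by
    unfold B
    nlinarith
  refine hlen.trans ?_
  have hX : ∀ x, x ≤ A ^ 3 * s → x ≤ A ^ 3 * s * τ := fun x hx => hx.trans (Nat.le_mul_of_pos_right _ hτ)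
  have hA3 : A ≤ A ^ 3 := Nat.le_self_pow (by omega) _
  have hAs : A * s ≤ A ^ 3 * s := Nat.mul_le_mul_right _ hA3
  have hA3s : A ^ 3 ≤ A ^ 3 * s := Nat.le_mul_of_pos_right _ hs
  have f1 := hX _ hAs
  have f2 : P.k ≤ A ^ 3 * s * τ := hX _ (by omega)
  have f3 : 1 ≤ A ^ 3 * s * τ := hX _ (by omega)
  have f4 : τ ≤ A ^ 3 * s * τ := Nat.le_mul_of_pos_left _ (by omega)
  have f5 : P.B * (L + 2 * (P.k * P.k) + P.k) ≤ 12 * (P.q + 1) * (A ^ 3 * s * τ) := by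
    have g1 : L + 2 * (P.k * P.k) + P.k ≤ 12 * (A ^ 2 * s) := by
      have : P.k * P.k ≤ A ^ 2 := by rw [pow_two]; exact Nat.mul_le_mul (by omega) (by omega)
      have e1 : A ^ 2 ≤ A ^ 2 * s := Nat.le_mul_of_pos_right _ hs
      have e2 : A ≤ A ^ 2 := Nat.le_self_pow (by omega) _
      have e3 : A * s ≤ A ^ 2 * s := Nat.mul_le_mul_right _ e2
      rw [mul_assoc] at hL
      omega
    calc _ ≤ (P.q + 1) * A * (12 * (A ^ 2 * s)) := Nat.mul_le_mul hB g1
      _ = 12 * (P.q + 1) * (A ^ 3 * s) := by ring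
      _ ≤ _ := Nat.mul_le_mul_left _ (hX _ le_rfl)
  have f6 : (3 + P.q) * L ≤ (3 + P.q) * (9 * (A ^ 3 * s * τ)) := by
    refine Nat.mul_le_mul_left _ ?_
    rw [mul_assoc] at hL
    omega
  generalize A ^ 3 * s * τ = X at *
  nlinarith

theorem steps_le {s : ℕ} (hs : 1 ≤ s) (hL : P.w.length ≤ 9 * (P.n + P.k + 1) * s) :
    P.steps ≤ (1197 * P.q + 780) *
      ((P.n + P.k + 1) ^ 2 * s * max P.t 1 * 4 ^ P.k) := by
  set A := P.n + P.k + 1 with hA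
  set L := P.w.length with hLd
  set u := max P.t 1 with hu
  have hu1 : 1 ≤ u := le_max_right _ _
  have hA1 : 1 ≤ A := by omega
  have hK : 1 ≤ 4 ^ P.k := Nat.one_le_pow _ _ (by omega)
  have hV : 1 ≤ u * 4 ^ P.k := Nat.mul_pos hu1 hK
  have hZ : (A ^ 2 * s * u * 4 ^ P.k) = A ^ 2 * s * (u * 4 ^ P.k) := by ring
  rw [hZ]
  have hS : P.S ≤ 2 * (u * 4 ^ P.k) := by
    rw [S, ← mul_assoc]
    exact Nat.mul_le_mul_right _ (by omega)
  have hEC : P.EC ≤ 60 * (A * (u * 4 ^ P.k)) := by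
    have h1 : P.S * (20 * (P.k + 1) + 9) ≤ 2 * (u * 4 ^ P.k) * (29 * A) :=
      Nat.mul_le_mul hS (by omega)
    have h2 : 1 ≤ A * (u * 4 ^ P.k) := Nat.mul_pos hA1 hV
    have h3 : 2 * (u * 4 ^ P.k) * (29 * A) = 58 * (A * (u * 4 ^ P.k)) := by ring
    unfold EC
    omega
  have hKC : P.KC + 8 ≤ (48 + 133 * P.q) * (A * (u * 4 ^ P.k)) := by
    have h2 : 1 ≤ A * (u * 4 ^ P.k) := Nat.mul_pos hA1 hV
    unfold KC
    generalize A * (u * 4 ^ P.k) = X at *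
    have : P.q * (2 * P.EC + 13) ≤ P.q * (133 * X) := Nat.mul_le_mul_left _ (by omega)
    nlinarith
  have f1 : (P.KC + 8) * L ≤ 9 * (48 + 133 * P.q) * (A ^ 2 * s * (u * 4 ^ P.k)) := by
    calc _ ≤ (48 + 133 * P.q) * (A * (u * 4 ^ P.k)) * (9 * A * s) := Nat.mul_le_mul hKC hL
      _ = _ := by ring
  have f2 : 16 * L + 3 * (L + 2 * (P.k * P.k)) + 3 * P.k + 60 ≤ 240 * (A ^ 2 * s * (u * 4 ^ P.k)) := by
    have e0 : P.k * P.k ≤ A ^ 2 := by rw [pow_two]; exact Nat.mul_le_mul (by omega) (by omega)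
    have e1 : A ^ 2 ≤ A ^ 2 * s := Nat.le_mul_of_pos_right _ hs
    have e2 : A ≤ A ^ 2 := Nat.le_self_pow (by omega) _
    have e3 : A * s ≤ A ^ 2 * s := Nat.mul_le_mul_right _ e2
    have e4 : A ^ 2 * s ≤ A ^ 2 * s * (u * 4 ^ P.k) := Nat.le_mul_of_pos_right _ hV
    rw [mul_assoc] at hL
    omega
  unfold steps
  generalize A ^ 2 * s * (u * 4 ^ P.k) = Z at *
  nlinarith

end Par

theorem corollary1 (q : ℕ) (hq : 2 ≤ q) :
    ∃ (P : RAM.Prog) (C c : ℕ), ∀ (n k t : ℕ) (φ : Formula n), φ.IsSimple →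
      ∃ (s' : RAM.State) (T : ℕ),
        RAM.Exec P (RAM.State.init (inputWord k t φ)) s' T ∧
        (HasMarkedQMonomial q k t φ.poly → s'.reg 0 = 1) ∧
        (¬ HasMarkedQMonomial q k t φ.poly → s'.reg 0 = 0) ∧
        (T : ℝ) ≤ C * ((n : ℝ) + k + 1) ^ c *
          ((max t 1 : ℕ) : ℝ) ^ 2 * (5.44 : ℝ) ^ k * ((max φ.size 1 : ℕ) : ℝ) ^ 4 := by
  -- The constant is the product of those in `size_sq_le`, `len_Y_le` (squared) and `steps_le`; the
  -- exponent is `8 = 2 + 2 * 3`.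
  refine ⟨algorithm q, 12 * (21 * q + 60) ^ 2 * (1197 * q + 780), 8, fun n k t φ hφ => ?_⟩
  obtain ⟨P, hP⟩ : ∃ P : Par, P = ⟨n, k, t, q, inputWord k t φ⟩ := ⟨_, rfl⟩
  obtain ⟨s', N, T, hT, hTN, -, h1, h0, hN⟩ :=
    Prog.wp_sound (P.algorithm_wp hq φ hP rfl) (P.init_bd hq φ hP)
  have hw : P.w = inputWord k t φ := by rw [hP]
  refine ⟨s', T, hw ▸ hT, h1, h0, ?_⟩
  have hs : 1 ≤ max φ.size 1 := le_max_right _ _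
  have hL : P.w.length ≤ 9 * (P.n + P.k + 1) * max φ.size 1 := by
    have := φ.length_encode_le hφ
    have hn : P.n = n := by rw [hP]
    rw [hw, inputWord, List.length_cons, List.length_cons, List.length_cons, hn]
    rcases Nat.eq_zero_or_pos φ.size with h | h
    · rw [h] at this ⊢
      simp at this ⊢
      omega
    · rw [if_neg (by omega)] at this
      rw [max_eq_left h]
      nlinarith
  have hY := P.len_Y_le hs hL
  have hS := P.steps_le hs hL
  have hτ := size_sq_le P.t
  have hn : P.n = n := by rw [hP]
  have hk : P.k = k := by rw [hP]
  have ht : P.t = t := by rw [hP]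
  have hqq : P.q = q := by rw [hP]
  rw [hn, hk, ht, hqq] at hY hS
  rw [ht] at hτ
  generalize max φ.size 1 = s at *
  generalize max t 1 = u at *
  generalize Nat.size (t + 2) = τ at *
  have key : T ≤ 12 * (21 * q + 60) ^ 2 * (1197 * q + 780) * (n + k + 1) ^ 8 * u ^ 2 * 4 ^ k *
      s ^ 3 := by
    calc T ≤ N * len P.Y ^ 2 := hTN
      _ ≤ (1197 * q + 780) * ((n + k + 1) ^ 2 * s * u * 4 ^ k) *
          ((21 * q + 60) * ((n + k + 1) ^ 3 * s * τ)) ^ 2 :=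
          Nat.mul_le_mul (hN.trans hS) (Nat.pow_le_pow_left hY 2)
      _ = (21 * q + 60) ^ 2 * (1197 * q + 780) * (n + k + 1) ^ 8 * u * 4 ^ k * s ^ 3 * τ ^ 2 := by
          ring
      _ ≤ (21 * q + 60) ^ 2 * (1197 * q + 780) * (n + k + 1) ^ 8 * u * 4 ^ k * s ^ 3 * (12 * u) :=
          Nat.mul_le_mul_left _ hτ
      _ = _ := by ring
  have hs' : (1 : ℝ) ≤ s := by exact_mod_cast hs
  calc (T : ℝ) ≤ ((12 * (21 * q + 60) ^ 2 * (1197 * q + 780) * (n + k + 1) ^ 8 * u ^ 2 * 4 ^ k *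
        s ^ 3 : ℕ) : ℝ) := by exact_mod_cast key
    _ = ((12 * (21 * q + 60) ^ 2 * (1197 * q + 780) : ℕ) : ℝ) * ((n : ℝ) + k + 1) ^ 8 *
        (u : ℝ) ^ 2 * 4 ^ k * (s : ℝ) ^ 3 := by push_cast; ring
    -- Only `4 ≤ 5.44` and `s ^ 3 ≤ s ^ 4` are used here.
    _ ≤ _ := by
      gcongr
      · norm_num
      · norm_num
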